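/- There is a universal constant $K>0$ such that the following holds. Let $H$ be a real Hilbert space of finite dimension $n$ with orthonormal basis $(e_j)_{j\le n}$, and let $h>0$. Write points of $H^2$ as $X=(x,\xi)$, $Y=(y,\eta)$, with $|X|^2=|x|^2+|\xi|^2$, identify $X$ with $x+i\xi$, and set $X\cdot\overline Y=(x+i\xi)\cdot(y-i\eta)$ (the complex bilinear extension of the scalar product of $H$). Let $\Phi:H^2\times H^2\to\mathbb C$ be such that $\Phi(X,Y)$ is holomorphic in $X$ and antiholomorphic in $Y$, and suppose that $$N_h^{(2)}(\Phi)=\sum_{0\le\alpha_j,\beta_j\le 2}N_{\alpha\beta}<\infty,\qquad N_{\alpha\beta}=\Big\|e^{-\frac1{4h}|X-Y|^2}(\partial_x+\partial_y)^\alpha(\partial_\xi+\partial_\eta)^\beta\Phi\Big\|_\infty ,$$ where the sum runs over all multi-indices $\alpha,\beta\in\{0,1,2\}^n$ and the derivatives are taken in the coordinates of the basis $(e_j)$. Let $$K_h^{Beals}(X,Y,Z)=e^{-\frac1h(Z-Y)\cdot(\overline Z-\overline X)-\frac1{2h}|X-Y|^2}.$$ Then: (i) The integral $$(B_h\Phi)(Z)=2^n(2\pi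 h)^{-2n}\int_{H^4}\Phi(X,Y)K_h^{Beals}(X,Y,Z)\,dX\,dY$$ defines a bounded continuous function $B_h\Phi$ on $H^2$, in the following two senses. For each $Z\in H^2$ it is an oscillatory integral: for every Schwartz function $\chi$ on $H^4$ with $\chi(0)=1$, the integral with the additional factor $\chi(\varepsilon X,\varepsilon Y)$ converges absolutely for all $\varepsilon>0$ and tends to $(B_h\Phi)(Z)$ as $\varepsilon\to0^+$. It also holds in the sense of distributions in $Z$: for every $\varphi\in C_c^\infty(H^2)$, $$\int_{H^2}(B_h\Phi)(Z)\varphi(Z)\,dZ=2^n(2\pi h)^{-2n}\int_{H^4}\Phi(X,Y)\Big(\int_{H^2}K_h^{Beals}(X,Y,Z)\varphi(Z)\,dZ\Big)dX\,dY,$$ the integral over $H^4$ being absolutely convergent. Moreover $$\|B_h\Phi\|_\infty\le K^n\sum_{0\le\alpha_j,\beta_j\le2}h^{|\alpha+\beta|/2}N_{\alpha\beta},$$ and in particular $\|B_h\Phi\|_\infty\le K^nN_h^{(2)}(\Phi)$ if $h\le1$. (ii) For every $Z\in H^2$, $(H_{h/2}B_h\Phi)(Z)=\Phi(Z,Z)$,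 where $H_t$ is the heat operator $$(H_tF)(X)=(2\pi t)^{-n}\int_{H^2}F(X+Y)e^{-|Y|^2/(2t)}\,dY.$$ -/

import Mathlib

open scoped ENNReal Topology InnerProductSpace ContDiff SchwartzMap BoundedContinuousFunction

noncomputable section

namespace BealsWeyl

variable {H : Type*} [NormedAddCommGroup H] [InnerProductSpace ℝ H]

/-- The Hilbert norm squared of `X = (x, ξ) ∈ H²`, i.e. `|X|² = |x|² + |ξ|²`
(Mathlib's norm on the product type is the sup norm, which is not used for this purpose). -/
def normSq (X : H × H) : ℝ := ‖X.1‖ ^ 2 + ‖X.2‖ ^ 2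

/-- `X · Ȳ = (x + iξ) · (y - iη)` for `X = (x, ξ)`, `Y = (y, η)`, where the dot on the right is
the complex bilinear extension of the scalar product of `H`. -/
def cdot (X Y : H × H) : ℂ :=
  ((⟪X.1, Y.1⟫_ℝ + ⟪X.2, Y.2⟫_ℝ : ℝ) : ℂ)
    + ((⟪X.2, Y.1⟫_ℝ - ⟪X.1, Y.2⟫_ℝ : ℝ) : ℂ) * Complex.I

/-- Holomorphy of a function on `H²`, where `(x, ξ)` is identified with `x + iξ`: real
differentiability and the Cauchy-Riemann equations `df(iv) = i df(v)`, with `i(x, ξ) = (-ξ, x)`. -/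
def IsHolomorphic (f : H × H → ℂ) : Prop :=
  Differentiable ℝ f ∧
    ∀ X v : H × H, fderiv ℝ f X (-v.2, v.1) = Complex.I * fderiv ℝ f X v

/-- Antiholomorphy on `H²`: real differentiability and `df(iv) = -i df(v)`. -/
def IsAntiholomorphic (f : H × H → ℂ) : Prop :=
  Differentiable ℝ f ∧
    ∀ X v : H × H, fderiv ℝ f X (-v.2, v.1) = -(Complex.I * fderiv ℝ f X v)

/-- The derivative along the diagonal direction `(v, v)` of `H² × H²`. For `v = (e_j, 0)` it is
`∂_{x_j} + ∂_{y_j}`, and for `v = (0, e_j)` it is `∂_{ξ_j} + ∂_{η_j}`. -/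
def diagDeriv (v : H × H) (F : (H × H) × (H × H) → ℂ) : (H × H) × (H × H) → ℂ :=
  fun p => lineDeriv ℝ F p (v, v)

/-- The composition over `j` of the `α j`-th powers of the derivatives along `(u j, u j)`. -/
def diagMonomial {n : ℕ} (u : Fin n → H × H) (α : Fin n → Fin 3)
    (F : (H × H) × (H × H) → ℂ) : (H × H) × (H × H) → ℂ :=
  (List.finRange n).foldr (fun j G => (diagDeriv (u j))^[(α j : ℕ)] G) F

/-- `(∂_x + ∂_y)^α (∂_ξ + ∂_η)^β Φ`, in the coordinates of the orthonormal basis `e`, for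
multi-indices with all entries at most `2`. -/
def diagMultiDeriv {n : ℕ} (e : OrthonormalBasis (Fin n) ℝ H) (α β : Fin n → Fin 3)
    (Φ : (H × H) × (H × H) → ℂ) : (H × H) × (H × H) → ℂ :=
  diagMonomial (fun j => (e j, 0)) α (diagMonomial (fun j => (0, e j)) β Φ)

/-- `‖exp(-|X-Y|²/(4h)) (∂_x + ∂_y)^α (∂_ξ + ∂_η)^β Φ‖_∞`, possibly infinite. -/
def weightedSup {n : ℕ} (h : ℝ) (e : OrthonormalBasis (Fin n) ℝ H) (α β : Fin n → Fin 3)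
    (Φ : (H × H) × (H × H) → ℂ) : ℝ≥0∞ :=
  ⨆ p : (H × H) × (H × H),
    ENNReal.ofReal (Real.exp (-(normSq (p.1 - p.2) / (4 * h))) * ‖diagMultiDeriv e α β Φ p‖)

/-- The norm `N_h^{(2)}(Φ)`: the sum of the weighted sup norms over all pairs of multi-indices
with entries at most `2`. -/
def derivNorm {n : ℕ} (h : ℝ) (e : OrthonormalBasis (Fin n) ℝ H)
    (Φ : (H × H) × (H × H) → ℂ) : ℝ≥0∞ :=
  ∑ α : Fin n → Fin 3, ∑ β : Fin n → Fin 3, weightedSup h e α β Φ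

/-- The same sum, the term of index `(α, β)` being multiplied by `h^{|α+β|/2}`. -/
def scaledDerivNorm {n : ℕ} (h : ℝ) (e : OrthonormalBasis (Fin n) ℝ H)
    (Φ : (H × H) × (H × H) → ℂ) : ℝ≥0∞ :=
  ∑ α : Fin n → Fin 3, ∑ β : Fin n → Fin 3,
    ENNReal.ofReal (√h ^ (∑ j, ((α j : ℕ) + (β j : ℕ)))) * weightedSup h e α β Φ

/-- The kernel `exp(-(1/h) (Z-Y)·(Z̄-X̄) - |X-Y|²/(2h))`. -/
def bealsKernel (h : ℝ) (X Y Z : H × H) : ℂ :=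
  Complex.exp (-(1 / (h : ℂ)) * cdot (Z - Y) (Z - X) - ((normSq (X - Y) / (2 * h) : ℝ) : ℂ))

variable [FiniteDimensional ℝ H] [MeasurableSpace H] [BorelSpace H]

/-- `I` is the value of the oscillatory integral `∫_{H⁴} f`: for every Schwartz cut-off `χ` with
`χ(0) = 1`, the integrals `∫ χ(εX, εY) f(X, Y) dX dY` converge absolutely for all `ε > 0` and
tend to `I` as `ε → 0⁺`. Here `volume` is the Lebesgue measure of the Euclidean space. -/
def IsOscillatoryIntegral (f : (H × H) × (H × H) → ℂ) (I : ℂ) : Prop :=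
  ∀ χ : 𝓢((H × H) × (H × H), ℂ), χ 0 = 1 →
    (∀ ε : ℝ, 0 < ε → MeasureTheory.Integrable (fun p => χ (ε • p) * f p)) ∧
    Filter.Tendsto (fun ε : ℝ => ∫ p, χ (ε • p) * f p) (𝓝[>] 0) (𝓝 I)

/-- `B(Z)` is, for each `Z`, the oscillatory integral
`2ⁿ (2πh)⁻²ⁿ ∫_{H⁴} Φ(X, Y) K_h(X, Y, Z) dX dY`. -/
def IsBealsTransform (n : ℕ) (h : ℝ) (Φ : (H × H) × (H × H) → ℂ) (B : H × H → ℂ) : Prop :=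
  ∀ Z : H × H, IsOscillatoryIntegral
    (fun p => (((2 : ℝ) ^ n / (2 * Real.pi * h) ^ (2 * n) : ℝ) : ℂ)
      * (Φ p * bealsKernel h p.1 p.2 Z)) (B Z)

/-- `B` is the same integral transform in the sense of distributions in `Z`: its pairing with a
test function `φ` is `2ⁿ (2πh)⁻²ⁿ ∫_{H⁴} Φ(X, Y) (∫_{H²} K_h(X, Y, Z) φ(Z) dZ) dX dY`, where the
integral over `H⁴` converges absolutely. -/
def IsBealsTransformDistrib (n : ℕ) (h : ℝ) (Φ : (H × H) × (H × H) → ℂ) (B : H × H → ℂ) : Prop :=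
  ∀ φ : H × H → ℂ, ContDiff ℝ ∞ φ → HasCompactSupport φ →
    MeasureTheory.Integrable
      (fun p : (H × H) × (H × H) => Φ p * ∫ Z, bealsKernel h p.1 p.2 Z * φ Z) ∧
    ∫ Z, B Z * φ Z = (((2 : ℝ) ^ n / (2 * Real.pi * h) ^ (2 * n) : ℝ) : ℂ)
      * ∫ p : (H × H) × (H × H), Φ p * ∫ Z, bealsKernel h p.1 p.2 Z * φ Z

/-- The centred Gaussian measure of variance `t` on `H²`, of real dimension `2 dim H`: density
`(2πt)^{-dim H} exp(-|Y|²/(2t))` with respect to the Lebesgue measure. -/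
def gaussianMeasure (t : ℝ) : MeasureTheory.Measure (H × H) :=
  MeasureTheory.volume.withDensity fun Y =>
    ENNReal.ofReal (Real.exp (-(normSq Y / (2 * t)))
      / (2 * Real.pi * t) ^ Module.finrank ℝ H)

/-- The heat operator `(H_t F)(X) = ∫ F(X + Y) dμ_t(Y)`. -/
def heatOp (t : ℝ) (F : H × H → ℂ) (X : H × H) : ℂ :=
  ∫ Y, F (X + Y) ∂(gaussianMeasure t : MeasureTheory.Measure (H × H))

end BealsWeyl

end

noncomputable section

open MeasureTheory

set_option linter.unusedSectionVars false

namespace BealsWeyl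

/-! ### The Hermitian form on `H²` and the kernel in centred variables. -/

section Algebra

variable {H : Type*} [NormedAddCommGroup H] [InnerProductSpace ℝ H]

/-! Put `V = (X - Y) / 2` and `M = (X + Y) / 2 - Z`. In these variables the kernel is `exp(-(|M|² +
|V|²)/h)` times the phase `exp((2i/h) Im(V·M̄))` (`bealsKernel_eq_centredKernel`). The growth
`exp(|X - Y|²/(4h)) = exp(|V|²/h)` allowed for `Φ` and its diagonal derivatives cancels the Gaussian
in `V` exactly. A Gaussian in `M` remains, with no absolute decay in `V`.

Decay in `V` comes from the phase. It is linear in `M`, with frequencies given by the coordinates of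
`V`, and a derivative in `M` moves `X` and `Y` together, so it acts on `Φ` as a diagonal derivative.
Applying `1 - ∂²` once in each of the `2n` coordinates, scaled by `√h`, yields the factor `∏ (1 +
κ_i²)⁻¹`, integrable in `V`, and costs at most two derivatives per coordinate, each with a factor
`√h`. This is `prod_mul_norm_integral_gaussian_planeWave_le`, transported to `H²` in
`norm_integral_mul_centredKernel_le`. Hence the iterated integral, over `M` and then over `V`,
converges; it defines `bealsTransform`, with a bound exponential in `n`.

These integrations by parts need a smooth `Φ`, while the hypotheses give differentiability only in
each variable separately. The mean value property against Gaussians provides a double reproducing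
formula, which writes `Φ` as an integral of exponentials and so makes it smooth
(`contDiff_of_entireOnLines`).

The oscillatory meaning follows by dominated convergence, because the cut-offs `χ(εX, εY)` have
mixed derivatives bounded uniformly for `|ε| ≤ 1` (`exists_norm_cutoff_le`). For the distributional
meaning, the decay in `V` is obtained from the derivatives of the test function instead, and
Fubini's theorem applies (`integrable_mul_kernelPairing`, `integral_bealsTransform_mul`).

For the heat identity the same Fubini formula is applied to a Gaussian centred at `Z`. Its pairing
with the kernel is explicit (`kernelPairing_heatKernel`). What remains is `Φ(Z + X, Z + Y)
exp(X·Ȳ/(2h))` against a product Gaussian, and the mean value property in `X`, then in `Y`, leaves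
`Φ(Z, Z)`. -/

/-- Multiplication by the complex number `z` on `H²`, where `(x, ξ)` is identified with
`x + iξ`. -/
def cmul (z : ℂ) (X : H × H) : H × H := (z.re • X.1 - z.im • X.2, z.re • X.2 + z.im • X.1)

lemma cdot_add_left (X X' Y : H × H) : cdot (X + X') Y = cdot X Y + cdot X' Y := by
  simp only [cdot, Prod.fst_add, Prod.snd_add, inner_add_left]; push_cast; ring

lemma cdot_add_right (X Y Y' : H × H) : cdot X (Y + Y') = cdot X Y + cdot X Y' := by
  simp only [cdot, Prod.fst_add, Prod.snd_add, inner_add_right]; push_cast; ring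

lemma cdot_neg_left (X Y : H × H) : cdot (-X) Y = -cdot X Y := by
  simp only [cdot, Prod.fst_neg, Prod.snd_neg, inner_neg_left]; push_cast; ring

lemma cdot_neg_right (X Y : H × H) : cdot X (-Y) = -cdot X Y := by
  simp only [cdot, Prod.fst_neg, Prod.snd_neg, inner_neg_right]; push_cast; ring

lemma cdot_sub_left (X X' Y : H × H) : cdot (X - X') Y = cdot X Y - cdot X' Y := by
  rw [sub_eq_add_neg, cdot_add_left, cdot_neg_left, ← sub_eq_add_neg]

lemma cdot_sub_right (X Y Y' : H × H) : cdot X (Y - Y') = cdot X Y - cdot X Y' := by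
  rw [sub_eq_add_neg, cdot_add_right, cdot_neg_right, ← sub_eq_add_neg]

lemma cdot_smul_left (r : ℝ) (X Y : H × H) : cdot (r • X) Y = r * cdot X Y := by
  simp only [cdot, Prod.smul_fst, Prod.smul_snd, real_inner_smul_left]; push_cast; ring

lemma cdot_smul_right (r : ℝ) (X Y : H × H) : cdot X (r • Y) = r * cdot X Y := by
  simp only [cdot, Prod.smul_fst, Prod.smul_snd, real_inner_smul_right]; push_cast; ring

lemma cdot_self (X : H × H) : cdot X X = (normSq X : ℂ) := by
  simp only [cdot, normSq, real_inner_self_eq_norm_sq, real_inner_comm X.1 X.2]; simp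

lemma conj_cdot (X Y : H × H) : (starRingEnd ℂ) (cdot X Y) = cdot Y X := by
  simp only [cdot, map_add, map_mul, Complex.conj_ofReal, Complex.conj_I,
    real_inner_comm X.1, real_inner_comm X.2]
  push_cast; ring

lemma cdot_cmul_left (z : ℂ) (X Y : H × H) : cdot (cmul z X) Y = z * cdot X Y := by
  apply Complex.ext <;>
  simp [cdot, cmul, inner_add_left, inner_sub_left, real_inner_smul_left] <;> ring

lemma normSq_nonneg (X : H × H) : 0 ≤ normSq X := by unfold normSq; positivity

@[simp] lemma normSq_zero : normSq (0 : H × H) = 0 := by simp [normSq]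

@[simp] lemma normSq_neg (X : H × H) : normSq (-X) = normSq X := by simp [normSq]

lemma normSq_smul (r : ℝ) (X : H × H) : normSq (r • X) = r ^ 2 * normSq X := by
  simp [normSq, norm_smul, mul_pow]; ring

lemma normSq_add (X Y : H × H) : normSq (X + Y) = normSq X + normSq Y + 2 * (cdot X Y).re := by
  simp [normSq, cdot, norm_add_sq_real]; ring

lemma normSq_sub (X Y : H × H) : normSq (X - Y) = normSq X + normSq Y - 2 * (cdot X Y).re := by
  simp [normSq, cdot, norm_sub_sq_real]; ring

lemma normSq_cmul (z : ℂ) (X : H × H) : normSq (cmul z X) = ‖z‖ ^ 2 * normSq X := by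
  have := norm_add_sq_real (z.re • X.2) (z.im • X.1)
  have h2 := norm_sub_sq_real (z.re • X.1) (z.im • X.2)
  rw [← Complex.normSq_eq_norm_sq, Complex.normSq_apply]
  simp only [normSq, cmul, this, h2, norm_smul, mul_pow, real_inner_smul_left,
    real_inner_smul_right, Real.norm_eq_abs, sq_abs, real_inner_comm X.1 X.2]
  ring

/-- The norm of the product type is the sup norm; this comparison lets the Gaussians absorb
exponentials of it. -/
lemma norm_sq_le_normSq (X : H × H) : ‖X‖ ^ 2 ≤ normSq X := by
  rcases max_choice ‖X.1‖ ‖X.2‖ with h | h <;> rw [Prod.norm_def, h, normSq] <;>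
    nlinarith [sq_nonneg ‖X.1‖, sq_nonneg ‖X.2‖]

lemma norm_cdot_le (X Y : H × H) : ‖cdot X Y‖ ≤ 4 * (‖X‖ * ‖Y‖) := by
  have h11 := abs_real_inner_le_norm X.1 Y.1
  have h22 := abs_real_inner_le_norm X.2 Y.2
  have h12 := abs_real_inner_le_norm X.1 Y.2
  have h21 := abs_real_inner_le_norm X.2 Y.1
  have b : ∀ a b : ℝ, a ≤ ‖X‖ → b ≤ ‖Y‖ → 0 ≤ b → a * b ≤ ‖X‖ * ‖Y‖ := fun a b h1 h2 h3 =>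
    mul_le_mul h1 h2 h3 (norm_nonneg _)
  have b11 := b _ _ (norm_fst_le X) (norm_fst_le Y) (norm_nonneg _)
  have b12 := b _ _ (norm_fst_le X) (norm_snd_le Y) (norm_nonneg _)
  have b21 := b _ _ (norm_snd_le X) (norm_fst_le Y) (norm_nonneg _)
  have b22 := b _ _ (norm_snd_le X) (norm_snd_le Y) (norm_nonneg _)
  unfold cdot
  refine (norm_add_le _ _).trans ?_
  rw [norm_mul, Complex.norm_I, mul_one, Complex.norm_real, Complex.norm_real, Real.norm_eq_abs,
    Real.norm_eq_abs]
  have t1 := abs_add_le ⟪X.1, Y.1⟫_ℝ ⟪X.2, Y.2⟫_ℝ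
  have t2 := abs_sub ⟪X.2, Y.1⟫_ℝ ⟪X.1, Y.2⟫_ℝ
  linarith

/-- `cdot`, as a continuous real bilinear map. -/
def cdotL : (H × H) →L[ℝ] (H × H) →L[ℝ] ℂ :=
  LinearMap.mkContinuous₂
    (LinearMap.mk₂ ℝ cdot cdot_add_left (fun r X Y => by simp [cdot_smul_left])
      cdot_add_right (fun r X Y => by simp [cdot_smul_right])) 4
    (fun X Y => by simpa [mul_assoc] using norm_cdot_le X Y)

@[simp] lemma cdotL_apply (X Y : H × H) : cdotL X Y = cdot X Y := rfl

lemma continuous_cdot : Continuous fun p : (H × H) × (H × H) => cdot p.1 p.2 := by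
  unfold cdot; fun_prop

@[fun_prop]
lemma Continuous.cdot {α : Type*} [TopologicalSpace α] {f g : α → H × H} (hf : Continuous f)
    (hg : Continuous g) : Continuous fun a => cdot (f a) (g a) :=
  continuous_cdot.comp (hf.prodMk hg)

lemma continuous_normSq : Continuous (normSq : H × H → ℝ) := by
  unfold normSq; fun_prop

@[fun_prop]
lemma Continuous.normSq {α : Type*} [TopologicalSpace α] {f : α → H × H} (hf : Continuous f) :
    Continuous fun a => normSq (f a) :=
  continuous_normSq.comp hf

lemma continuous_cmul : Continuous fun p : ℂ × (H × H) => cmul p.1 p.2 := by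
  unfold cmul; fun_prop

/-- The phase space kernel in the centred variables `V = (X - Y) / 2`, `M = (X + Y) / 2 - Z`. -/
def centredKernel (h : ℝ) (V M : H × H) : ℂ :=
  Complex.exp (((-((normSq M + normSq V) / h) : ℝ) : ℂ)
    + ((2 / h * (cdot V M).im : ℝ) : ℂ) * Complex.I)

/-- Here `(Z - Y)·(Z̄ - X̄) = |M|² - |V|² - 2i Im(V·M̄)`. The wrong sign of `|V|²` is corrected by
`|X - Y|²/(2h) = 2|V|²/h`, and the cross terms are purely imaginary. -/
lemma bealsKernel_eq_centredKernel {h : ℝ} (hh : h ≠ 0) (Z V M : H × H) :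
    bealsKernel h (Z + M + V) (Z + M - V) Z = centredKernel h V M := by
  have h1 : cdot (Z - (Z + M - V)) (Z - (Z + M + V))
      = ((normSq M - normSq V : ℝ) : ℂ) - ((2 * (cdot V M).im : ℝ) : ℂ) * Complex.I := by
    have e1 : Z - (Z + M - V) = V - M := by abel
    have e2 : Z - (Z + M + V) = -(V + M) := by abel
    have e3 := Complex.sub_conj (cdot V M)
    rw [conj_cdot] at e3
    rw [e1, e2, cdot_neg_right, cdot_sub_left, cdot_add_right, cdot_add_right, cdot_self,
      cdot_self]
    push_cast
    push_cast at e3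
    linear_combination -e3
  have h2 : Z + M + V - (Z + M - V) = (2 : ℝ) • V := by rw [two_smul]; abel
  rw [bealsKernel, centredKernel, h1, h2, normSq_smul]
  congr 1
  have : (h : ℂ) ≠ 0 := by exact_mod_cast hh
  push_cast
  field_simp
  ring

lemma norm_centredKernel (h : ℝ) (V M : H × H) :
    ‖centredKernel h V M‖ = Real.exp (-(normSq M / h)) * Real.exp (-(normSq V / h)) := by
  rw [centredKernel, Complex.norm_exp, ← Real.exp_add]
  congr 1
  simp
  ring

lemma continuous_centredKernel (h : ℝ) :
    Continuous fun p : (H × H) × (H × H) => centredKernel h p.1 p.2 := by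
  unfold centredKernel
  fun_prop

end Algebra

end BealsWeyl
end

noncomputable section

open MeasureTheory

namespace BealsWeyl

/-! ### Rotation invariance and the mean value property for Gaussians. -/

section MeanValue

variable {H : Type*} [NormedAddCommGroup H] [InnerProductSpace ℝ H]

lemma cmul_add (z : ℂ) (X Y : H × H) : cmul z (X + Y) = cmul z X + cmul z Y := by
  ext <;> simp only [cmul, Prod.fst_add, Prod.snd_add, smul_add] <;> abel

lemma cmul_smul (z : ℂ) (r : ℝ) (X : H × H) : cmul z (r • X) = r • cmul z X := by
  ext <;> simp only [cmul, Prod.smul_fst, Prod.smul_snd, smul_sub, smul_add, smul_comm r]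

lemma cmul_cmul (z w : ℂ) (X : H × H) : cmul z (cmul w X) = cmul (z * w) X := by
  ext <;> simp only [cmul, Complex.mul_re, Complex.mul_im] <;> module

@[simp] lemma cmul_one (X : H × H) : cmul 1 X = X := by simp [cmul]

@[simp] lemma cmul_zero_left (X : H × H) : cmul 0 X = 0 := by simp [cmul]

/-- `cmul z` as a real linear map. -/
def cmulLin (z : ℂ) : (H × H) →ₗ[ℝ] (H × H) where
  toFun := cmul z
  map_add' := cmul_add z
  map_smul' := cmul_smul z

/-- Complex conjugation on `H²`. -/
def conjEquiv : (H × H) ≃ₗ[ℝ] (H × H) :=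
  (LinearEquiv.refl ℝ H).prodCongr (LinearEquiv.neg ℝ)

/-- Conjugation intertwines multiplication by `z` and by `z̄`, so their determinants agree; the
product of the two maps is multiplication by `|z|² = 1`, hence the determinant squares to `1`. -/
lemma abs_det_cmulLin [FiniteDimensional ℝ H] {z : ℂ} (hz : ‖z‖ = 1) :
    |LinearMap.det (cmulLin z : (H × H) →ₗ[ℝ] (H × H))| = 1 := by
  have h1 : (conjEquiv (H := H) : (H × H) →ₗ[ℝ] (H × H)) ∘ₗ cmulLin z ∘ₗ
      (conjEquiv (H := H)).symm = cmulLin ((starRingEnd ℂ) z) := by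
    ext x <;> simp [conjEquiv, cmulLin, cmul]
  have h2 : (cmulLin z : (H × H) →ₗ[ℝ] (H × H)) ∘ₗ cmulLin ((starRingEnd ℂ) z)
      = LinearMap.id := by
    apply LinearMap.ext
    intro X
    change cmul z (cmul _ X) = X
    rw [cmul_cmul, Complex.mul_conj, Complex.normSq_eq_norm_sq, hz]
    simp
  have h3 := LinearMap.det_conj (cmulLin z : (H × H) →ₗ[ℝ] (H × H)) conjEquiv
  rw [h1] at h3
  have h4 := congrArg LinearMap.det h2
  rw [LinearMap.det_comp, h3, LinearMap.det_id] at h4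
  rw [← sq_eq_sq₀ (abs_nonneg _) zero_le_one, sq_abs, sq, h4, one_pow]

variable [FiniteDimensional ℝ H] [MeasurableSpace H] [BorelSpace H]

instance isAddHaarMeasure_volume_prod :
    (volume : Measure (H × H)).IsAddHaarMeasure := by
  rw [Measure.volume_eq_prod]; infer_instance

lemma measurePreserving_cmul {z : ℂ} (hz : ‖z‖ = 1) :
    MeasurePreserving (cmul z : H × H → H × H) volume volume := by
  have hd : LinearMap.det (cmulLin z : (H × H) →ₗ[ℝ] (H × H)) ≠ 0 := by
    intro h0
    have := abs_det_cmulLin (H := H) hz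
    rw [h0] at this
    simp at this
  refine ⟨(cmulLin z : (H × H) →ₗ[ℝ] (H × H)).continuous_of_finiteDimensional.measurable, ?_⟩
  have := Measure.map_linearMap_addHaar_eq_smul_addHaar (volume : Measure (H × H)) hd
  rw [abs_inv, abs_det_cmulLin hz] at this
  simpa [cmulLin] using this

lemma measurableEmbedding_cmul {z : ℂ} (hz : ‖z‖ = 1) :
    MeasurableEmbedding (cmul z : H × H → H × H) := by
  have hz0 : z ≠ 0 := by rintro rfl; simp at hz
  let m : H × H ≃ᵐ H × H :=
    { toFun := cmul z
      invFun := cmul z⁻¹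
      left_inv := fun X => by rw [cmul_cmul, inv_mul_cancel₀ hz0, cmul_one]
      right_inv := fun X => by rw [cmul_cmul, mul_inv_cancel₀ hz0, cmul_one]
      measurable_toFun := (continuous_cmul.comp (by fun_prop : Continuous fun X : H × H => (z, X))).measurable
      measurable_invFun := (continuous_cmul.comp (by fun_prop : Continuous fun X : H × H => (z⁻¹, X))).measurable }
  exact m.measurableEmbedding

lemma integrable_exp_neg_normSq {s : ℝ} (hs : 0 < s) :
    Integrable fun X : H × H => Real.exp (-(normSq X / s)) := by
  have h1 : Integrable fun x : H => Real.exp (-(‖x‖ ^ 2 / s)) := by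
    have := (GaussianFourier.integrable_cexp_neg_mul_sq_norm_add (V := H) (b := ((s⁻¹ : ℝ) : ℂ))
      (by simpa using hs) 0 0).norm
    refine this.congr (Filter.Eventually.of_forall fun x => ?_)
    simp only [Complex.norm_exp]
    congr 1
    simp [← Complex.ofReal_pow]
    simp [div_eq_inv_mul]
  refine (h1.mul_prod h1).congr (Filter.Eventually.of_forall fun X => ?_)
  simp only [← Real.exp_add, normSq]
  congr 1; ring

lemma integral_exp_neg_normSq {s : ℝ} (hs : 0 < s) :
    ∫ X : H × H, Real.exp (-(normSq X / s)) = (Real.pi * s) ^ Module.finrank ℝ H := by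
  have h1 := GaussianFourier.integral_rexp_neg_mul_sq_norm (V := H) (inv_pos.2 hs)
  have h2 : ∀ X : H × H, Real.exp (-(normSq X / s))
      = Real.exp (-s⁻¹ * ‖X.1‖ ^ 2) * Real.exp (-s⁻¹ * ‖X.2‖ ^ 2) := fun X => by
    rw [← Real.exp_add, normSq]; congr 1; field_simp; ring
  simp_rw [h2]
  rw [Measure.volume_eq_prod, integral_prod_mul (fun x : H => Real.exp (-s⁻¹ * ‖x‖ ^ 2))
    (fun x : H => Real.exp (-s⁻¹ * ‖x‖ ^ 2)), h1, ← Real.rpow_add (by positivity),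
    div_inv_eq_mul, ← Real.rpow_natCast]
  congr 1; ring

/-- The mean value property: an entire function integrates against a centred Gaussian to a
multiple of its value at the origin. -/
lemma integral_mul_gaussian_of_entire {s : ℝ} (hs : 0 < s) {g : H × H → ℂ} (hg : Continuous g)
    (hol : ∀ X, Differentiable ℂ fun z => g (cmul z X))
    (hint : Integrable fun X => g X * (Real.exp (-(normSq X / s)) : ℂ)) :
    ∫ X, g X * (Real.exp (-(normSq X / s)) : ℂ)
      = ((Real.pi * s) ^ Module.finrank ℝ H : ℝ) * g 0 := by
  set γ : H × H → ℂ := fun X => (Real.exp (-(normSq X / s)) : ℂ) with hγ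
  have hγc : Continuous γ := by rw [hγ]; fun_prop
  have hγr : ∀ z : ℂ, ‖z‖ = 1 → ∀ X, γ (cmul z X) = γ X := fun z hz X => by
    simp [hγ, normSq_cmul, hz]
  -- Rotation by `e^{iθ}` preserves both Lebesgue measure and the Gaussian, so the integral may be
  -- averaged over `θ`.
  have hrot : ∀ θ : ℝ, ∫ X, g (cmul (circleMap 0 1 θ) X) * γ X = ∫ X, g X * γ X := fun θ => by
    have hz : ‖circleMap 0 1 θ‖ = 1 := by simp
    have := (measurePreserving_cmul hz).integral_comp (measurableEmbedding_cmul hz)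
      (fun X => g X * γ X)
    simpa only [hγr _ hz] using this
  have hmv : ∀ X, ∫ θ in (0 : ℝ)..2 * Real.pi, g (cmul (circleMap 0 1 θ) X)
      = 2 * Real.pi * g 0 := fun X => by
    have := DiffContOnCl.circleAverage (f := fun z => g (cmul z X)) (c := 0) (R := 1)
      (hol X).diffContOnCl
    rw [Real.circleAverage] at this
    simp only [cmul_zero_left] at this
    rw [← this]
    simp
    field_simp
  have hc2 : Continuous fun p : ℝ × (H × H) => g (cmul (circleMap 0 1 p.1) p.2) * γ p.2 := by
    refine (hg.comp (continuous_cmul.comp (Continuous.prodMk ?_ continuous_snd))).mul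
      (hγc.comp continuous_snd)
    exact (continuous_circleMap 0 1).comp continuous_fst
  have hI2 : Integrable (fun p : ℝ × (H × H) => g (cmul (circleMap 0 1 p.1) p.2) * γ p.2)
      ((volume.restrict (Set.uIoc 0 (2 * Real.pi))).prod volume) := by
    rw [integrable_prod_iff hc2.aestronglyMeasurable]
    have hnorm : ∀ θ : ℝ, (fun X => g (cmul (circleMap 0 1 θ) X) * γ X)
        = (fun X => g X * γ X) ∘ cmul (circleMap 0 1 θ) := fun θ => by
      ext X; simp [hγr (circleMap 0 1 θ) (by simp)]
    refine ⟨Filter.Eventually.of_forall fun θ => ?_, ?_⟩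
    · have hz : ‖circleMap 0 1 θ‖ = 1 := by simp
      simp only
      rw [hnorm]
      exact (measurePreserving_cmul hz).integrable_comp_of_integrable hint
    · have : ∀ θ : ℝ, ∫ X, ‖g (cmul (circleMap 0 1 θ) X) * γ X‖ = ∫ X, ‖g X * γ X‖ := fun θ => by
        have hz : ‖circleMap 0 1 θ‖ = 1 := by simp
        have := (measurePreserving_cmul hz).integral_comp (measurableEmbedding_cmul hz)
          (fun X => ‖g X * γ X‖)
        simpa only [hγr _ hz] using this
      simp only [this]
      rw [Set.uIoc_of_le (by positivity)]
      exact integrable_const _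
  -- After the exchange, the average over `θ` at fixed `X` is a circle average on a complex line
  -- through the origin, equal to `g 0` by Cauchy.
  have hswap := intervalIntegral_integral_swap (μ := (volume : Measure (H × H)))
    (a := 0) (b := 2 * Real.pi) (f := fun θ X => g (cmul (circleMap 0 1 θ) X) * γ X) hI2
  simp_rw [hrot, intervalIntegral.integral_mul_const, hmv] at hswap
  rw [intervalIntegral.integral_const, integral_const_mul] at hswap
  have hγi : ∫ X, γ X = (((Real.pi * s) ^ Module.finrank ℝ H : ℝ) : ℂ) := by
    rw [← integral_exp_neg_normSq (H := H) hs, hγ]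
    exact integral_ofReal
  rw [hγi] at hswap
  have hpi : (Real.pi : ℂ) ≠ 0 := by exact_mod_cast Real.pi_ne_zero
  simp only [sub_zero, Complex.real_smul] at hswap
  apply mul_left_cancel₀ (mul_ne_zero two_ne_zero hpi)
  push_cast at hswap
  change _ * ∫ X, g X * γ X = _
  rw [hswap]
  push_cast
  ring

lemma integral_mul_gaussian_of_conj_entire {s : ℝ} (hs : 0 < s) {g : H × H → ℂ}
    (hg : Continuous g)
    (hol : ∀ X, Differentiable ℂ fun z => (starRingEnd ℂ) (g (cmul z X)))
    (hint : Integrable fun X => g X * (Real.exp (-(normSq X / s)) : ℂ)) :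
    ∫ X, g X * (Real.exp (-(normSq X / s)) : ℂ)
      = ((Real.pi * s) ^ Module.finrank ℝ H : ℝ) * g 0 := by
  have key := integral_mul_gaussian_of_entire hs (g := fun X => (starRingEnd ℂ) (g X))
    (by fun_prop) hol ?_
  · apply (starRingEnd ℂ).injective
    rw [← integral_conj]
    simpa [map_mul, ← Complex.exp_conj] using key
  · have := (Complex.conjLIE.integrable_comp_iff).2 hint
    simpa [map_mul, ← Complex.exp_conj, Function.comp_def] using this

end MeanValue

end BealsWeyl
end

noncomputable section

open MeasureTheory

set_option linter.unusedSectionVars false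

namespace BealsWeyl

/-! ### Smoothness of integrals of exponentials in a parameter. -/

section ExponentialIntegral

variable {P Q : Type*} [NormedAddCommGroup P] [NormedSpace ℝ P] [FiniteDimensional ℝ P]
  [NormedAddCommGroup Q] [NormedSpace ℝ Q] [FiniteDimensional ℝ Q] [MeasurableSpace Q]
  [BorelSpace Q]

lemma integrable_mul_cexp (μ : Measure Q) (L : Q →L[ℝ] P →L[ℝ] ℂ) {G : Q → ℂ}
    (hG : AEStronglyMeasurable G μ)
    (hI : ∀ R : ℝ, Integrable (fun q => Real.exp (R * ‖q‖) * ‖G q‖) μ) (p : P) :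
    Integrable (fun q => G q * Complex.exp (L q p)) μ := by
  refine (hI (‖L‖ * ‖p‖)).mono'
    (hG.mul (by fun_prop : Continuous fun q => Complex.exp (L q p)).aestronglyMeasurable)
    (Filter.Eventually.of_forall fun q => ?_)
  rw [norm_mul, mul_comm, Complex.norm_exp]
  gcongr
  exact (Complex.re_le_norm _).trans ((L.le_opNorm₂ q p).trans_eq (by ring))

/-- Both the factor `‖q‖` produced by differentiation and the variation of `p` in a unit ball only
enlarge the rate `R`; this is why integrability is assumed for every `R`. -/
lemma hasFDerivAt_integral_mul_cexp (μ : Measure Q) (L : Q →L[ℝ] P →L[ℝ] ℂ) {G : Q → ℂ}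
    (hG : AEStronglyMeasurable G μ)
    (hI : ∀ R : ℝ, Integrable (fun q => Real.exp (R * ‖q‖) * ‖G q‖) μ) (p₀ : P) :
    Integrable (fun q => (G q * Complex.exp (L q p₀)) • L q) μ ∧
    HasFDerivAt (fun p => ∫ q, G q * Complex.exp (L q p) ∂μ)
      (∫ q, (G q * Complex.exp (L q p₀)) • L q ∂μ) p₀ := by
  have hmeas : ∀ p, AEStronglyMeasurable (fun q => G q * Complex.exp (L q p)) μ := fun p =>
    hG.mul (by fun_prop : Continuous fun q => Complex.exp (L q p)).aestronglyMeasurable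
  have hexp : ∀ q p, ‖Complex.exp (L q p)‖ ≤ Real.exp (‖L‖ * ‖p‖ * ‖q‖) := fun q p => by
    rw [Complex.norm_exp]
    apply Real.exp_le_exp.2
    calc (L q p).re ≤ ‖L q p‖ := Complex.re_le_norm _
      _ ≤ ‖L‖ * ‖q‖ * ‖p‖ := L.le_opNorm₂ q p
      _ = _ := by ring
  have hF'meas : AEStronglyMeasurable (fun q => (G q * Complex.exp (L q p₀)) • L q) μ :=
    (hmeas p₀).smul L.continuous.aestronglyMeasurable
  have hbound : ∀ q, ∀ p ∈ Metric.ball p₀ 1, ‖(G q * Complex.exp (L q p)) • L q‖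
      ≤ ‖L‖ * (Real.exp ((‖L‖ * (‖p₀‖ + 1) + 1) * ‖q‖) * ‖G q‖) := fun q p hp => by
    have hp' : ‖p‖ ≤ ‖p₀‖ + 1 := by
      have h1 := norm_le_norm_add_norm_sub' p p₀
      have h2 := mem_ball_iff_norm.1 hp
      linarith
    have h1 : ‖q‖ ≤ Real.exp ‖q‖ := (Real.add_one_le_exp _).trans' (by linarith)
    have h2 : ‖L q‖ ≤ ‖L‖ * Real.exp ‖q‖ :=
      (L.le_opNorm q).trans (mul_le_mul_of_nonneg_left h1 (norm_nonneg _))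
    have h3 : ‖Complex.exp (L q p)‖ ≤ Real.exp (‖L‖ * (‖p₀‖ + 1) * ‖q‖) :=
      (hexp q p).trans (Real.exp_le_exp.2 (by gcongr))
    rw [norm_smul, norm_mul, add_mul, Real.exp_add, one_mul]
    calc ‖G q‖ * ‖Complex.exp (L q p)‖ * ‖L q‖
        ≤ ‖G q‖ * Real.exp (‖L‖ * (‖p₀‖ + 1) * ‖q‖) * (‖L‖ * Real.exp ‖q‖) := by gcongr
      _ = _ := by ring
  have hbi : Integrable (fun q => ‖L‖ * (Real.exp ((‖L‖ * (‖p₀‖ + 1) + 1) * ‖q‖) * ‖G q‖)) μ :=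
    (hI _).const_mul _
  refine ⟨hbi.mono' hF'meas (Filter.Eventually.of_forall fun q =>
    hbound q p₀ (Metric.mem_ball_self one_pos)), ?_⟩
  refine hasFDerivAt_integral_of_dominated_of_fderiv_le
    (F' := fun p q => (G q * Complex.exp (L q p)) • L q)
    (Metric.ball_mem_nhds p₀ one_pos) (Filter.Eventually.of_forall hmeas) ?_ hF'meas
    (Filter.Eventually.of_forall hbound) hbi ?_
  · exact integrable_mul_cexp μ L hG hI p₀
  · refine Filter.Eventually.of_forall fun q p _ => ?_
    have := ((L q).hasFDerivAt (x := p)).cexp.const_mul (G q)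
    rwa [smul_smul] at this

/-- A directional derivative replaces the density `G q` by `G q * L q v`, which satisfies the same
hypotheses. The induction therefore runs over all densities at once. -/
lemma contDiff_integral_mul_cexp (μ : Measure Q) (L : Q →L[ℝ] P →L[ℝ] ℂ) (k : ℕ) :
    ∀ {G : Q → ℂ}, AEStronglyMeasurable G μ →
    (∀ R : ℝ, Integrable (fun q => Real.exp (R * ‖q‖) * ‖G q‖) μ) →
    ContDiff ℝ k fun p => ∫ q, G q * Complex.exp (L q p) ∂μ := by
  induction k with
  | zero =>
    intro G hG hI
    refine contDiff_zero.2 (continuous_iff_continuousAt.2 fun p => ?_)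
    exact (hasFDerivAt_integral_mul_cexp μ L hG hI p).2.continuousAt
  | succ k ih =>
    intro G hG hI
    have hd := hasFDerivAt_integral_mul_cexp μ L hG hI
    rw [Nat.cast_add, Nat.cast_one, contDiff_succ_iff_fderiv_apply]
    refine ⟨fun p => (hd p).2.differentiableAt, by simp, fun v => ?_⟩
    have hv : (fun p => fderiv ℝ (fun p => ∫ q, G q * Complex.exp (L q p) ∂μ) p v)
        = fun p => ∫ q, (G q * L q v) * Complex.exp (L q p) ∂μ := by
      ext p
      rw [(hd p).2.fderiv, ContinuousLinearMap.integral_apply (hd p).1]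
      refine integral_congr_ae (Filter.Eventually.of_forall fun q => ?_)
      simp only [FunLike.coe_smul, Pi.smul_apply, smul_eq_mul]
      ring
    rw [hv]
    have hcv : Continuous fun q => L q v := by fun_prop
    refine ih (hG.mul hcv.aestronglyMeasurable) fun R => ?_
    refine ((hI (R + 1)).const_mul (‖L‖ * ‖v‖)).mono' ?_ (Filter.Eventually.of_forall fun q => ?_)
    · exact ((by fun_prop : Continuous fun q : Q => Real.exp (R * ‖q‖)).aestronglyMeasurable).mul
        (hG.mul hcv.aestronglyMeasurable).norm
    · have h1 : ‖q‖ ≤ Real.exp ‖q‖ := (Real.add_one_le_exp _).trans' (by linarith)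
      have h2 : ‖L q v‖ ≤ ‖L‖ * Real.exp ‖q‖ * ‖v‖ :=
        (L.le_opNorm₂ q v).trans (by gcongr)
      rw [add_mul, one_mul, Real.exp_add, norm_mul, norm_norm, norm_mul,
        Real.norm_of_nonneg (Real.exp_pos _).le]
      calc Real.exp (R * ‖q‖) * (‖G q‖ * ‖L q v‖)
          ≤ Real.exp (R * ‖q‖) * (‖G q‖ * (‖L‖ * Real.exp ‖q‖ * ‖v‖)) := by gcongr
        _ = _ := by ring

end ExponentialIntegral

/-! ### Holomorphy along complex lines and reproducing formulas. -/

section Holomorphic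

variable {H : Type*} [NormedAddCommGroup H] [InnerProductSpace ℝ H]

/-- A continuous function whose restrictions to all complex lines of `H²` are entire. -/
def EntireOnLines (f : H × H → ℂ) : Prop :=
  Continuous f ∧ ∀ A X, Differentiable ℂ fun z => f (A + cmul z X)

lemma IsHolomorphic.entireOnLines {f : H × H → ℂ} (hf : IsHolomorphic f) : EntireOnLines f := by
  refine ⟨hf.1.continuous, fun A X z => ?_⟩
  let ℓ : ℂ →L[ℝ] H × H := Complex.reCLM.smulRight X + Complex.imCLM.smulRight (-X.2, X.1)
  have hℓ : ∀ w, ℓ w = cmul w X := fun w => by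
    ext <;> simp [ℓ, cmul, sub_eq_add_neg]
  have hd : HasFDerivAt (fun w => f (A + cmul w X)) ((fderiv ℝ f (A + cmul z X)).comp ℓ) z := by
    have h1 : HasFDerivAt (fun w => A + cmul w X) ℓ z := by
      simpa only [hℓ] using (ℓ.hasFDerivAt (x := z)).const_add A
    exact (hf.1 (A + cmul z X)).hasFDerivAt.comp z h1
  rw [differentiableAt_complex_iff_differentiableAt_real]
  refine ⟨hd.differentiableAt, ?_⟩
  rw [hd.fderiv]
  simp only [ContinuousLinearMap.comp_apply, hℓ, cmul_one, smul_eq_mul]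
  rw [← hf.2]
  simp [cmul]

lemma IsAntiholomorphic.conj {f : H × H → ℂ} (hf : IsAntiholomorphic f) :
    IsHolomorphic fun X => (starRingEnd ℂ) (f X) := by
  have hd : ∀ X, HasFDerivAt (fun X => (starRingEnd ℂ) (f X))
      ((Complex.conjCLE : ℂ →L[ℝ] ℂ).comp (fderiv ℝ f X)) X := fun X =>
    (Complex.conjCLE : ℂ →L[ℝ] ℂ).hasFDerivAt.comp X (hf.1 X).hasFDerivAt
  refine ⟨fun X => (hd X).differentiableAt, fun X v => ?_⟩
  rw [(hd X).fderiv]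
  simp [hf.2]

variable [FiniteDimensional ℝ H] [MeasurableSpace H] [BorelSpace H]

/-- The reproducing property of the Gaussian weight `exp(-|W|²/s)` for entire functions. -/
lemma EntireOnLines.integral_mul_cexp {f : H × H → ℂ} (hf : EntireOnLines f) {s : ℝ} (hs : 0 < s)
    (X : H × H)
    (hint : Integrable fun W => f W * Complex.exp ((cdot X W - normSq W) / s)) :
    ∫ W, f W * Complex.exp ((cdot X W - normSq W) / s)
      = ((Real.pi * s) ^ Module.finrank ℝ H : ℝ) * f X := by
  -- Translation by `X` turns the exponent into `-(W·X̄ + |W|²)/s`. The first term is holomorphic in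
  -- `W` and vanishes at `W = 0`, so the mean value property gives `f X`.
  have hrw : ∀ W, f (X + W) * Complex.exp ((cdot X (X + W) - normSq (X + W)) / s)
      = f (X + W) * Complex.exp (-(cdot W X / s)) * (Real.exp (-(normSq W / s)) : ℂ) := fun W => by
    rw [mul_assoc, Complex.ofReal_exp, ← Complex.exp_add, ← cdot_self (X + W), cdot_add_left,
      cdot_add_right W, cdot_self W]
    congr 2
    push_cast
    ring
  rw [← integral_add_left_eq_self _ X]
  have hint' := hint.comp_add_left X
  simp_rw [hrw] at hint' ⊢
  rw [integral_mul_gaussian_of_entire hs (g := fun W => f (X + W) * Complex.exp (-(cdot W X / s)))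
    ?_ ?_ hint']
  · simp [cdot]
  · have := hf.1
    fun_prop
  · intro Y
    simp only [cdot_cmul_left]
    exact (hf.2 X Y).mul (by fun_prop)

lemma EntireOnLines.integral_conj_mul_cexp {f : H × H → ℂ}
    (hf : EntireOnLines fun X => (starRingEnd ℂ) (f X)) {s : ℝ} (hs : 0 < s)
    (X : H × H)
    (hint : Integrable fun W => f W * Complex.exp ((cdot W X - normSq W) / s)) :
    ∫ W, f W * Complex.exp ((cdot W X - normSq W) / s)
      = ((Real.pi * s) ^ Module.finrank ℝ H : ℝ) * f X := by
  have hrw : ∀ W, (starRingEnd ℂ) (f W * Complex.exp ((cdot W X - normSq W) / s))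
      = (starRingEnd ℂ) (f W) * Complex.exp ((cdot X W - normSq W) / s) := fun W => by
    simp [← Complex.exp_conj, conj_cdot]
  have h1 : Integrable fun W => (starRingEnd ℂ) (f W)
      * Complex.exp ((cdot X W - normSq W) / s) := by
    exact ((Complex.conjLIE.integrable_comp_iff).2 hint).congr
      (Filter.Eventually.of_forall fun W => hrw W)
  have h2 := hf.integral_mul_cexp hs X h1
  apply (starRingEnd ℂ).injective
  rw [← integral_conj]
  simp_rw [hrw]
  rw [h2, map_mul, Complex.conj_ofReal]

end Holomorphic

end BealsWeyl
end

noncomputable section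

open MeasureTheory

set_option linter.unusedSectionVars false

namespace BealsWeyl

/-! ### Joint smoothness of the symbol from separate holomorphy. -/

section Smoothness

variable {H : Type*} [NormedAddCommGroup H] [InnerProductSpace ℝ H]
  [FiniteDimensional ℝ H] [MeasurableSpace H] [BorelSpace H]

/-- Completing the square: half of the Gaussian absorbs the linear term and the other half is kept
for integrability. -/
lemma mul_norm_sub_div_le {h : ℝ} (hh : 0 < h) (R x t : ℝ) (hx : x ^ 2 ≤ t) :
    R * x - t / (2 * h) ≤ R ^ 2 * h - t / (4 * h) := by
  have h1 : R * x ≤ R ^ 2 * h + x ^ 2 / (4 * h) := by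
    have : 0 ≤ (2 * h * R - x) ^ 2 / (4 * h) := by positivity
    have e : (2 * h * R - x) ^ 2 / (4 * h) = R ^ 2 * h + x ^ 2 / (4 * h) - R * x := by
      field_simp; ring
    linarith
  have h2 : x ^ 2 / (4 * h) ≤ t / (4 * h) := by gcongr
  have h3 : t / (2 * h) = t / (4 * h) + t / (4 * h) := by field_simp; ring
  linarith

lemma integrable_exp_norm_mul_exp_neg_normSq {h : ℝ} (hh : 0 < h) (R : ℝ) :
    Integrable fun X : H × H => Real.exp (R * ‖X‖) * Real.exp (-(normSq X / (2 * h))) := by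
  refine ((integrable_exp_neg_normSq (H := H) (s := 4 * h) (by positivity)).const_mul
    (Real.exp (R ^ 2 * h))).mono' (by fun_prop) (Filter.Eventually.of_forall fun X => ?_)
  rw [← Real.exp_add, ← Real.exp_add, Real.norm_of_nonneg (Real.exp_pos _).le]
  apply Real.exp_le_exp.2
  linarith [mul_norm_sub_div_le hh R ‖X‖ (normSq X) (norm_sq_le_normSq X)]

lemma integrable_exp_neg_normSq_prod {s : ℝ} (hs : 0 < s) :
    Integrable fun q : (H × H) × (H × H) => Real.exp (-((normSq q.1 + normSq q.2) / s)) := by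
  refine ((integrable_exp_neg_normSq (H := H) hs).mul_prod
    (integrable_exp_neg_normSq (H := H) hs)).congr (Filter.Eventually.of_forall fun q => ?_)
  simp only [← Real.exp_add]
  congr 1; ring

lemma norm_sq_le_normSq_add (q : (H × H) × (H × H)) : ‖q‖ ^ 2 ≤ normSq q.1 + normSq q.2 := by
  have h1 := norm_sq_le_normSq q.1
  have h2 := norm_sq_le_normSq q.2
  rcases max_choice ‖q.1‖ ‖q.2‖ with h | h <;> rw [Prod.norm_def, h] <;>
    nlinarith [sq_nonneg ‖q.1‖, sq_nonneg ‖q.2‖]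

lemma integrable_exp_norm_mul_exp_neg_normSq_prod {h : ℝ} (hh : 0 < h) (R : ℝ) :
    Integrable fun q : (H × H) × (H × H) =>
      Real.exp (R * ‖q‖) * Real.exp (-((normSq q.1 + normSq q.2) / (2 * h))) := by
  refine ((integrable_exp_neg_normSq_prod (H := H) (s := 4 * h) (by positivity)).const_mul
    (Real.exp (R ^ 2 * h))).mono'
    (by fun_prop : Continuous _).aestronglyMeasurable
    (Filter.Eventually.of_forall fun q => ?_)
  rw [← Real.exp_add, ← Real.exp_add, Real.norm_of_nonneg (Real.exp_pos _).le]
  apply Real.exp_le_exp.2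
  linarith [mul_norm_sub_div_le hh R ‖q‖ _ (norm_sq_le_normSq_add q)]

/-- By the parallelogram law, the growth allowed for `Φ` uses only half of the reproducing Gaussian
`exp(-(|X|² + |Y|²)/h)`. -/
lemma normSq_sub_div_le {h : ℝ} (hh : 0 < h) (X Y : H × H) :
    normSq (X - Y) / (4 * h) ≤ (normSq X + normSq Y) / (2 * h) := by
  have h1 : normSq (X - Y) ≤ 2 * (normSq X + normSq Y) := by
    have e1 := normSq_add X Y
    have e2 := normSq_sub X Y
    linarith [normSq_nonneg (X + Y)]
  rw [div_le_div_iff₀ (by positivity) (by positivity)]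
  nlinarith

lemma norm_cexp_cdot_sub_normSq_le {h : ℝ} (hh : 0 < h) (c : ℂ) (X Y : H × H)
    (hc : ‖c‖ ≤ 4 * (‖X‖ * ‖Y‖)) :
    ‖Complex.exp ((c - normSq X) / h)‖
      ≤ Real.exp (4 * ‖Y‖ / h * ‖X‖) * Real.exp (-(normSq X / h)) := by
  rw [Complex.norm_exp, ← Real.exp_add]
  apply Real.exp_le_exp.2
  have h1 : c.re ≤ 4 * (‖X‖ * ‖Y‖) := (Complex.re_le_norm c).trans hc
  have h2 : ((c - normSq X) / h).re = c.re / h - normSq X / h := by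
    rw [Complex.div_ofReal_re]; simp [sub_div]
  have h3 : c.re / h ≤ 4 * (‖X‖ * ‖Y‖) / h := by gcongr
  rw [h2]
  calc c.re / h - normSq X / h ≤ 4 * (‖X‖ * ‖Y‖) / h - normSq X / h := by linarith
    _ = _ := by ring

lemma integrable_mul_cexp_of_le {h : ℝ} (hh : 0 < h) {f : H × H → ℂ} (hf : Continuous f) {C : ℝ}
    (hC : ∀ X, ‖f X‖ ≤ C * Real.exp (normSq X / (2 * h))) (Y : H × H) {c : H × H → ℂ}
    (hcc : Continuous c) (hc : ∀ X, ‖c X‖ ≤ 4 * (‖X‖ * ‖Y‖)) :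
    Integrable fun X => f X * Complex.exp ((c X - normSq X) / h) := by
  refine ((integrable_exp_norm_mul_exp_neg_normSq (H := H) hh (4 * ‖Y‖ / h)).const_mul C).mono'
    (by fun_prop : Continuous _).aestronglyMeasurable
    (Filter.Eventually.of_forall fun X => ?_)
  rw [norm_mul]
  refine (mul_le_mul (hC X) (norm_cexp_cdot_sub_normSq_le hh (c X) X Y (hc X)) (norm_nonneg _)
    ((norm_nonneg _).trans (hC X))).trans_eq ?_
  have : Real.exp (-(normSq X / (2 * h)))
      = Real.exp (normSq X / (2 * h)) * Real.exp (-(normSq X / h)) := by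
    rw [← Real.exp_add]; congr 1; field_simp; ring
  rw [this]; ring

/-- The exponent in the double reproducing formula on `H⁴`. -/
def reproducingPairing (h : ℝ) :
    ((H × H) × (H × H)) →L[ℝ] ((H × H) × (H × H)) →L[ℝ] ℂ :=
  h⁻¹ • (cdotL.flip.bilinearComp (ContinuousLinearMap.fst ℝ (H × H) (H × H))
      (ContinuousLinearMap.fst ℝ (H × H) (H × H))
    + cdotL.bilinearComp (ContinuousLinearMap.snd ℝ (H × H) (H × H))
      (ContinuousLinearMap.snd ℝ (H × H) (H × H)))

lemma reproducingPairing_apply (h : ℝ) (q p : (H × H) × (H × H)) :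
    reproducingPairing h q p = (cdot p.1 q.1 + cdot q.2 p.2) / h := by
  simp [reproducingPairing, div_eq_inv_mul, mul_add]

variable {h : ℝ} {Φ : (H × H) × (H × H) → ℂ} {N : ℝ}

lemma norm_le_exp_normSq_add (hh : 0 < h)
    (hN : ∀ p, ‖Φ p‖ ≤ N * Real.exp (normSq (p.1 - p.2) / (4 * h))) (p : (H × H) × (H × H)) :
    ‖Φ p‖ ≤ N * Real.exp ((normSq p.1 + normSq p.2) / (2 * h)) := by
  have hN0 : 0 ≤ N := by simpa using (norm_nonneg _).trans (hN 0)
  exact (hN p).trans (by gcongr N * Real.exp ?_; exact normSq_sub_div_le hh _ _)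

lemma integrable_mul_cexp_reproducingPairing (h : ℝ) (μ : Measure ((H × H) × (H × H)))
    {G : (H × H) × (H × H) → ℂ} (hG : AEStronglyMeasurable G μ)
    (hI : ∀ R : ℝ, Integrable (fun q => Real.exp (R * ‖q‖) * ‖G q‖) μ)
    (p : (H × H) × (H × H)) :
    Integrable (fun q => G q * Complex.exp (reproducingPairing h q p)) μ :=
  integrable_mul_cexp μ (reproducingPairing h) hG hI p

lemma contDiff_integral_mul_cexp_reproducingPairing (h : ℝ)
    (μ : Measure ((H × H) × (H × H))) (k : ℕ)
    {G : (H × H) × (H × H) → ℂ} (hG : AEStronglyMeasurable G μ)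
    (hI : ∀ R : ℝ, Integrable (fun q => Real.exp (R * ‖q‖) * ‖G q‖) μ) :
    ContDiff ℝ k fun p => ∫ q, G q * Complex.exp (reproducingPairing h q p) ∂μ :=
  contDiff_integral_mul_cexp μ (reproducingPairing h) k hG hI

/-- The density in the double reproducing formula. -/
def reproducingDensity (h : ℝ) (Φ : (H × H) × (H × H) → ℂ) (q : (H × H) × (H × H)) : ℂ :=
  Φ q * (Real.exp (-((normSq q.1 + normSq q.2) / h)) : ℂ)

/-- Joint continuity is not yet available at this stage; a function continuous in each variable
separately is still jointly measurable. -/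
lemma aestronglyMeasurable_reproducingDensity
    (hX : ∀ Y, Continuous fun X => Φ (X, Y)) (hY : ∀ X, Continuous fun Y => Φ (X, Y)) :
    AEStronglyMeasurable (reproducingDensity h Φ) := by
  have hmeas : Measurable Φ :=
    measurable_uncurry_of_continuous_of_measurable (u := fun X Y => Φ (X, Y)) hX
      fun X => (hY X).measurable
  have hc : Continuous fun q : (H × H) × (H × H) =>
      (Real.exp (-((normSq q.1 + normSq q.2) / h)) : ℂ) := by fun_prop
  exact (hmeas.mul hc.measurable).aestronglyMeasurable

lemma integrable_exp_norm_mul_reproducingDensity (hh : 0 < h)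
    (hX : ∀ Y, Continuous fun X => Φ (X, Y)) (hY : ∀ X, Continuous fun Y => Φ (X, Y))
    (hN : ∀ p, ‖Φ p‖ ≤ N * Real.exp (normSq (p.1 - p.2) / (4 * h))) (R : ℝ) :
    Integrable fun q => Real.exp (R * ‖q‖) * ‖reproducingDensity h Φ q‖ := by
  refine ((integrable_exp_norm_mul_exp_neg_normSq_prod (H := H) hh R).const_mul N).mono'
    ((by fun_prop : Continuous _).aestronglyMeasurable.mul
      (aestronglyMeasurable_reproducingDensity hX hY).norm)
    (Filter.Eventually.of_forall fun q => ?_)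
  rw [Real.norm_of_nonneg (by positivity), reproducingDensity, norm_mul, Complex.norm_real,
    Real.norm_of_nonneg (Real.exp_pos _).le]
  have : Real.exp (-((normSq q.1 + normSq q.2) / (2 * h)))
      = Real.exp ((normSq q.1 + normSq q.2) / (2 * h))
        * Real.exp (-((normSq q.1 + normSq q.2) / h)) := by
    rw [← Real.exp_add]; congr 1; field_simp; ring
  rw [this]
  calc _ ≤ Real.exp (R * ‖q‖) * (N * Real.exp ((normSq q.1 + normSq q.2) / (2 * h))
        * Real.exp (-((normSq q.1 + normSq q.2) / h))) := by
        gcongr; exact norm_le_exp_normSq_add hh hN q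
    _ = _ := by ring

lemma integrable_reproducingDensity_mul_cexp (hh : 0 < h)
    (hX : ∀ Y, Continuous fun X => Φ (X, Y)) (hY : ∀ X, Continuous fun Y => Φ (X, Y))
    (hN : ∀ p, ‖Φ p‖ ≤ N * Real.exp (normSq (p.1 - p.2) / (4 * h))) (p : (H × H) × (H × H)) :
    Integrable fun q => reproducingDensity h Φ q * Complex.exp (reproducingPairing h q p) :=
  have h1 := aestronglyMeasurable_reproducingDensity (h := h) hX hY
  have h2 := integrable_exp_norm_mul_reproducingDensity hh hX hY hN
  integrable_mul_cexp_reproducingPairing h _ h1 h2 p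

lemma contDiff_integral_reproducingDensity_mul_cexp (hh : 0 < h)
    (hX : ∀ Y, Continuous fun X => Φ (X, Y)) (hY : ∀ X, Continuous fun Y => Φ (X, Y))
    (hN : ∀ p, ‖Φ p‖ ≤ N * Real.exp (normSq (p.1 - p.2) / (4 * h))) (k : ℕ) :
    ContDiff ℝ k fun p =>
      ∫ q, reproducingDensity h Φ q * Complex.exp (reproducingPairing h q p) :=
  have h1 := aestronglyMeasurable_reproducingDensity (h := h) hX hY
  have h2 := integrable_exp_norm_mul_reproducingDensity hh hX hY hN
  contDiff_integral_mul_cexp_reproducingPairing h _ k h1 h2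

/-- By Fubini the inner integral reproduces the antiholomorphic variable at `p.2`, and the outer one
the holomorphic variable at `p.1`. -/
lemma integral_reproducingDensity (hh : 0 < h)
    (hX : ∀ Y, EntireOnLines fun X => Φ (X, Y))
    (hY : ∀ X, EntireOnLines fun Y => (starRingEnd ℂ) (Φ (X, Y)))
    (hYc : ∀ X, Continuous fun Y => Φ (X, Y))
    (hN : ∀ p, ‖Φ p‖ ≤ N * Real.exp (normSq (p.1 - p.2) / (4 * h)))
    (p : (H × H) × (H × H)) :
    ∫ q, reproducingDensity h Φ q * Complex.exp (reproducingPairing h q p)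
      = (((Real.pi * h) ^ Module.finrank ℝ H : ℝ) : ℂ)
        * ((((Real.pi * h) ^ Module.finrank ℝ H : ℝ) : ℂ) * Φ p) := by
  have h1 := integrable_reproducingDensity_mul_cexp hh (fun Y => (hX Y).1) hYc hN p
  rw [Measure.volume_eq_prod] at h1 ⊢
  rw [integral_prod _ h1]
  have e1 : ∀ W U, reproducingDensity h Φ (W, U) * Complex.exp (reproducingPairing h (W, U) p)
      = Complex.exp ((cdot p.1 W - normSq W) / h)
        * (Φ (W, U) * Complex.exp ((cdot U p.2 - normSq U) / h)) := fun W U => by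
    rw [reproducingPairing_apply, reproducingDensity, Complex.ofReal_exp, mul_assoc,
      ← Complex.exp_add, mul_left_comm, ← Complex.exp_add]
    congr 2
    push_cast
    ring
  have hN2 := norm_le_exp_normSq_add hh hN
  have e2 : ∀ W, ∫ U, Φ (W, U) * Complex.exp ((cdot U p.2 - normSq U) / h)
      = (((Real.pi * h) ^ Module.finrank ℝ H : ℝ) : ℂ) * Φ (W, p.2) := fun W => by
    refine EntireOnLines.integral_conj_mul_cexp (hY W) hh p.2 ?_
    refine integrable_mul_cexp_of_le hh (hYc W) (C := N * Real.exp (normSq W / (2 * h)))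
      (fun U => (hN2 _).trans_eq ?_) p.2 (c := fun U => cdot U p.2) (by fun_prop)
      (fun U => norm_cdot_le _ _)
    rw [mul_assoc, ← Real.exp_add, add_div]
  have e3 : ∫ W, Φ (W, p.2) * Complex.exp ((cdot p.1 W - normSq W) / h)
      = (((Real.pi * h) ^ Module.finrank ℝ H : ℝ) : ℂ) * Φ p := by
    refine EntireOnLines.integral_mul_cexp (hX p.2) hh p.1 ?_
    refine integrable_mul_cexp_of_le hh (hX p.2).1 (C := N * Real.exp (normSq p.2 / (2 * h)))
      (fun U => (hN2 _).trans_eq ?_) p.1 (c := fun W => cdot p.1 W) (by fun_prop)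
      (fun U => (norm_cdot_le _ _).trans_eq (by ring))
    rw [mul_assoc, ← Real.exp_add, add_div, add_comm]
  simp_rw [e1, integral_const_mul, e2]
  rw [← e3, ← integral_const_mul]
  congr 1
  ext W
  ring

/-- A function on `H⁴` which is holomorphic in the first and antiholomorphic in the second
variable and is bounded by a multiple of `exp(|X - Y|²/(4h))` is smooth. -/
lemma contDiff_of_entireOnLines (hh : 0 < h)
    (hX : ∀ Y, EntireOnLines fun X => Φ (X, Y))
    (hY : ∀ X, EntireOnLines fun Y => (starRingEnd ℂ) (Φ (X, Y)))
    (hN : ∀ p, ‖Φ p‖ ≤ N * Real.exp (normSq (p.1 - p.2) / (4 * h))) :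
    ContDiff ℝ ∞ Φ := by
  have hYc : ∀ X, Continuous fun Y => Φ (X, Y) := fun X => by
    have := Complex.continuous_conj.comp (hY X).1
    simpa [Function.comp_def] using this
  have hA0 : (((Real.pi * h) ^ Module.finrank ℝ H : ℝ) : ℂ) ≠ 0 := by norm_cast; positivity
  -- On the right `p` occurs only in the exponential, so smoothness no longer depends on any
  -- regularity of `Φ`.
  have hΦ : Φ = fun p => ((((Real.pi * h) ^ Module.finrank ℝ H : ℝ) : ℂ)⁻¹
      * (((Real.pi * h) ^ Module.finrank ℝ H : ℝ) : ℂ)⁻¹)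
      * ∫ q, reproducingDensity h Φ q * Complex.exp (reproducingPairing h q p) := by
    ext p
    rw [integral_reproducingDensity hh hX hY hYc hN, mul_assoc, inv_mul_cancel_left₀ hA0,
      inv_mul_cancel_left₀ hA0]
  rw [contDiff_infty, hΦ]
  intro k
  exact contDiff_const.mul
    (contDiff_integral_reproducingDensity_mul_cexp hh (fun Y => (hX Y).1) hYc hN k)

end Smoothness

end BealsWeyl
end

noncomputable section

open MeasureTheory

set_option linter.unusedSectionVars false

namespace BealsWeyl

/-! ### Iterated directional derivatives. -/

section DirectionalDerivatives

variable {E : Type*} [NormedAddCommGroup E] [NormedSpace ℝ E] {ι : Type*}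

/-- The derivative in the direction `v`. -/
def dirDeriv (v : E) (F : E → ℂ) : E → ℂ := fun x => lineDeriv ℝ F x v

/-- The composition over the list `l` of the `k j`-th powers of the derivatives along `u j`. -/
def dirMonomial (u : ι → E) (l : List ι) (k : ι → Fin 3) (F : E → ℂ) : E → ℂ :=
  l.foldr (fun j G => (dirDeriv (u j))^[(k j : ℕ)] G) F

lemma dirMonomial_cons (u : ι → E) (j : ι) (l : List ι) (k : ι → Fin 3) (F : E → ℂ) :
    dirMonomial u (j :: l) k F = (dirDeriv (u j))^[(k j : ℕ)] (dirMonomial u l k F) := rfl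

lemma dirMonomial_congr (u : ι → E) {l : List ι} {k k' : ι → Fin 3} (hk : ∀ i ∈ l, k i = k' i)
    (F : E → ℂ) : dirMonomial u l k F = dirMonomial u l k' F := by
  induction l with
  | nil => rfl
  | cons j l ih =>
    rw [dirMonomial_cons, dirMonomial_cons, ih fun i hi => hk i (List.mem_cons_of_mem _ hi),
      hk j List.mem_cons_self]

lemma ContDiff.dirDeriv {F : E → ℂ} (hF : ContDiff ℝ ∞ F) (v : E) :
    ContDiff ℝ ∞ (dirDeriv v F) := by
  have : BealsWeyl.dirDeriv v F = fun x => fderiv ℝ F x v := by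
    ext x
    exact (hF.differentiable (by simp) x).lineDeriv_eq_fderiv
  rw [this]
  exact (hF.fderiv_right (by simp)).clm_apply contDiff_const

lemma ContDiff.iterate_dirDeriv {F : E → ℂ} (hF : ContDiff ℝ ∞ F) (v : E) (k : ℕ) :
    ContDiff ℝ ∞ ((BealsWeyl.dirDeriv v)^[k] F) := by
  induction k with
  | zero => exact hF
  | succ k ih => rw [Function.iterate_succ_apply']; exact ContDiff.dirDeriv ih v

lemma ContDiff.dirMonomial {F : E → ℂ} (hF : ContDiff ℝ ∞ F) (u : ι → E) (l : List ι)
    (k : ι → Fin 3) : ContDiff ℝ ∞ (BealsWeyl.dirMonomial u l k F) := by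
  induction l with
  | nil => exact hF
  | cons j l ih => exact ContDiff.iterate_dirDeriv ih _ _

lemma hasLineDerivAt_dirDeriv {F : E → ℂ} (hF : ContDiff ℝ ∞ F) (v x : E) :
    HasLineDerivAt ℝ F (dirDeriv v F x) x v :=
  (hF.differentiable (by simp) x).lineDifferentiableAt.hasLineDerivAt

end DirectionalDerivatives

/-! ### One-dimensional weights for `1 - d²/dt²`. -/

section GaussianWeights

/-- The one-dimensional Gaussian `exp(-t²)`. -/
def gaussWeight (t : ℝ) : ℝ := Real.exp (-t ^ 2)

/-- The coefficients of `1 - d²/dt²` after conjugation by `exp(-t²)`. -/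
def ibpWeight : Fin 3 → ℝ → ℝ :=
  ![fun t => (3 - 4 * t ^ 2) * Real.exp (-t ^ 2), fun t => 4 * t * Real.exp (-t ^ 2),
    fun t => -Real.exp (-t ^ 2)]

lemma hasDerivAt_gaussWeight (t : ℝ) : HasDerivAt gaussWeight (-2 * t * Real.exp (-t ^ 2)) t := by
  have h1 : HasDerivAt (fun t : ℝ => -t ^ 2) (-(2 * t)) t := by
    simpa using (hasDerivAt_pow 2 t).fun_neg
  refine h1.exp.congr_deriv ?_
  ring

lemma hasDerivAt_deriv_gaussWeight (t : ℝ) :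
    HasDerivAt (fun t => -2 * t * Real.exp (-t ^ 2)) ((4 * t ^ 2 - 2) * Real.exp (-t ^ 2)) t := by
  have h1 : HasDerivAt (fun t : ℝ => -2 * t) (-2) t := by
    simpa using (hasDerivAt_id t).const_mul (-2)
  refine (h1.mul (hasDerivAt_gaussWeight t)).congr_deriv ?_
  rw [gaussWeight]
  ring

lemma integrable_pow_mul_gaussian (k : ℕ) : Integrable fun t : ℝ => t ^ k * Real.exp (-t ^ 2) := by
  have := integrable_rpow_mul_exp_neg_mul_sq (b := 1) one_pos (s := k)
    (by have : (0 : ℝ) ≤ k := k.cast_nonneg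
        linarith)
  simpa using this

lemma integrable_gaussWeight : Integrable gaussWeight := by
  exact (integrable_pow_mul_gaussian 0).congr
    (Filter.Eventually.of_forall fun t => by simp [gaussWeight])

lemma integrable_deriv_gaussWeight : Integrable fun t : ℝ => -2 * t * Real.exp (-t ^ 2) := by
  refine ((integrable_pow_mul_gaussian 1).const_mul (-2)).congr
    (Filter.Eventually.of_forall fun t => ?_)
  simp only; ring

lemma integrable_deriv_deriv_gaussWeight :
    Integrable fun t : ℝ => (4 * t ^ 2 - 2) * Real.exp (-t ^ 2) := by
  refine (((integrable_pow_mul_gaussian 2).const_mul 4).sub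
    ((integrable_pow_mul_gaussian 0).const_mul 2)).congr
    (Filter.Eventually.of_forall fun t => ?_)
  simp only [Pi.sub_apply]; ring

lemma integrable_ibpWeight (r : Fin 3) : Integrable (ibpWeight r) := by
  fin_cases r
  · refine (((integrable_pow_mul_gaussian 0).const_mul 3).sub
      ((integrable_pow_mul_gaussian 2).const_mul 4)).congr
      (Filter.Eventually.of_forall fun t => ?_)
    simp [ibpWeight]; ring
  · refine ((integrable_pow_mul_gaussian 1).const_mul 4).congr
      (Filter.Eventually.of_forall fun t => ?_)
    simp [ibpWeight]; ring
  · simpa [ibpWeight] using (integrable_pow_mul_gaussian 0).neg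

lemma continuous_ibpWeight (r : Fin 3) : Continuous (ibpWeight r) := by
  fin_cases r <;> simp [ibpWeight] <;> fun_prop

end GaussianWeights

/-! ### Integration by parts against a plane wave in one coordinate. -/

section IntegrationByParts

variable {ι : Type*} [Fintype ι] [DecidableEq ι]

/-- The plane wave `exp(i κ·x)`. -/
def planeWave (κ x : ι → ℝ) : ℂ := Complex.exp (((∑ i, κ i * x i : ℝ) : ℂ) * Complex.I)

lemma norm_planeWave (κ x : ι → ℝ) : ‖planeWave κ x‖ = 1 := Complex.norm_exp_ofReal_mul_I _

lemma continuous_planeWave (κ : ι → ℝ) : Continuous (planeWave κ) := by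
  unfold planeWave; fun_prop

lemma hasLineDerivAt_planeWave (κ x : ι → ℝ) (j : ι) :
    HasLineDerivAt ℝ (planeWave κ) (κ j * Complex.I * planeWave κ x) x (Pi.single j 1) := by
  have h0 : ∀ t : ℝ, planeWave κ (x + t • Pi.single j 1)
      = Complex.exp (((t * κ j : ℝ) : ℂ) * Complex.I) * planeWave κ x := fun t => by
    rw [planeWave, planeWave, ← Complex.exp_add, ← add_mul]
    congr 2
    rw [← Complex.ofReal_add]
    congr 1
    simp only [Pi.add_apply, Pi.smul_apply, smul_eq_mul, mul_add, Finset.sum_add_distrib]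
    simp [Pi.single_apply]
    ring
  unfold HasLineDerivAt
  simp only [h0]
  have h1 : HasDerivAt (fun t : ℝ => ((t * κ j : ℝ) : ℂ) * Complex.I) (κ j * Complex.I) 0 := by
    have := ((hasDerivAt_id (0 : ℝ)).mul_const (κ j)).ofReal_comp.mul_const Complex.I
    simpa using this
  have h2 := (h1.cexp).mul_const (planeWave κ x)
  simpa using h2

lemma integral_mul_hasLineDerivAt {j : ι} {f f' g g' : (ι → ℝ) → ℂ}
    (hf : ∀ x, HasLineDerivAt ℝ f (f' x) x (Pi.single j 1))
    (hg : ∀ x, HasLineDerivAt ℝ g (g' x) x (Pi.single j 1))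
    (h1 : Integrable fun x => f' x * g x) (h2 : Integrable fun x => f x * g' x)
    (h3 : Integrable fun x => f x * g x) : ∫ x, f x * g' x = -∫ x, f' x * g x := by
  exact integral_bilinear_hasLineDerivAt_right_eq_neg_left_of_integrable
    (B := ContinuousLinearMap.mul ℝ ℂ) h1 h2 h3 (fun x _ => hf x)
    (fun x _ => hg x)

/-- Two integrations by parts against a plane wave. -/
lemma one_add_sq_mul_integral_planeWave {j : ι} {a a₁ a₂ : (ι → ℝ) → ℂ} (κ : ι → ℝ)
    (h₀ : Integrable a) (h₁ : Integrable a₁) (h₂ : Integrable a₂)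
    (d₀ : ∀ x, HasLineDerivAt ℝ a (a₁ x) x (Pi.single j 1))
    (d₁ : ∀ x, HasLineDerivAt ℝ a₁ (a₂ x) x (Pi.single j 1)) :
    (1 + (κ j : ℂ) ^ 2) * ∫ x, a x * planeWave κ x = ∫ x, (a x - a₂ x) * planeWave κ x := by
  have hi : ∀ {b : (ι → ℝ) → ℂ}, Integrable b → Integrable fun x => b x * planeWave κ x :=
    fun {b} hb => hb.mul_bdd (c := 1) (continuous_planeWave κ).aestronglyMeasurable
      (Filter.Eventually.of_forall fun x => (norm_planeWave κ x).le)
  have e : ∀ b : (ι → ℝ) → ℂ, ∀ x, b x * (κ j * Complex.I * planeWave κ x)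
      = κ j * Complex.I * (b x * planeWave κ x) := fun b x => by ring
  have hi' : ∀ {b : (ι → ℝ) → ℂ}, Integrable b →
      Integrable fun x => b x * (κ j * Complex.I * planeWave κ x) := fun {b} hb => by
    simp_rw [e]
    exact (hi hb).const_mul _
  have r1 := integral_mul_hasLineDerivAt d₀ (fun x => hasLineDerivAt_planeWave κ x j) (hi h₁)
    (hi' h₀) (hi h₀)
  have r2 := integral_mul_hasLineDerivAt d₁ (fun x => hasLineDerivAt_planeWave κ x j) (hi h₂)
    (hi' h₁) (hi h₁)
  simp_rw [e, integral_const_mul] at r1 r2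
  simp_rw [sub_mul]
  rw [integral_sub (hi h₀) (hi h₂)]
  linear_combination (-(κ j : ℂ) * Complex.I) * r1 + r2
    + ((κ j : ℂ) ^ 2 * ∫ x, a x * planeWave κ x) * Complex.I_sq

end IntegrationByParts

end BealsWeyl
end

noncomputable section

open MeasureTheory

set_option linter.unusedSectionVars false

namespace BealsWeyl

/-! ### Integration by parts in all coordinates. -/

section IteratedIntegrationByParts

variable {ι : Type*} [Fintype ι] [DecidableEq ι]

lemma hasLineDerivAt_weight_mul {j : ι} {R : (ι → ℝ) → ℝ}
    (hR : ∀ x (t : ℝ), R (x + t • Pi.single j 1) = R x) {v v' : ℝ → ℝ}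
    (hv : ∀ t, HasDerivAt v (v' t) t) {G : (ι → ℝ) → ℂ} (hG : ContDiff ℝ ∞ G) (x : ι → ℝ) :
    HasLineDerivAt ℝ (fun x => ((v (x j) * R x : ℝ) : ℂ) * G x)
      (((v' (x j) * R x : ℝ) : ℂ) * G x
        + ((v (x j) * R x : ℝ) : ℂ) * dirDeriv (Pi.single j 1) G x) x (Pi.single j 1) := by
  have h1 : HasDerivAt (fun t : ℝ => ((v (x j + t) * R x : ℝ) : ℂ)) ((v' (x j) * R x : ℝ) : ℂ) 0 := by
    have h2 : HasDerivAt v (v' (x j)) (x j + 0) := by simpa using hv (x j)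
    have h3 := (h2.comp_const_add (x j) 0).mul_const (R x)
    exact h3.ofReal_comp
  have h2 := h1.mul (hasLineDerivAt_dirDeriv hG (Pi.single j 1) x)
  simp only [add_zero, zero_smul] at h2
  refine h2.congr_of_eventuallyEq (Filter.Eventually.of_forall fun t => ?_)
  simp [hR]

/-- The factor `R`, independent of the `j`-th coordinate, stands for the weights of the other
coordinates. Expanding `1 - ∂_j²` on the Gaussian times `G` gives one term for each order of
derivative falling on `G`. -/
lemma one_add_sq_mul_integral_eq_sum {j : ι} {R : (ι → ℝ) → ℝ}
    (hR : ∀ x (t : ℝ), R (x + t • Pi.single j 1) = R x)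
    (hRi : ∀ v : ℝ → ℝ, Integrable v → Integrable fun x => v (x j) * R x)
    {G : (ι → ℝ) → ℂ} (hG : ContDiff ℝ ∞ G)
    (hb : ∀ r : Fin 3, ∃ C, ∀ x, ‖(dirDeriv (Pi.single j 1))^[(r : ℕ)] G x‖ ≤ C) (κ : ι → ℝ) :
    (1 + (κ j : ℂ) ^ 2) * ∫ x, ((gaussWeight (x j) * R x : ℝ) : ℂ) * G x * planeWave κ x
      = ∑ r : Fin 3, ∫ x, ((ibpWeight r (x j) * R x : ℝ) : ℂ)
          * (dirDeriv (Pi.single j 1))^[(r : ℕ)] G x * planeWave κ x := by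
  have hi : ∀ (v : ℝ → ℝ) (r : Fin 3), Integrable v →
      Integrable fun x => ((v (x j) * R x : ℝ) : ℂ)
        * (dirDeriv (Pi.single j 1))^[(r : ℕ)] G x := fun v r hv => by
    obtain ⟨C, hC⟩ := hb r
    exact (hRi v hv).ofReal.mul_bdd (c := C)
      (ContDiff.iterate_dirDeriv hG _ _).continuous.aestronglyMeasurable
      (Filter.Eventually.of_forall hC)
  have hw : ∀ {b : (ι → ℝ) → ℂ}, Integrable b → Integrable fun x => b x * planeWave κ x :=
    fun {b} hb => hb.mul_bdd (c := 1) (continuous_planeWave κ).aestronglyMeasurable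
      (Filter.Eventually.of_forall fun x => (norm_planeWave κ x).le)
  have hi0 := fun v hv => hi v 0 hv
  have hi1 := fun v hv => hi v 1 hv
  have hi2 := fun v hv => hi v 2 hv
  simp only [Fin.val_zero, Fin.val_one, Fin.val_two, Function.iterate_succ, Function.iterate_zero,
    Function.comp_apply, id] at hi0 hi1 hi2
  have hG1 := ContDiff.dirDeriv hG (Pi.single j 1 : ι → ℝ)
  have i0 := hi0 _ integrable_gaussWeight
  have i1 := (hi0 _ integrable_deriv_gaussWeight).add (hi1 _ integrable_gaussWeight)
  have i2 := ((hi0 _ integrable_deriv_deriv_gaussWeight).add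
    (hi1 _ integrable_deriv_gaussWeight)).add
    ((hi1 _ integrable_deriv_gaussWeight).add (hi2 _ integrable_gaussWeight))
  rw [one_add_sq_mul_integral_planeWave κ i0 i1 i2
    (fun x => hasLineDerivAt_weight_mul hR hasDerivAt_gaussWeight hG x)
    (fun x => (hasLineDerivAt_weight_mul hR hasDerivAt_deriv_gaussWeight hG x).add
      (hasLineDerivAt_weight_mul hR hasDerivAt_gaussWeight hG1 x))]
  rw [← integral_finsetSum _ fun r _ => hw (hi _ r (integrable_ibpWeight r))]
  refine integral_congr_ae (Filter.Eventually.of_forall fun x => ?_)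
  simp [Fin.sum_univ_three, ibpWeight, gaussWeight]
  ring

/-- The weight in which the coordinates listed in `l` have been integrated by parts. -/
def mixedWeight (l : List ι) (k : ι → Fin 3) (i : ι) : ℝ → ℝ :=
  if i ∈ l then ibpWeight (k i) else gaussWeight

lemma integrable_mixedWeight (l : List ι) (k : ι → Fin 3) (i : ι) :
    Integrable (mixedWeight l k i) := by
  unfold mixedWeight
  split_ifs
  exacts [integrable_ibpWeight _, integrable_gaussWeight]

lemma integrable_prod_apply {V : ι → ℝ → ℝ} (hV : ∀ i, Integrable (V i)) :
    Integrable fun x : ι → ℝ => ∏ i, V i (x i) :=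
  Integrable.fintype_prod hV

/-- The oscillating integral of `F` after integration by parts in the coordinates listed
in `l`. -/
def ibpIntegral (κ : ι → ℝ) (F : (ι → ℝ) → ℂ) (l : List ι) (k : ι → Fin 3) : ℂ :=
  ∫ x, ((∏ i, mixedWeight l k i (x i) : ℝ) : ℂ)
    * dirMonomial (fun j => Pi.single j 1) l k F x * planeWave κ x

lemma mixedWeight_cons_update {j : ι} {l : List ι} (hj : j ∉ l) (k : ι → Fin 3) (r : Fin 3) :
    mixedWeight (j :: l) (Function.update k j r) = Function.update (mixedWeight l k) j (ibpWeight r) := by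
  ext i t
  by_cases hij : i = j
  · subst hij; simp [mixedWeight]
  · simp [mixedWeight, hij]

lemma prod_update_apply (V : ι → ℝ → ℝ) (j : ι) (v : ℝ → ℝ) (x : ι → ℝ) :
    ∏ i, Function.update V j v i (x i) = v (x j) * ∏ i ∈ Finset.univ.erase j, V i (x i) := by
  rw [← Finset.mul_prod_erase _ _ (Finset.mem_univ j), Function.update_self]
  congr 1
  refine Finset.prod_congr rfl fun i hi => ?_
  rw [Function.update_of_ne (Finset.ne_of_mem_erase hi)]

/-- For the list `l` only the entries of `k` on `l` matter, and `j ∉ l`, so the order of derivative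
in the new direction can be stored as the `j`-th entry. -/
lemma one_add_sq_mul_ibpIntegral {κ : ι → ℝ} {F : (ι → ℝ) → ℂ} (hF : ContDiff ℝ ∞ F) {j : ι}
    {l : List ι} (hj : j ∉ l) (k : ι → Fin 3)
    (hb : ∀ k : ι → Fin 3, ∃ C, ∀ x, ‖dirMonomial (fun j => Pi.single j 1) (j :: l) k F x‖ ≤ C) :
    (1 + (κ j : ℂ) ^ 2) * ibpIntegral κ F l k
      = ∑ r : Fin 3, ibpIntegral κ F (j :: l) (Function.update k j r) := by
  have hmon : ∀ r : Fin 3, dirMonomial (fun j => Pi.single j (1 : ℝ)) (j :: l)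
      (Function.update k j r) F = (dirDeriv (Pi.single j 1))^[(r : ℕ)]
        (dirMonomial (fun j => Pi.single j 1) l k F) := fun r => by
    rw [dirMonomial_cons, Function.update_self]
    congr 1
    refine dirMonomial_congr _ (fun i hi => ?_) F
    rw [Function.update_of_ne]
    rintro rfl
    exact hj hi
  have hself : mixedWeight l k = Function.update (mixedWeight l k) j gaussWeight := by
    rw [eq_comm, Function.update_eq_self_iff]
    simp [mixedWeight, hj]
  have hR : ∀ (x : ι → ℝ) (t : ℝ),
      ∏ i ∈ Finset.univ.erase j, mixedWeight l k i ((x + t • Pi.single j (1 : ℝ) : ι → ℝ) i)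
        = ∏ i ∈ Finset.univ.erase j, mixedWeight l k i (x i) := fun x t => by
    refine Finset.prod_congr rfl fun i hi => ?_
    simp [Finset.ne_of_mem_erase hi]
  have hRi : ∀ v : ℝ → ℝ, Integrable v → Integrable fun x : ι → ℝ =>
      v (x j) * ∏ i ∈ Finset.univ.erase j, mixedWeight l k i (x i) := fun v hv => by
    simp_rw [← prod_update_apply]
    refine integrable_prod_apply fun i => ?_
    by_cases hij : i = j
    · subst hij; simpa using hv
    · simpa [hij] using integrable_mixedWeight l k i
  have key := one_add_sq_mul_integral_eq_sum hR hRi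
    (ContDiff.dirMonomial hF (fun j => Pi.single j 1) l k) (fun r => by
      obtain ⟨C, hC⟩ := hb (Function.update k j r)
      rw [hmon] at hC
      exact ⟨C, hC⟩) κ
  simp_rw [← prod_update_apply] at key
  rw [← hself] at key
  unfold ibpIntegral
  rw [key]
  simp_rw [hmon, mixedWeight_cons_update hj]

/-- Summing over an updated multi-index counts every multi-index three times. -/
lemma sum_sum_update (j : ι) (g : (ι → Fin 3) → ℝ) :
    ∑ k : ι → Fin 3, ∑ r : Fin 3, g (Function.update k j r) = 3 * ∑ k, g k := by
  -- Exchanging `k j` with `r` is an involution of the pairs; after it the summand no longer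
  -- involves `r`.
  let σ : (ι → Fin 3) × Fin 3 ≃ (ι → Fin 3) × Fin 3 :=
    Function.Involutive.toPerm (fun p => (Function.update p.1 j p.2, p.1 j))
      fun p => by simp
  rw [← Fintype.sum_prod_type' (f := fun k r => g (Function.update k j r))]
  refine (σ.sum_comp fun p => g p.1).trans ?_
  rw [Fintype.sum_prod_type]
  simp [Finset.mul_sum]

/-- The sum runs over multi-indices on all of `ι`, so that the index type stays fixed in the
induction. Each distinct term then occurs `3 ^ (card ι - length l)` times, which the powers of three
compensate. -/
lemma prod_mul_norm_ibpIntegral_le {κ : ι → ℝ} {F : (ι → ℝ) → ℂ} (hF : ContDiff ℝ ∞ F)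
    (l : List ι) (hl : l.Nodup)
    (hb : ∀ k : ι → Fin 3, ∃ C, ∀ x, ‖dirMonomial (fun j => Pi.single j 1) l k F x‖ ≤ C) :
    3 ^ Fintype.card ι * ((l.map fun j => 1 + κ j ^ 2).prod * ‖ibpIntegral κ F [] 0‖)
      ≤ 3 ^ l.length * ∑ k, ‖ibpIntegral κ F l k‖ := by
  induction l with
  | nil =>
    have : ∀ k, ibpIntegral κ F [] k = ibpIntegral κ F [] 0 := fun k => by
      simp [ibpIntegral, dirMonomial, mixedWeight]
    simp [this]
  | cons j l ih =>
    rw [List.nodup_cons] at hl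
    have ih' := ih hl.2 fun k => by
      obtain ⟨C, hC⟩ := hb (Function.update k j 0)
      refine ⟨C, fun x => ?_⟩
      have := hC x
      rw [dirMonomial_cons, Function.update_self, dirMonomial_congr (k' := k)] at this
      · simpa using this
      · intro i hi
        rw [Function.update_of_ne]
        rintro rfl
        exact hl.1 hi
    have hstep : ∀ k, (1 + κ j ^ 2) * ‖ibpIntegral κ F l k‖
        ≤ ∑ r : Fin 3, ‖ibpIntegral κ F (j :: l) (Function.update k j r)‖ := fun k => by
      have h1 := one_add_sq_mul_ibpIntegral (κ := κ) hF hl.1 k hb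
      have h2 : ‖(1 + (κ j : ℂ) ^ 2)‖ = 1 + κ j ^ 2 := by
        rw [show (1 + (κ j : ℂ) ^ 2) = ((1 + κ j ^ 2 : ℝ) : ℂ) by push_cast; rfl,
          Complex.norm_real, Real.norm_of_nonneg (by positivity)]
      rw [← h2, ← norm_mul, h1]
      exact norm_sum_le _ _
    have hs := Finset.sum_le_sum fun k (_ : k ∈ Finset.univ) => hstep k
    rw [sum_sum_update j fun k => ‖ibpIntegral κ F (j :: l) k‖, ← Finset.mul_sum] at hs
    rw [List.map_cons, List.prod_cons, List.length_cons, pow_succ]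
    have hpos : 0 < 1 + κ j ^ 2 := by positivity
    calc _ = (1 + κ j ^ 2) * (3 ^ Fintype.card ι
          * ((l.map fun j => 1 + κ j ^ 2).prod * ‖ibpIntegral κ F [] 0‖)) := by ring
      _ ≤ (1 + κ j ^ 2) * (3 ^ l.length * ∑ k, ‖ibpIntegral κ F l k‖) := by gcongr
      _ = 3 ^ l.length * ((1 + κ j ^ 2) * ∑ k, ‖ibpIntegral κ F l k‖) := by ring
      _ ≤ 3 ^ l.length * (3 * ∑ k, ‖ibpIntegral κ F (j :: l) k‖) := by gcongr
      _ = _ := by ring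

/-- The weight obtained after integrating by parts in all coordinates. -/
def fullWeight (k : ι → Fin 3) (x : ι → ℝ) : ℝ := ∏ i, |ibpWeight (k i) (x i)|

/-- The decay of Gaussian Fourier integrals of functions with bounded mixed derivatives of order
at most two in each variable. -/
lemma prod_mul_norm_integral_gaussian_planeWave_le (κ : ι → ℝ) {F : (ι → ℝ) → ℂ}
    (hF : ContDiff ℝ ∞ F) {l : List ι} (hl : l.Nodup) (hmem : ∀ i, i ∈ l)
    (hb : ∀ k : ι → Fin 3, ∃ C, ∀ x, ‖dirMonomial (fun j => Pi.single j 1) l k F x‖ ≤ C) :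
    (∏ i, (1 + κ i ^ 2)) * ‖∫ x, (Real.exp (-∑ i, x i ^ 2) : ℂ) * F x * planeWave κ x‖
      ≤ ∑ k, ∫ x, fullWeight k x * ‖dirMonomial (fun j => Pi.single j 1) l k F x‖ := by
  have h1 := prod_mul_norm_ibpIntegral_le (κ := κ) hF l hl hb
  have hfin : l.toFinset = Finset.univ := by ext i; simp [hmem]
  have hlen : l.length = Fintype.card ι := by
    rw [← List.toFinset_card_of_nodup hl, hfin, Finset.card_univ]
  have hprod : (l.map fun j => 1 + κ j ^ 2).prod = ∏ i, (1 + κ i ^ 2) := by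
    rw [← List.prod_toFinset _ hl, hfin]
  have h0 : ibpIntegral κ F [] 0
      = ∫ x, (Real.exp (-∑ i, x i ^ 2) : ℂ) * F x * planeWave κ x := by
    refine integral_congr_ae (Filter.Eventually.of_forall fun x => ?_)
    simp [dirMonomial, mixedWeight, gaussWeight, ← Complex.exp_sum]
  -- For the full list the two powers of three coincide and cancel.
  rw [hlen, hprod, h0] at h1
  refine (le_of_mul_le_mul_left h1 (by positivity)).trans (Finset.sum_le_sum fun k _ => ?_)
  refine (norm_integral_le_integral_norm _).trans_eq ?_
  refine integral_congr_ae (Filter.Eventually.of_forall fun x => ?_)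
  simp only [norm_mul, norm_planeWave, mul_one, Complex.norm_real, fullWeight, mixedWeight, hmem,
    if_true, Real.norm_eq_abs, Finset.abs_prod]

lemma integrable_fullWeight (k : ι → Fin 3) : Integrable (fullWeight k) :=
  integrable_prod_apply fun i => (integrable_ibpWeight (k i)).abs

/-- A bound for the integrals of the one-dimensional weights. -/
def weightBound : ℝ := ∑ r : Fin 3, ∫ t, |ibpWeight r t|

lemma integral_fullWeight_le (k : ι → Fin 3) :
    ∫ x, fullWeight k x ≤ weightBound ^ Fintype.card ι := by
  have : ∫ x, fullWeight k x = ∏ i, ∫ t, |ibpWeight (k i) t| :=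
    integral_fintype_prod_volume_eq_prod (fun i t => |ibpWeight (k i) t|)
  rw [this, ← Finset.card_univ, ← Finset.prod_const]
  refine Finset.prod_le_prod (fun _ _ => integral_nonneg fun _ => abs_nonneg _) fun i _ => ?_
  exact Finset.single_le_sum (f := fun r => ∫ t, |ibpWeight r t|)
    (fun _ _ => integral_nonneg fun _ => abs_nonneg _) (Finset.mem_univ (k i))

lemma fullWeight_nonneg (k : ι → Fin 3) (x : ι → ℝ) : 0 ≤ fullWeight k x :=
  Finset.prod_nonneg fun _ _ => abs_nonneg _

end IteratedIntegrationByParts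

end BealsWeyl
end

noncomputable section

open MeasureTheory

set_option linter.unusedSectionVars false

namespace BealsWeyl

/-! ### Directional derivatives under affine maps and scaling. -/

section AffineChange

variable {E E' : Type*} [NormedAddCommGroup E] [NormedSpace ℝ E] [NormedAddCommGroup E']
  [NormedSpace ℝ E'] {ι : Type*}

lemma dirDeriv_comp_affine (F : E' → ℂ) (A : E') (L : E →L[ℝ] E') (v : E) :
    dirDeriv v (fun x => F (A + L x)) = fun x => dirDeriv (L v) F (A + L x) := by
  ext x
  simp only [dirDeriv, lineDeriv, map_add, map_smul, add_assoc]

lemma dirMonomial_comp_affine (F : E' → ℂ) (A : E') (L : E →L[ℝ] E') (u : ι → E) (l : List ι)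
    (k : ι → Fin 3) : dirMonomial u l k (fun x => F (A + L x))
      = fun x => dirMonomial (fun i => L (u i)) l k F (A + L x) := by
  induction l with
  | nil => rfl
  | cons j l ih =>
    rw [dirMonomial_cons, dirMonomial_cons, ih]
    generalize dirMonomial (fun i => L (u i)) l k F = G
    generalize (k j : ℕ) = r
    induction r with
    | zero => rfl
    | succ r ihr => rw [Function.iterate_succ_apply', ihr, Function.iterate_succ_apply',
        dirDeriv_comp_affine]

lemma dirDeriv_smul_left (c : ℝ) (v : E) (F : E → ℂ) :
    dirDeriv (c • v) F = c • dirDeriv v F := by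
  ext x
  simp [dirDeriv, lineDeriv_smul]

lemma dirDeriv_const_smul (c : ℝ) (v : E) (F : E → ℂ) :
    dirDeriv v (c • F) = c • dirDeriv v F := by
  ext x
  simp only [dirDeriv, lineDeriv, Pi.smul_apply, Complex.real_smul]
  exact deriv_const_mul_field _

lemma iterate_dirDeriv_smul (c : ℝ) (v : E) (F : E → ℂ) (a : ℝ) (r : ℕ) :
    (dirDeriv (c • v))^[r] (a • F) = (c ^ r * a) • (dirDeriv v)^[r] F := by
  induction r with
  | zero => simp
  | succ r ih =>
    rw [Function.iterate_succ_apply', ih, Function.iterate_succ_apply', dirDeriv_smul_left,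
      dirDeriv_const_smul, smul_smul, pow_succ']
    ring_nf

/-- With `c = √h` this is the origin of the factors `h^{|α+β|/2}` in the final estimate. -/
lemma dirMonomial_smul (c : ℝ) (u : ι → E) (l : List ι) (k : ι → Fin 3) (F : E → ℂ) :
    dirMonomial (fun i => c • u i) l k F
      = c ^ (l.map fun i => (k i : ℕ)).sum • dirMonomial u l k F := by
  induction l with
  | nil => simp [dirMonomial]
  | cons j l ih =>
    rw [dirMonomial_cons, dirMonomial_cons, ih, iterate_dirDeriv_smul, List.map_cons,
      List.sum_cons, pow_add]

end AffineChange

/-! ### Scaled coordinates on `H²`. -/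

section Coordinates

variable {H : Type*} [NormedAddCommGroup H] [InnerProductSpace ℝ H] {n : ℕ}

/-- The coordinate directions of `H²`. -/
def coordDir (e : OrthonormalBasis (Fin n) ℝ H) : Fin n ⊕ Fin n → H × H :=
  Sum.elim (fun j => (e j, 0)) fun j => (0, e j)

/-- The indices of the coordinate directions, in the order in which derivatives are taken. -/
def coordList (n : ℕ) : List (Fin n ⊕ Fin n) :=
  (List.finRange n).map Sum.inl ++ (List.finRange n).map Sum.inr

lemma nodup_coordList (n : ℕ) : (coordList n).Nodup := by
  refine List.Nodup.append ((List.nodup_finRange n).map Sum.inl_injective)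
    ((List.nodup_finRange n).map Sum.inr_injective) ?_
  simp [List.Disjoint]

lemma mem_coordList (i : Fin n ⊕ Fin n) : i ∈ coordList n := by
  rcases i with i | i <;> simp [coordList]

lemma sum_map_coordList (k : Fin n ⊕ Fin n → Fin 3) :
    ((coordList n).map fun i => (k i : ℕ)).sum = ∑ i, (k i : ℕ) := by
  have hfin : (coordList n).toFinset = Finset.univ := by ext i; simp [mem_coordList]
  rw [← List.sum_toFinset _ (nodup_coordList n), hfin]

/-- Mixed derivatives on `H²` of order at most two in each coordinate. -/
def coordMonomial (e : OrthonormalBasis (Fin n) ℝ H) (k : Fin n ⊕ Fin n → Fin 3)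
    (F : H × H → ℂ) : H × H → ℂ :=
  dirMonomial (coordDir e) (coordList n) k F

/-- `coordList` follows the nesting of the original derivatives, so no commutation of derivatives is
needed. -/
lemma diagMultiDeriv_eq_dirMonomial (e : OrthonormalBasis (Fin n) ℝ H)
    (k : Fin n ⊕ Fin n → Fin 3) (Φ : (H × H) × (H × H) → ℂ) :
    diagMultiDeriv e (fun j => k (Sum.inl j)) (fun j => k (Sum.inr j)) Φ
      = dirMonomial (fun i => (coordDir e i, coordDir e i)) (coordList n) k Φ := by
  rw [dirMonomial, coordList, List.foldr_append, List.foldr_map, List.foldr_map]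
  rfl

/-- The parametrization of `H²` by `ℝ²ⁿ`, scaled by `√h`. -/
def coordMap (e : OrthonormalBasis (Fin n) ℝ H) (h : ℝ) : (Fin n ⊕ Fin n → ℝ) →L[ℝ] H × H :=
  ∑ i, (ContinuousLinearMap.proj i : (Fin n ⊕ Fin n → ℝ) →L[ℝ] ℝ).smulRight (√h • coordDir e i)

lemma coordMap_apply (e : OrthonormalBasis (Fin n) ℝ H) (h : ℝ) (x : Fin n ⊕ Fin n → ℝ) :
    coordMap e h x = √h • (∑ j, x (Sum.inl j) • e j, ∑ j, x (Sum.inr j) • e j) := by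
  simp only [coordMap, Fintype.sum_sum_type, coordDir, Sum.elim_inl, Sum.elim_inr]
  ext <;> simp [Prod.fst_sum, Prod.snd_sum, Finset.smul_sum, smul_comm (√h)]

lemma coordMap_single (e : OrthonormalBasis (Fin n) ℝ H) (h : ℝ) (i : Fin n ⊕ Fin n) :
    coordMap e h (Pi.single i 1) = √h • coordDir e i := by
  simp only [coordMap, sum_apply, ContinuousLinearMap.smulRight_apply,
    ContinuousLinearMap.proj_apply, Pi.single_apply, ite_smul, one_smul, zero_smul]
  simp

lemma norm_sum_smul_sq (e : OrthonormalBasis (Fin n) ℝ H) (c : Fin n → ℝ) :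
    ‖∑ j, c j • e j‖ ^ 2 = ∑ j, c j ^ 2 := by
  rw [← real_inner_self_eq_norm_sq, e.orthonormal.inner_sum]
  simp [sq]

lemma normSq_coordMap (e : OrthonormalBasis (Fin n) ℝ H) {h : ℝ} (hh : 0 < h)
    (x : Fin n ⊕ Fin n → ℝ) : normSq (coordMap e h x) = h * ∑ i, x i ^ 2 := by
  rw [coordMap_apply, normSq_smul, Real.sq_sqrt hh.le, normSq, norm_sum_smul_sq,
    norm_sum_smul_sq, Fintype.sum_sum_type]

/-- The frequency in the coordinates `coordMap e h` of the phase of the centred kernel. -/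
def frequency (e : OrthonormalBasis (Fin n) ℝ H) (h : ℝ) (V : H × H) : Fin n ⊕ Fin n → ℝ :=
  Sum.elim (fun j => 2 / √h * ⟪V.2, e j⟫_ℝ) fun j => -(2 / √h * ⟪V.1, e j⟫_ℝ)

/-- Scaling by `√h` makes the Gaussian in `M` standard. The phase `Im(V·M̄)` is symplectic, so the
momentum part of `V` is the frequency of the position coordinates, and the position part, with a
minus sign, that of the momentum coordinates. -/
lemma centredKernel_coordMap (e : OrthonormalBasis (Fin n) ℝ H) {h : ℝ} (hh : 0 < h) (V : H × H)
    (x : Fin n ⊕ Fin n → ℝ) :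
    centredKernel h V (coordMap e h x) = (Real.exp (-(normSq V / h)) : ℂ)
      * ((Real.exp (-∑ i, x i ^ 2) : ℂ) * planeWave (frequency e h V) x) := by
  have hs : √h * √h = h := Real.mul_self_sqrt hh.le
  have hs0 : √h ≠ 0 := (Real.sqrt_pos.2 hh).ne'
  have h1 : 2 / h * (cdot V (coordMap e h x)).im = ∑ i, frequency e h V i * x i := by
    rw [coordMap_apply, cdot_smul_right]
    simp only [cdot, inner_sum, real_inner_smul_right, Complex.mul_im, Complex.add_im,
      Complex.ofReal_im, Complex.ofReal_re, Complex.I_im, Complex.I_re, Complex.add_re,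
      Complex.mul_re, frequency, Fintype.sum_sum_type, Sum.elim_inl, Sum.elim_inr]
    have e2 : 2 / h = 2 / √h / √h := by rw [div_div, hs]
    have e1 : 2 / h * √h = 2 / √h := by rw [e2]; field_simp
    simp only [neg_mul, Finset.sum_neg_distrib, mul_assoc, ← Finset.mul_sum]
    simp only [mul_comm (x _)]
    rw [← e1]
    ring
  have h2 : normSq (coordMap e h x) / h = ∑ i, x i ^ 2 := by
    rw [normSq_coordMap e hh]; field_simp
  rw [centredKernel, planeWave, h1, add_div, h2, Complex.ofReal_exp, Complex.ofReal_exp,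
    ← Complex.exp_add, ← Complex.exp_add]
  congr 1
  push_cast
  ring

end Coordinates

end BealsWeyl
end

noncomputable section

open MeasureTheory

set_option linter.unusedSectionVars false

namespace BealsWeyl

/-! ### Lebesgue measure in scaled coordinates. -/

section CoordinateMeasure

variable {H : Type*} [NormedAddCommGroup H] [InnerProductSpace ℝ H] {n : ℕ}
  [FiniteDimensional ℝ H] [MeasurableSpace H] [BorelSpace H]

/-- The measurable parametrization of `H` by the coordinates in an orthonormal basis. -/
def coordEquiv (e : OrthonormalBasis (Fin n) ℝ H) : (Fin n → ℝ) ≃ᵐ H :=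
  (MeasurableEquiv.toLp 2 (Fin n → ℝ)).trans e.repr.symm.toHomeomorph.toMeasurableEquiv

lemma coordEquiv_apply (e : OrthonormalBasis (Fin n) ℝ H) (c : Fin n → ℝ) :
    coordEquiv e c = ∑ j, c j • e j :=
  (e.sum_repr_symm (WithLp.toLp 2 c)).symm

lemma measurePreserving_coordEquiv (e : OrthonormalBasis (Fin n) ℝ H) :
    MeasurePreserving (coordEquiv e) volume volume :=
  e.measurePreserving_repr_symm.comp (PiLp.volume_preserving_toLp (Fin n))

/-- The measurable parametrization of `H²` by coordinates. -/
def coordEquivProd (e : OrthonormalBasis (Fin n) ℝ H) : (Fin n ⊕ Fin n → ℝ) ≃ᵐ H × H :=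
  (MeasurableEquiv.sumPiEquivProdPi fun _ => ℝ).trans ((coordEquiv e).prodCongr (coordEquiv e))

lemma measurePreserving_coordEquivProd (e : OrthonormalBasis (Fin n) ℝ H) :
    MeasurePreserving (coordEquivProd e) volume volume :=
  ((measurePreserving_coordEquiv e).prod (measurePreserving_coordEquiv e)).comp
    (volume_measurePreserving_sumPiEquivProdPi fun _ => ℝ)

lemma smul_coordEquivProd (e : OrthonormalBasis (Fin n) ℝ H) (h : ℝ) (x : Fin n ⊕ Fin n → ℝ) :
    √h • coordEquivProd e x = coordMap e h x := by
  rw [coordMap_apply, ← coordEquiv_apply, ← coordEquiv_apply]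
  rfl

lemma finrank_eq (e : OrthonormalBasis (Fin n) ℝ H) : Module.finrank ℝ H = n := by
  rw [Module.finrank_eq_card_basis e.toBasis, Fintype.card_fin]

variable {F : Type*} [NormedAddCommGroup F] [NormedSpace ℝ F]

lemma integral_comp_coordMap (e : OrthonormalBasis (Fin n) ℝ H) {h : ℝ} (hh : 0 < h)
    (f : H × H → F) : ∫ X, f X = h ^ n • ∫ x, f (coordMap e h x) := by
  simp_rw [← smul_coordEquivProd]
  rw [(measurePreserving_coordEquivProd e).integral_comp (coordEquivProd e).measurableEmbedding
    (fun X => f (√h • X)), Measure.integral_comp_smul, Module.finrank_prod, finrank_eq e,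
    pow_add, ← mul_pow, Real.mul_self_sqrt hh.le, abs_of_pos (by positivity), smul_smul,
    mul_inv_cancel₀ (by positivity), one_smul]

lemma integrable_comp_coordMap_iff (e : OrthonormalBasis (Fin n) ℝ H) {h : ℝ} (hh : 0 < h)
    (f : H × H → F) : Integrable (fun x => f (coordMap e h x)) ↔ Integrable f := by
  simp_rw [← smul_coordEquivProd]
  rw [← integrable_comp_smul_iff volume f (Real.sqrt_pos.2 hh).ne']
  exact (measurePreserving_coordEquivProd e).integrable_comp_emb
    (coordEquivProd e).measurableEmbedding (g := fun X => f (√h • X))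

end CoordinateMeasure

/-! ### The integrable factor in `V` gained from oscillation. -/

section Decay

variable {H : Type*} [NormedAddCommGroup H] [InnerProductSpace ℝ H] {n : ℕ}

/-- The decay in `V` gained by two integrations by parts in each coordinate. -/
def decay (e : OrthonormalBasis (Fin n) ℝ H) (h : ℝ) (V : H × H) : ℝ :=
  (∏ i, (1 + frequency e h V i ^ 2))⁻¹

lemma decay_nonneg (e : OrthonormalBasis (Fin n) ℝ H) (h : ℝ) (V : H × H) : 0 ≤ decay e h V := by
  unfold decay; positivity

/-- The frequency map exchanges the two halves of the coordinates up to sign, which a product of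
squares does not see. The integral over `V` thus factors into one-dimensional ones. -/
lemma decay_coordMap (e : OrthonormalBasis (Fin n) ℝ H) {h : ℝ} (hh : 0 < h)
    (x : Fin n ⊕ Fin n → ℝ) : decay e h (coordMap e h x) = ∏ i, (1 + (2 * x i) ^ 2)⁻¹ := by
  have hs0 : √h ≠ 0 := (Real.sqrt_pos.2 hh).ne'
  have h1 : ∀ (c : Fin n → ℝ) (j : Fin n), 2 / √h * ⟪√h • ∑ i, c i • e i, e j⟫_ℝ = 2 * c j :=
    fun c j => by
      rw [real_inner_smul_left, e.orthonormal.inner_left_fintype]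
      field_simp
      simp
  rw [decay, coordMap_apply, Finset.prod_inv_distrib]
  simp only [frequency, Fintype.prod_sum_type, Sum.elim_inl, Sum.elim_inr, Prod.smul_mk, h1,
    neg_sq]
  rw [mul_comm]

lemma integrable_inv_one_add_two_mul_sq : Integrable fun t : ℝ => (1 + (2 * t) ^ 2)⁻¹ :=
  integrable_inv_one_add_sq.comp_mul_left' two_ne_zero

lemma integral_inv_one_add_two_mul_sq : ∫ t : ℝ, (1 + (2 * t) ^ 2)⁻¹ = Real.pi / 2 := by
  rw [Measure.integral_comp_mul_left (fun t : ℝ => (1 + t ^ 2)⁻¹) 2, integral_univ_inv_one_add_sq]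
  norm_num [abs_of_pos]
  ring

variable [FiniteDimensional ℝ H] [MeasurableSpace H] [BorelSpace H]

lemma integrable_decay (e : OrthonormalBasis (Fin n) ℝ H) {h : ℝ} (hh : 0 < h) :
    Integrable (decay e h) := by
  rw [← integrable_comp_coordMap_iff e hh]
  simp_rw [decay_coordMap e hh]
  exact integrable_prod_apply fun _ => integrable_inv_one_add_two_mul_sq

lemma integral_decay (e : OrthonormalBasis (Fin n) ℝ H) {h : ℝ} (hh : 0 < h) :
    ∫ V, decay e h V = h ^ n * (Real.pi / 2) ^ (2 * n) := by
  rw [integral_comp_coordMap e hh]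
  simp_rw [decay_coordMap e hh]
  rw [integral_fintype_prod_volume_eq_pow (fun t : ℝ => (1 + (2 * t) ^ 2)⁻¹),
    integral_inv_one_add_two_mul_sq, smul_eq_mul]
  simp [two_mul]

/-- The decay in `V` of the partial integrals against the centred kernel. -/
lemma norm_integral_mul_centredKernel_le (e : OrthonormalBasis (Fin n) ℝ H) {h : ℝ} (hh : 0 < h)
    {F : H × H → ℂ} (hF : ContDiff ℝ ∞ F)
    (hb : ∀ k, ∃ C, ∀ X, ‖coordMonomial e k F X‖ ≤ C) (V : H × H) :
    ‖∫ M, F M * centredKernel h V M‖ ≤ h ^ n * Real.exp (-(normSq V / h)) * decay e h V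
      * ∑ k, √h ^ (∑ i, (k i : ℕ))
        * ∫ x, fullWeight k x * ‖coordMonomial e k F (coordMap e h x)‖ := by
  have hmon : ∀ k, dirMonomial (fun j => Pi.single j (1 : ℝ)) (coordList n) k
      (fun x => F (coordMap e h x))
      = fun x => √h ^ (∑ i, (k i : ℕ)) • coordMonomial e k F (coordMap e h x) := fun k => by
    have h1 := dirMonomial_comp_affine F 0 (coordMap e h) (fun j => Pi.single j (1 : ℝ))
      (coordList n) k
    simp only [zero_add, coordMap_single] at h1
    rw [h1, dirMonomial_smul, sum_map_coordList]
    rfl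
  have key := prod_mul_norm_integral_gaussian_planeWave_le (frequency e h V)
    (F := fun x => F (coordMap e h x)) (hF.comp (coordMap e h).contDiff) (nodup_coordList n)
    mem_coordList (fun k => by
      obtain ⟨C, hC⟩ := hb k
      refine ⟨√h ^ (∑ i, (k i : ℕ)) * C, fun x => ?_⟩
      rw [hmon, norm_smul, Real.norm_of_nonneg (by positivity)]
      exact mul_le_mul_of_nonneg_left (hC _) (by positivity))
  have hint : ∫ M, F M * centredKernel h V M = h ^ n • ((Real.exp (-(normSq V / h)) : ℂ)
      * ∫ x, (Real.exp (-∑ i, x i ^ 2) : ℂ) * F (coordMap e h x)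
        * planeWave (frequency e h V) x) := by
    rw [integral_comp_coordMap e hh, ← integral_const_mul]
    congr 1
    refine integral_congr_ae (Filter.Eventually.of_forall fun x => ?_)
    simp only [centredKernel_coordMap e hh]
    ring
  rw [hint, norm_smul, norm_mul, Complex.norm_real, Real.norm_of_nonneg (Real.exp_pos _).le,
    Real.norm_of_nonneg (by positivity), mul_assoc, mul_assoc]
  refine mul_le_mul_of_nonneg_left (mul_le_mul_of_nonneg_left ?_ (Real.exp_pos _).le)
    (by positivity)
  rw [decay, inv_mul_eq_div, le_div_iff₀' (by positivity)]
  refine key.trans_eq (Finset.sum_congr rfl fun k _ => ?_)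
  rw [← integral_const_mul]
  refine integral_congr_ae (Filter.Eventually.of_forall fun x => ?_)
  simp only [hmon, norm_smul]
  rw [Real.norm_of_nonneg (by positivity)]
  ring

end Decay

end BealsWeyl
end

noncomputable section

open MeasureTheory

set_option linter.unusedSectionVars false

namespace BealsWeyl

/-! ### The change of variables from `(V, M)` to `(X, Y)`. -/

section CentredVariables

variable {H : Type*} [NormedAddCommGroup H] [InnerProductSpace ℝ H]

/-- The point `(X, Y)` of `H⁴` with `(X - Y) / 2 = V` and `(X + Y) / 2 = Z + M`, where
`p = (V, M)`. -/
def centre (Z : H × H) (p : (H × H) × (H × H)) : (H × H) × (H × H) :=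
  (Z + p.2 + p.1, Z + p.2 - p.1)

lemma continuous_centre : Continuous fun q : (H × H) × ((H × H) × (H × H)) => centre q.1 q.2 := by
  unfold centre; fun_prop

@[fun_prop]
lemma Continuous.centre {α : Type*} [TopologicalSpace α] {f : α → H × H}
    {g : α → (H × H) × (H × H)} (hf : Continuous f) (hg : Continuous g) :
    Continuous fun a => BealsWeyl.centre (f a) (g a) := by
  unfold BealsWeyl.centre
  fun_prop

@[fun_prop]
lemma Continuous.centredKernel {α : Type*} [TopologicalSpace α] {f g : α → H × H} (h : ℝ)
    (hf : Continuous f) (hg : Continuous g) :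
    Continuous fun a => BealsWeyl.centredKernel h (f a) (g a) := by
  unfold BealsWeyl.centredKernel
  fun_prop

/-- The exponent of the admissible growth of `Φ` is exactly that of the kernel's Gaussian in `V`, so
absolute values leave no decay in `V`. -/
lemma normSq_centre_sub (Z : H × H) (p : (H × H) × (H × H)) {h : ℝ} (hh : 0 < h) :
    normSq ((centre Z p).1 - (centre Z p).2) / (4 * h) = normSq p.1 / h := by
  have : (centre Z p).1 - (centre Z p).2 = (2 : ℝ) • p.1 := by
    simp only [centre, two_smul]; abel
  rw [this, normSq_smul]
  field_simp
  ring

/-- The inverse of `centre Z`. -/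
def centreEquiv [MeasurableSpace H] [BorelSpace H] [FiniteDimensional ℝ H] (Z : H × H) :
    (H × H) × (H × H) ≃ᵐ (H × H) × (H × H) where
  toFun := centre Z
  invFun q := ((1 / 2 : ℝ) • (q.1 - q.2), (1 / 2 : ℝ) • (q.1 + q.2) - Z)
  left_inv p := by
    ext1 <;> simp only [centre] <;> module
  right_inv q := by
    ext1 <;> simp only [centre] <;> module
  measurable_toFun := (continuous_centre.comp (Continuous.prodMk_right Z)).measurable
  measurable_invFun := (by fun_prop : Continuous fun q : (H × H) × (H × H) =>
    ((1 / 2 : ℝ) • (q.1 - q.2), (1 / 2 : ℝ) • (q.1 + q.2) - Z)).measurable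

variable [FiniteDimensional ℝ H] [MeasurableSpace H] [BorelSpace H]

/-- The map is a composition of shears and a translation, all measure preserving, with `V ↦ 2V`,
which acts on `2 dim H` real dimensions. -/
lemma map_centre (Z : H × H) :
    Measure.map (centre Z) volume
      = ENNReal.ofReal ((4 ^ Module.finrank ℝ H)⁻¹) • (volume : Measure ((H × H) × (H × H))) := by
  have h1 := measurePreserving_prod_sub (volume : Measure (H × H)) (volume : Measure (H × H))
  have h2 := measurePreserving_add_prod (volume : Measure (H × H)) (volume : Measure (H × H))
  have h3 := (measurePreserving_add_left (volume : Measure (H × H)) Z).prod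
    (measurePreserving_add_left (volume : Measure (H × H)) Z)
  have h4 : Measure.map (Prod.map (fun V : H × H => (2 : ℝ) • V) id)
      ((volume : Measure (H × H)).prod (volume : Measure (H × H)))
      = ENNReal.ofReal ((4 ^ Module.finrank ℝ H)⁻¹) •
        ((volume : Measure (H × H)).prod (volume : Measure (H × H))) := by
    rw [← Measure.map_prod_map _ _ (by fun_prop) measurable_id,
      Measure.map_addHaar_smul _ two_ne_zero, Measure.map_id, Measure.prod_smul_left,
      Module.finrank_prod, ← two_mul, pow_mul, abs_of_pos (by positivity)]
    norm_num
  have hcomp : centre Z = (Prod.map (Z + ·) (Z + ·)) ∘ (fun z => (z.1 + z.2, z.2)) ∘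
      (Prod.map (fun V : H × H => (2 : ℝ) • V) id) ∘ (fun z => (z.1, z.2 - z.1)) := by
    funext z
    ext1 <;> simp only [centre, Function.comp_apply, Prod.map_apply, id] <;> module
  have hm : Measurable (Prod.map (fun V : H × H => (2 : ℝ) • V) (id : H × H → H × H)) := by
    fun_prop
  rw [Measure.volume_eq_prod, hcomp, ← Measure.map_map, ← Measure.map_map,
    ← Measure.map_map hm h1.measurable, h1.map_eq, h4, Measure.map_smul, h2.map_eq,
    Measure.map_smul, h3.map_eq]
  · exact h2.measurable
  · exact hm.comp h1.measurable
  · exact h3.measurable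
  · exact h2.measurable.comp (hm.comp h1.measurable)

variable {F : Type*} [NormedAddCommGroup F] [NormedSpace ℝ F]

lemma integral_comp_centre (Z : H × H) (f : (H × H) × (H × H) → F) :
    ∫ p, f p = (4 : ℝ) ^ Module.finrank ℝ H • ∫ p, f (centre Z p) := by
  have h1 := (centreEquiv Z).measurableEmbedding.integral_map (μ := volume) f
  change ∫ y, f y ∂(Measure.map (centre Z) volume) = ∫ x, f (centre Z x) at h1
  rw [map_centre, integral_smul_measure, ENNReal.toReal_ofReal (by positivity)] at h1
  rw [← h1, smul_smul, mul_inv_cancel₀ (by positivity), one_smul]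

lemma integrable_comp_centre_iff (Z : H × H) (f : (H × H) × (H × H) → F) :
    Integrable (fun p => f (centre Z p)) ↔ Integrable f := by
  have h1 := (centreEquiv Z).measurableEmbedding.integrable_map_iff (μ := volume) (g := f)
  change Integrable f (Measure.map (centre Z) volume) ↔ _ at h1
  rw [map_centre, integrable_smul_measure (by simp) (by simp)] at h1
  exact h1.symm

end CentredVariables

/-! ### Leibniz estimates for mixed derivatives, and uniform bounds for dilated cut-offs. -/

section MixedBounds

variable {E : Type*} [NormedAddCommGroup E] [NormedSpace ℝ E]

lemma dirDeriv_add {a b : E → ℂ} (ha : ContDiff ℝ ∞ a) (hb : ContDiff ℝ ∞ b) (v : E) :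
    dirDeriv v (a + b) = dirDeriv v a + dirDeriv v b := by
  ext x
  exact HasLineDerivAt.lineDeriv (f := a + b)
    (HasDerivAt.add (hasLineDerivAt_dirDeriv ha v x) (hasLineDerivAt_dirDeriv hb v x))

lemma dirDeriv_mul {a b : E → ℂ} (ha : ContDiff ℝ ∞ a) (hb : ContDiff ℝ ∞ b) (v : E) :
    dirDeriv v (a * b) = dirDeriv v a * b + a * dirDeriv v b := by
  ext x
  have h1 := HasDerivAt.mul (hasLineDerivAt_dirDeriv ha v x) (hasLineDerivAt_dirDeriv hb v x)
  simp only [zero_smul, add_zero] at h1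
  exact HasLineDerivAt.lineDeriv (f := a * b) h1

/-- All derivatives of `F` of order at most two in each of the directions in the list are bounded
by `A`. -/
def MixedBounded : List E → ℝ → (E → ℂ) → Prop
  | [], A, F => ∀ x, ‖F x‖ ≤ A
  | v :: D, A, F => ∀ r : Fin 3, MixedBounded D A ((dirDeriv v)^[(r : ℕ)] F)

lemma MixedBounded.mono {D : List E} {A B : ℝ} (hAB : A ≤ B) {F : E → ℂ}
    (hF : MixedBounded D A F) : MixedBounded D B F := by
  induction D generalizing F with
  | nil => exact fun x => (hF x).trans hAB
  | cons v D ih => exact fun r => ih (hF r)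

lemma iterate_dirDeriv_add {a b : E → ℂ} (ha : ContDiff ℝ ∞ a) (hb : ContDiff ℝ ∞ b) (v : E)
    (r : ℕ) : (dirDeriv v)^[r] (a + b) = (dirDeriv v)^[r] a + (dirDeriv v)^[r] b := by
  induction r with
  | zero => rfl
  | succ r ih =>
    rw [Function.iterate_succ_apply', ih, dirDeriv_add (ContDiff.iterate_dirDeriv ha v r)
      (ContDiff.iterate_dirDeriv hb v r), Function.iterate_succ_apply',
      Function.iterate_succ_apply']

lemma MixedBounded.add {D : List E} {A B : ℝ} {a b : E → ℂ} (hac : ContDiff ℝ ∞ a)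
    (hbc : ContDiff ℝ ∞ b) (ha : MixedBounded D A a) (hb : MixedBounded D B b) :
    MixedBounded D (A + B) (a + b) := by
  induction D generalizing a b with
  | nil => exact fun x => (norm_add_le _ _).trans (add_le_add (ha x) (hb x))
  | cons v D ih =>
    intro r
    rw [iterate_dirDeriv_add hac hbc]
    exact ih (ContDiff.iterate_dirDeriv hac _ _) (ContDiff.iterate_dirDeriv hbc _ _) (ha r) (hb r)

lemma MixedBounded.smul {D : List E} {A c : ℝ} (hc : |c| ≤ 1) {F : E → ℂ}
    (hF : MixedBounded D A F) : MixedBounded D A (c • F) := by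
  induction D generalizing F with
  | nil =>
    intro x
    rw [Pi.smul_apply, norm_smul, Real.norm_eq_abs]
    exact (mul_le_of_le_one_left (norm_nonneg _) hc).trans (hF x)
  | cons v D ih =>
    intro r
    have := iterate_dirDeriv_smul 1 v F c r
    rw [one_smul, one_pow, one_mul] at this
    rw [this]
    exact ih (hF r)

/-- A second derivative of a product has four terms, counted with multiplicity, so each direction
costs at most a factor `4`. -/
lemma MixedBounded.mul {D : List E} {A B : ℝ} {a b : E → ℂ} (hac : ContDiff ℝ ∞ a)
    (hbc : ContDiff ℝ ∞ b) (ha : MixedBounded D A a) (hb : MixedBounded D B b) :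
    MixedBounded D (4 ^ D.length * (A * B)) (a * b) := by
  induction D generalizing a b with
  | nil =>
    intro x
    rw [Pi.mul_apply, norm_mul, List.length_nil, pow_zero, one_mul]
    exact mul_le_mul (ha x) (hb x) (norm_nonneg _) ((norm_nonneg _).trans (ha x))
  | cons v D ih =>
    have ha0 := ha 0
    have ha1 := ha 1
    have ha2 := ha 2
    have hb0 := hb 0
    have hb1 := hb 1
    have hb2 := hb 2
    simp only [Fin.val_zero, Fin.val_one, Fin.val_two, Function.iterate_succ,
      Function.iterate_zero, Function.comp_apply, id] at ha0 ha1 ha2 hb0 hb1 hb2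
    have ca1 := ContDiff.dirDeriv hac v
    have cb1 := ContDiff.dirDeriv hbc v
    have ca2 := ContDiff.dirDeriv ca1 v
    have cb2 := ContDiff.dirDeriv cb1 v
    have cm : ∀ {f g : E → ℂ}, ContDiff ℝ ∞ f → ContDiff ℝ ∞ g → ContDiff ℝ ∞ (f * g) :=
      fun hf hg => hf.mul hg
    have hpos : 0 ≤ 4 ^ D.length * (A * B) := by
      have key : ∀ {D : List E} {A : ℝ} {F : E → ℂ}, MixedBounded D A F → 0 ≤ A := by
        intro D
        induction D with
        | nil => exact fun {A F} h => (norm_nonneg _).trans (h 0)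
        | cons v D ih => exact fun {A F} h => ih (h 0)
      have := key ha
      have := key hb
      positivity
    have d1 : dirDeriv v (a * b) = dirDeriv v a * b + a * dirDeriv v b := dirDeriv_mul hac hbc v
    have d2 : dirDeriv v (dirDeriv v (a * b))
        = (dirDeriv v (dirDeriv v a) * b + dirDeriv v a * dirDeriv v b)
          + (dirDeriv v a * dirDeriv v b + a * dirDeriv v (dirDeriv v b)) := by
      rw [d1, dirDeriv_add (cm ca1 hbc) (cm hac cb1), dirDeriv_mul ca1 hbc,
        dirDeriv_mul hac cb1]
    intro r
    rw [List.length_cons, pow_succ]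
    fin_cases r
    · exact (ih hac hbc ha0 hb0).mono (by linarith)
    · change MixedBounded D _ (dirDeriv v (a * b))
      rw [d1]
      exact (MixedBounded.add (cm ca1 hbc) (cm hac cb1) (ih ca1 hbc ha1 hb0)
        (ih hac cb1 ha0 hb1)).mono (by linarith)
    · change MixedBounded D _ (dirDeriv v (dirDeriv v (a * b)))
      rw [d2]
      exact (MixedBounded.add ((cm ca2 hbc).add (cm ca1 cb1)) ((cm ca1 cb1).add (cm hac cb2))
        (MixedBounded.add (cm ca2 hbc) (cm ca1 cb1) (ih ca2 hbc ha2 hb0) (ih ca1 cb1 ha1 hb1))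
        (MixedBounded.add (cm ca1 cb1) (cm hac cb2) (ih ca1 cb1 ha1 hb1)
          (ih hac cb2 ha0 hb2))).mono (by linarith)

variable {ι : Type*}

lemma dirMonomial_append (u : ι → E) (l l' : List ι) (k : ι → Fin 3) (F : E → ℂ) :
    dirMonomial u (l ++ l') k F = dirMonomial u l k (dirMonomial u l' k F) :=
  List.foldr_append

/-- `MixedBounded` differentiates along the head of the list first, `dirMonomial` along the head
last; hence the reversal. -/
lemma MixedBounded.norm_dirMonomial_le {u : ι → E} {l : List ι} {A : ℝ} {F : E → ℂ}
    (hF : MixedBounded (l.map u) A F) (k : ι → Fin 3) (x : E) :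
    ‖dirMonomial u l.reverse k F x‖ ≤ A := by
  induction l generalizing F with
  | nil => exact hF x
  | cons j l ih =>
    rw [List.reverse_cons, dirMonomial_append]
    exact ih (hF (k j))

lemma mixedBounded_of_norm_dirMonomial_le [DecidableEq ι] {u : ι → E} {l : List ι} (hl : l.Nodup)
    {A : ℝ} {F : E → ℂ} (hF : ∀ k x, ‖dirMonomial u l.reverse k F x‖ ≤ A) :
    MixedBounded (l.map u) A F := by
  induction l generalizing F with
  | nil => exact fun x => hF 0 x
  | cons j l ih =>
    rw [List.nodup_cons] at hl
    refine fun r => ih hl.2 fun k x => ?_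
    have := hF (Function.update k j r) x
    rw [List.reverse_cons, dirMonomial_append, dirMonomial_congr (k' := k)] at this
    · simpa [dirMonomial] using this
    · intro i hi
      rw [Function.update_of_ne]
      rintro rfl
      exact hl.1 (List.mem_reverse.1 hi)

/-- Schwartz functions composed with contracting dilations have uniformly bounded mixed
derivatives. -/
lemma exists_mixedBounded_schwartz {E' : Type*} [NormedAddCommGroup E'] [NormedSpace ℝ E']
    (L : E →L[ℝ] E') (D : List E) (χ : 𝓢(E', ℂ)) :
    ∃ A, ∀ (c : E') (ε : ℝ), |ε| ≤ 1 → MixedBounded D A fun x => χ (ε • (c + L x)) := by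
  induction D generalizing χ with
  | nil =>
    obtain ⟨C, hC⟩ := χ.decay 0 0
    exact ⟨C, fun c ε _ x => by simpa using hC.2 (ε • (c + L x))⟩
  | cons v D ih =>
    -- A derivative gives a factor `ε`, at most `1` in absolute value, and another Schwartz function
    -- of the same argument, so the bound is uniform in both `c` and `ε`.
    have hstep : ∀ (χ : 𝓢(E', ℂ)) (c : E') (ε : ℝ), dirDeriv v (fun x => χ (ε • (c + L x)))
        = ε • fun x => (LineDeriv.lineDerivOp (L v) χ : 𝓢(E', ℂ)) (ε • (c + L x)) :=
      fun χ c ε => by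
        have h1 := dirDeriv_comp_affine χ (ε • c) (ε • L) v
        simp only [FunLike.coe_smul, Pi.smul_apply, ← smul_add] at h1
        rw [h1, dirDeriv_smul_left]
        ext x
        simp [SchwartzMap.lineDerivOp_apply, dirDeriv]
    obtain ⟨A0, h0⟩ := ih χ
    obtain ⟨A1, h1⟩ := ih (LineDeriv.lineDerivOp (L v) χ)
    obtain ⟨A2, h2⟩ := ih (LineDeriv.lineDerivOp (L v) (LineDeriv.lineDerivOp (L v) χ : 𝓢(E', ℂ)))
    refine ⟨max A0 (max A1 A2), fun c ε hε r => ?_⟩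
    fin_cases r
    · exact (h0 c ε hε).mono (le_max_left _ _)
    · change MixedBounded D _ (dirDeriv v fun x => χ (ε • (c + L x)))
      rw [hstep]
      exact ((h1 c ε hε).mono ((le_max_left _ _).trans (le_max_right _ _))).smul hε
    · change MixedBounded D _ (dirDeriv v (dirDeriv v fun x => χ (ε • (c + L x))))
      rw [hstep, dirDeriv_const_smul, hstep]
      exact (((h2 c ε hε).mono ((le_max_right _ _).trans (le_max_right _ _))).smul hε).smul hε

end MixedBounds

end BealsWeyl
end

noncomputable section

open MeasureTheory

set_option linter.unusedSectionVars false

namespace BealsWeyl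

/-! ### Symbol bounds in centred variables. -/

section Symbols

variable {H : Type*} [NormedAddCommGroup H] [InnerProductSpace ℝ H] {n : ℕ}

/-- A smooth function on `H⁴` whose mixed diagonal derivatives `D^k Φ` of order at most two in
each coordinate are bounded by `N k * exp(|X - Y|²/(4h))`. -/
structure IsBealsSymbol (e : OrthonormalBasis (Fin n) ℝ H) (h : ℝ)
    (N : (Fin n ⊕ Fin n → Fin 3) → ℝ) (Φ : (H × H) × (H × H) → ℂ) : Prop where
  smooth : ContDiff ℝ ∞ Φ
  bound : ∀ k p, ‖dirMonomial (fun i => (coordDir e i, coordDir e i)) (coordList n) k Φ p‖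
    ≤ N k * Real.exp (normSq (p.1 - p.2) / (4 * h))

lemma dirMonomial_zero {E ι : Type*} [NormedAddCommGroup E] [NormedSpace ℝ E] (u : ι → E)
    (l : List ι) (F : E → ℂ) : dirMonomial u l 0 F = F := by
  induction l with
  | nil => rfl
  | cons j l ih => rw [dirMonomial_cons, ih]; rfl

lemma centre_eq_add (Z V M : H × H) :
    centre Z (V, M) = (Z + V, Z - V)
      + ((ContinuousLinearMap.id ℝ (H × H)).prod (ContinuousLinearMap.id ℝ (H × H))) M := by
  ext1 <;> simp [centre] <;> abel

/-- Varying `M` translates `X` and `Y` by the same vector; this is why only diagonal derivatives of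
`Φ` enter the norm. -/
lemma coordMonomial_comp_centre (e : OrthonormalBasis (Fin n) ℝ H) (k : Fin n ⊕ Fin n → Fin 3)
    (Φ : (H × H) × (H × H) → ℂ) (Z V : H × H) :
    coordMonomial e k (fun M => Φ (centre Z (V, M)))
      = fun M => dirMonomial (fun i => (coordDir e i, coordDir e i)) (coordList n) k Φ
        (centre Z (V, M)) := by
  simp_rw [centre_eq_add]
  exact dirMonomial_comp_affine Φ _ _ _ _ _

lemma contDiff_comp_centre {Φ : (H × H) × (H × H) → ℂ} (hΦ : ContDiff ℝ ∞ Φ) (Z V : H × H) :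
    ContDiff ℝ ∞ fun M => Φ (centre Z (V, M)) := by
  simp_rw [centre_eq_add]
  exact hΦ.comp (contDiff_const.add (ContinuousLinearMap.contDiff _))

namespace IsBealsSymbol

variable {e : OrthonormalBasis (Fin n) ℝ H} {h : ℝ} {N : (Fin n ⊕ Fin n → Fin 3) → ℝ}
  {Φ : (H × H) × (H × H) → ℂ}

lemma nonneg (hΦ : IsBealsSymbol e h N Φ) (k) : 0 ≤ N k := by
  simpa using (norm_nonneg _).trans (hΦ.bound k 0)

lemma norm_coordMonomial_le (hΦ : IsBealsSymbol e h N Φ) (hh : 0 < h) (Z V : H × H) (k)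
    (M : H × H) : ‖coordMonomial e k (fun M => Φ (centre Z (V, M))) M‖
      ≤ N k * Real.exp (normSq V / h) := by
  rw [coordMonomial_comp_centre]
  have := hΦ.bound k (centre Z (V, M))
  rwa [normSq_centre_sub Z _ hh] at this

lemma norm_apply_le (hΦ : IsBealsSymbol e h N Φ) (p) :
    ‖Φ p‖ ≤ N 0 * Real.exp (normSq (p.1 - p.2) / (4 * h)) := by
  simpa [dirMonomial_zero] using hΦ.bound 0 p

lemma norm_comp_centre_le (hΦ : IsBealsSymbol e h N Φ) (hh : 0 < h) (Z : H × H) (p) :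
    ‖Φ (centre Z p)‖ ≤ N 0 * Real.exp (normSq p.1 / h) := by
  have := hΦ.norm_apply_le (centre Z p)
  rwa [normSq_centre_sub Z _ hh] at this

/-- The points `M` and `M'` are kept independent because the Fubini argument for distributions
evaluates the symbol at `P` and the kernel at `P - Z`. -/
lemma norm_mul_centredKernel_le (hΦ : IsBealsSymbol e h N Φ) (hh : 0 < h) (Z V M M' : H × H) :
    ‖Φ (centre Z (V, M)) * centredKernel h V M'‖ ≤ N 0 * Real.exp (-(normSq M' / h)) := by
  rw [norm_mul, norm_centredKernel]
  calc _ ≤ N 0 * Real.exp (normSq V / h)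
        * (Real.exp (-(normSq M' / h)) * Real.exp (-(normSq V / h))) := by
        gcongr; exact hΦ.norm_comp_centre_le hh Z (V, M)
    _ = N 0 * Real.exp (-(normSq M' / h))
        * (Real.exp (normSq V / h) * Real.exp (-(normSq V / h))) := by ring
    _ = _ := by rw [← Real.exp_add, add_neg_cancel, Real.exp_zero, mul_one]

end IsBealsSymbol

end Symbols

/-! ### The Beals transform as an iterated integral, its continuity and its bound. -/

section Transform

variable {H : Type*} [NormedAddCommGroup H] [InnerProductSpace ℝ H] {n : ℕ}
  [FiniteDimensional ℝ H] [MeasurableSpace H] [BorelSpace H]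

instance isAddHaarMeasure_volume_prod_prod :
    (volume : Measure ((H × H) × (H × H))).IsAddHaarMeasure := by
  rw [Measure.volume_eq_prod]
  exact Measure.prod.instIsAddHaarMeasure volume volume

/-- This sup-norm form serves for symbols. The sharper form with integrals of derivatives is kept
for test functions, where integrability in a further variable is needed. -/
lemma norm_integral_mul_centredKernel_le_of_bound (e : OrthonormalBasis (Fin n) ℝ H) {h : ℝ}
    (hh : 0 < h) {F : H × H → ℂ} (hF : ContDiff ℝ ∞ F) {b : (Fin n ⊕ Fin n → Fin 3) → ℝ}
    (hb : ∀ k X, ‖coordMonomial e k F X‖ ≤ b k) (V : H × H) :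
    ‖∫ M, F M * centredKernel h V M‖ ≤ h ^ n * Real.exp (-(normSq V / h)) * decay e h V
      * ∑ k, √h ^ (∑ i, (k i : ℕ)) * (weightBound ^ (2 * n) * b k) := by
  refine (norm_integral_mul_centredKernel_le e hh hF (fun k => ⟨b k, hb k⟩) V).trans ?_
  refine mul_le_mul_of_nonneg_left (Finset.sum_le_sum fun k _ => ?_)
    (by have := decay_nonneg e h V; positivity)
  refine mul_le_mul_of_nonneg_left ?_ (by positivity)
  have hb0 : 0 ≤ b k := (norm_nonneg _).trans (hb k 0)
  calc ∫ x, fullWeight k x * ‖coordMonomial e k F (coordMap e h x)‖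
      ≤ ∫ x, fullWeight k x * b k := by
        refine integral_mono_of_nonneg
          (Filter.Eventually.of_forall fun x => mul_nonneg (fullWeight_nonneg k x) (norm_nonneg _))
          ((integrable_fullWeight k).mul_const _) (Filter.Eventually.of_forall fun x => ?_)
        exact mul_le_mul_of_nonneg_left (hb k _) (fullWeight_nonneg k x)
    _ = (∫ x, fullWeight k x) * b k := integral_mul_const _ _
    _ ≤ weightBound ^ (2 * n) * b k := by
        have := integral_fullWeight_le k
        rw [Fintype.card_sum, Fintype.card_fin, ← two_mul] at this
        exact mul_le_mul_of_nonneg_right this hb0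

/-- The integral over `M = (X + Y) / 2 - Z` in the Beals transform, for fixed
`V = (X - Y) / 2`. -/
def partialTransform (h : ℝ) (Φ : (H × H) × (H × H) → ℂ) (Z V : H × H) : ℂ :=
  ∫ M, Φ (centre Z (V, M)) * centredKernel h V M

/-- The normalization of the Beals transform. -/
def bealsConst (n : ℕ) (h : ℝ) : ℝ := (2 : ℝ) ^ n / (2 * Real.pi * h) ^ (2 * n)

/-- The Beals transform as an iterated integral. -/
def bealsTransform (n : ℕ) (h : ℝ) (Φ : (H × H) × (H × H) → ℂ) (Z : H × H) : ℂ :=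
  ((bealsConst n h * 4 ^ n : ℝ) : ℂ) * ∫ V, partialTransform h Φ Z V

/-- The weighted sum of the bounds of the derivatives of a symbol. -/
def scaledSum (h : ℝ) (N : (Fin n ⊕ Fin n → Fin 3) → ℝ) : ℝ :=
  ∑ k, √h ^ (∑ i, (k i : ℕ)) * N k

lemma bealsConst_nonneg (n : ℕ) {h : ℝ} (hh : 0 < h) : 0 ≤ bealsConst n h := by
  unfold bealsConst; positivity

namespace IsBealsSymbol

variable {e : OrthonormalBasis (Fin n) ℝ H} {h : ℝ} {N : (Fin n ⊕ Fin n → Fin 3) → ℝ}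
  {Φ : (H × H) × (H × H) → ℂ}

/-- The growth `exp(|V|²/h)` of the derivatives of the symbol cancels the Gaussian in `V`; what
remains is the gain from integration by parts, uniform in `Z`. -/
lemma norm_partialTransform_le (hΦ : IsBealsSymbol e h N Φ) (hh : 0 < h) (Z V : H × H) :
    ‖partialTransform h Φ Z V‖
      ≤ h ^ n * (weightBound ^ (2 * n) * scaledSum h N) * decay e h V := by
  refine (norm_integral_mul_centredKernel_le_of_bound e hh (contDiff_comp_centre hΦ.smooth Z V)
    (hΦ.norm_coordMonomial_le hh Z V) V).trans_eq ?_
  have : ∀ k : Fin n ⊕ Fin n → Fin 3, √h ^ (∑ i, (k i : ℕ))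
      * (weightBound ^ (2 * n) * (N k * Real.exp (normSq V / h)))
      = weightBound ^ (2 * n) * Real.exp (normSq V / h) * (√h ^ (∑ i, (k i : ℕ)) * N k) :=
    fun k => by ring
  simp_rw [this, ← Finset.mul_sum, scaledSum]
  have h1 : Real.exp (-(normSq V / h)) * Real.exp (normSq V / h) = 1 := by
    rw [← Real.exp_add, neg_add_cancel, Real.exp_zero]
  linear_combination (h ^ n * decay e h V * weightBound ^ (2 * n)
    * ∑ k, √h ^ (∑ i, (k i : ℕ)) * N k) * h1

lemma integrable_mul_centredKernel (hΦ : IsBealsSymbol e h N Φ) (hh : 0 < h) (Z V : H × H) :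
    Integrable fun M => Φ (centre Z (V, M)) * centredKernel h V M := by
  refine ((integrable_exp_neg_normSq hh).const_mul (N 0)).mono' ?_
    (Filter.Eventually.of_forall fun M => hΦ.norm_mul_centredKernel_le hh Z V M M)
  have h1 := (contDiff_comp_centre hΦ.smooth Z V).continuous
  have h2 := (continuous_centredKernel h).comp (Continuous.prodMk_right V)
  exact (h1.mul h2).aestronglyMeasurable

lemma stronglyMeasurable_partialTransform (hΦ : IsBealsSymbol e h N Φ) :
    StronglyMeasurable fun q : (H × H) × (H × H) => partialTransform h Φ q.1 q.2 := by
  have hc : Continuous fun q : ((H × H) × (H × H)) × (H × H) =>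
      Φ (centre q.1.1 (q.1.2, q.2)) * centredKernel h q.1.2 q.2 := by
    have h1 := hΦ.smooth.continuous
    exact (h1.comp (by fun_prop)).mul (by fun_prop)
  exact hc.stronglyMeasurable.integral_prod_right (ν := volume)

lemma continuous_partialTransform (hΦ : IsBealsSymbol e h N Φ) (hh : 0 < h) (V : H × H) :
    Continuous fun Z => partialTransform h Φ Z V := by
  refine continuous_of_dominated (bound := fun M => N 0 * Real.exp (-(normSq M / h)))
    (fun Z => (hΦ.integrable_mul_centredKernel hh Z V).aestronglyMeasurable)
    (fun Z => Filter.Eventually.of_forall fun M => hΦ.norm_mul_centredKernel_le hh Z V M M)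
    ((integrable_exp_neg_normSq hh).const_mul _) (Filter.Eventually.of_forall fun M => ?_)
  exact (hΦ.smooth.continuous.comp (by fun_prop)).mul continuous_const

lemma continuous_bealsTransform (hΦ : IsBealsSymbol e h N Φ) (hh : 0 < h) :
    Continuous (bealsTransform n h Φ) := by
  refine continuous_const.mul (continuous_of_dominated
    (fun Z => (hΦ.stronglyMeasurable_partialTransform.comp_measurable
      measurable_prodMk_left).aestronglyMeasurable)
    (fun Z => Filter.Eventually.of_forall (hΦ.norm_partialTransform_le hh Z))
    ((integrable_decay e hh).const_mul _)
    (Filter.Eventually.of_forall (hΦ.continuous_partialTransform hh)))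

lemma norm_bealsTransform_le (hΦ : IsBealsSymbol e h N Φ) (hh : 0 < h) (Z : H × H) :
    ‖bealsTransform n h Φ Z‖ ≤ (weightBound ^ 2 / 2) ^ n * scaledSum h N := by
  have h0 := bealsConst_nonneg n hh
  rw [bealsTransform, norm_mul, Complex.norm_real, Real.norm_of_nonneg (by positivity)]
  have h1 : ‖∫ V, partialTransform h Φ Z V‖
      ≤ h ^ n * (weightBound ^ (2 * n) * scaledSum h N) * (h ^ n * (Real.pi / 2) ^ (2 * n)) := by
    rw [← integral_decay e hh, ← integral_const_mul]
    exact norm_integral_le_of_norm_le ((integrable_decay e hh).const_mul _)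
      (Filter.Eventually.of_forall (hΦ.norm_partialTransform_le hh Z))
  refine (mul_le_mul_of_nonneg_left h1 (by positivity)).trans_eq ?_
  -- The powers of `h` and `π` cancel: per dimension, `2 · 4 · (π/2)² / (2π)² = 1/2`.
  have e1 : bealsConst n h * 4 ^ n * (h ^ n * h ^ n * (Real.pi / 2) ^ (2 * n)) = (1 / 2) ^ n := by
    rw [bealsConst, pow_mul, pow_mul, ← mul_pow, ← mul_pow, div_mul_eq_mul_div, ← mul_pow,
      div_mul_eq_mul_div, ← mul_pow, ← div_pow]
    congr 1
    have := Real.pi_pos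
    field_simp
    ring
  rw [div_eq_mul_one_div (weightBound ^ 2), mul_pow, ← e1, pow_mul weightBound]
  ring

end IsBealsSymbol

end Transform

end BealsWeyl
end

noncomputable section

open MeasureTheory

set_option linter.unusedSectionVars false

namespace BealsWeyl

/-! ### Convergence of the regularized oscillatory integrals. -/

section Oscillatory

variable {H : Type*} [NormedAddCommGroup H] [InnerProductSpace ℝ H] {n : ℕ}
  [FiniteDimensional ℝ H] [MeasurableSpace H] [BorelSpace H]

lemma mixedBounded_of_norm_coordMonomial_le {e : OrthonormalBasis (Fin n) ℝ H} {A : ℝ}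
    {F : H × H → ℂ} (hF : ∀ k X, ‖coordMonomial e k F X‖ ≤ A) :
    MixedBounded ((coordList n).reverse.map (coordDir e)) A F :=
  mixedBounded_of_norm_dirMonomial_le (List.nodup_reverse.2 (nodup_coordList n)) fun k x => by
    rw [List.reverse_reverse]
    exact hF k x

lemma MixedBounded.norm_coordMonomial_le {e : OrthonormalBasis (Fin n) ℝ H} {A : ℝ}
    {F : H × H → ℂ} (hF : MixedBounded ((coordList n).reverse.map (coordDir e)) A F) (k X) :
    ‖coordMonomial e k F X‖ ≤ A := by
  have := hF.norm_dirMonomial_le k X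
  rwa [List.reverse_reverse] at this

lemma bealsKernel_centre {h : ℝ} (hh : 0 < h) (Z : H × H) (p : (H × H) × (H × H)) :
    bealsKernel h (centre Z p).1 (centre Z p).2 Z = centredKernel h p.1 p.2 :=
  bealsKernel_eq_centredKernel hh.ne' Z p.1 p.2

lemma continuous_bealsKernel (h : ℝ) (Z : H × H) :
    Continuous fun p : (H × H) × (H × H) => bealsKernel h p.1 p.2 Z := by
  unfold bealsKernel
  fun_prop

namespace IsBealsSymbol

variable {e : OrthonormalBasis (Fin n) ℝ H} {h : ℝ} {N : (Fin n ⊕ Fin n → Fin 3) → ℝ}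
  {Φ : (H × H) × (H × H) → ℂ}

lemma norm_mul_bealsKernel_le (hΦ : IsBealsSymbol e h N Φ) (hh : 0 < h) (Z : H × H)
    (p : (H × H) × (H × H)) : ‖Φ p * bealsKernel h p.1 p.2 Z‖ ≤ N 0 := by
  obtain ⟨q, rfl⟩ := (centreEquiv Z).surjective p
  change ‖Φ (centre Z q) * bealsKernel h (centre Z q).1 (centre Z q).2 Z‖ ≤ N 0
  rw [bealsKernel_centre hh]
  refine (hΦ.norm_mul_centredKernel_le hh Z q.1 q.2 q.2).trans ?_
  refine mul_le_of_le_one_right (hΦ.nonneg 0) (Real.exp_le_one_iff.2 ?_)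
  have := normSq_nonneg q.2
  rw [neg_nonpos]
  positivity

lemma integrable_cutoff_mul (hΦ : IsBealsSymbol e h N Φ) (hh : 0 < h) (Z : H × H)
    (χ : 𝓢((H × H) × (H × H), ℂ)) {ε : ℝ} (hε : 0 < ε) :
    Integrable fun p => χ (ε • p) * (Φ p * bealsKernel h p.1 p.2 Z) := by
  have h1 : Integrable fun p => χ (ε • p) :=
    (integrable_comp_smul_iff volume χ hε.ne').2 χ.integrable
  exact h1.mul_bdd (hΦ.smooth.continuous.mul (continuous_bealsKernel h Z)).aestronglyMeasurable
    (Filter.Eventually.of_forall (hΦ.norm_mul_bealsKernel_le hh Z))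

/-- This supplies the dominating function in `V` for the limit `ε → 0`: the cut-off is carried
through the integrations by parts by Leibniz' rule, at a cost independent of `ε`. -/
lemma exists_norm_cutoff_le (hΦ : IsBealsSymbol e h N Φ) (hh : 0 < h) (Z : H × H)
    (χ : 𝓢((H × H) × (H × H), ℂ)) :
    ∃ C, ∀ ε : ℝ, |ε| ≤ 1 → ∀ V,
      ‖∫ M, (χ (ε • centre Z (V, M)) * Φ (centre Z (V, M))) * centredKernel h V M‖
        ≤ C * decay e h V := by
  obtain ⟨A, hA⟩ := exists_mixedBounded_schwartz
    ((ContinuousLinearMap.id ℝ (H × H)).prod (ContinuousLinearMap.id ℝ (H × H)))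
    ((coordList n).reverse.map (coordDir e)) χ
  -- `MixedBounded` takes a single constant for all multi-indices; the sum dominates each `N k`, and
  -- its size is irrelevant for domination.
  set B : ℝ := ∑ k, N k with hB
  set m : ℕ := ((coordList n).reverse.map (coordDir e)).length with hm
  refine ⟨h ^ n * ∑ k : Fin n ⊕ Fin n → Fin 3, √h ^ (∑ i, (k i : ℕ))
    * (weightBound ^ (2 * n) * (4 ^ m * (A * B))), fun ε hε V => ?_⟩
  have hχ : MixedBounded ((coordList n).reverse.map (coordDir e)) A
      fun M => χ (ε • centre Z (V, M)) := by
    simp_rw [centre_eq_add]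
    exact hA _ ε hε
  have hΦb : MixedBounded ((coordList n).reverse.map (coordDir e)) (B * Real.exp (normSq V / h))
      fun M => Φ (centre Z (V, M)) := by
    refine mixedBounded_of_norm_coordMonomial_le fun k M =>
      (hΦ.norm_coordMonomial_le hh Z V k M).trans ?_
    gcongr
    exact Finset.single_le_sum (fun k _ => hΦ.nonneg k) (Finset.mem_univ k)
  have hΦc := contDiff_comp_centre hΦ.smooth Z V
  have hχc : ContDiff ℝ ∞ fun M => χ (ε • centre Z (V, M)) :=
    contDiff_comp_centre (Φ := fun p => χ (ε • p))
      ((χ.smooth ⊤).comp (contDiff_const_smul ε)) Z V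
  have hmul := hχ.mul hχc hΦc hΦb
  have key := norm_integral_mul_centredKernel_le_of_bound e hh (hχc.mul hΦc)
    (fun k X => hmul.norm_coordMonomial_le k X) V
  refine key.trans_eq ?_
  have h1 : Real.exp (-(normSq V / h)) * Real.exp (normSq V / h) = 1 := by
    rw [← Real.exp_add, neg_add_cancel, Real.exp_zero]
  rw [← Finset.sum_mul, ← Finset.sum_mul]
  linear_combination (h ^ n * decay e h V * (∑ k : Fin n ⊕ Fin n → Fin 3, √h ^ (∑ i, (k i : ℕ)))
    * (weightBound ^ (2 * n) * (4 ^ m * (A * B)))) * h1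

lemma integral_cutoff_mul (hΦ : IsBealsSymbol e h N Φ) (hh : 0 < h) (Z : H × H)
    (χ : 𝓢((H × H) × (H × H), ℂ)) {ε : ℝ} (hε : 0 < ε) :
    ∫ p, χ (ε • p) * (Φ p * bealsKernel h p.1 p.2 Z)
      = (4 : ℝ) ^ n • ∫ V, ∫ M, (χ (ε • centre Z (V, M)) * Φ (centre Z (V, M)))
        * centredKernel h V M := by
  have h1 := (integrable_comp_centre_iff Z _).2 (hΦ.integrable_cutoff_mul hh Z χ hε)
  rw [integral_comp_centre Z, finrank_eq e]
  congr 1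
  simp_rw [bealsKernel_centre hh, ← mul_assoc] at h1 ⊢
  exact integral_prod _ h1

/-- Dominated convergence is applied twice: in `M` for fixed `V`, with a Gaussian bound, and then in
`V`, with the bound by `decay`. -/
lemma isBealsTransform (hΦ : IsBealsSymbol e h N Φ) (hh : 0 < h) :
    IsBealsTransform n h Φ (bealsTransform n h Φ) := by
  intro Z χ hχ
  have e1 : ∀ (ε : ℝ) (p : (H × H) × (H × H)),
      χ (ε • p) * ((((2 : ℝ) ^ n / (2 * Real.pi * h) ^ (2 * n) : ℝ) : ℂ)
        * (Φ p * bealsKernel h p.1 p.2 Z))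
      = ((bealsConst n h : ℝ) : ℂ) * (χ (ε • p) * (Φ p * bealsKernel h p.1 p.2 Z)) :=
    fun ε p => by rw [bealsConst]; ring
  simp_rw [e1]
  refine ⟨fun ε hε => (hΦ.integrable_cutoff_mul hh Z χ hε).const_mul _, ?_⟩
  simp_rw [integral_const_mul]
  obtain ⟨C, hC⟩ := hΦ.exists_norm_cutoff_le hh Z χ
  obtain ⟨D, hD⟩ := χ.decay 0 0
  have hD' : ∀ x, ‖χ x‖ ≤ D := fun x => by simpa using hD.2 x
  have hpos : ∀ᶠ ε : ℝ in 𝓝[>] 0, 0 < ε ∧ |ε| ≤ 1 := by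
    filter_upwards [Ioc_mem_nhdsGT (zero_lt_one' ℝ)] with ε hε
    exact ⟨hε.1, by rw [abs_of_pos hε.1]; exact hε.2⟩
  have hcont : ∀ ε : ℝ, Continuous fun p : (H × H) × (H × H) =>
      χ (ε • centre Z p) * Φ (centre Z p) * centredKernel h p.1 p.2 := fun ε =>
    ((χ.continuous.comp (by fun_prop)).mul (hΦ.smooth.continuous.comp (by fun_prop))).mul
      (by fun_prop)
  have hlim : Filter.Tendsto (fun ε : ℝ => ∫ V, ∫ M,
      (χ (ε • centre Z (V, M)) * Φ (centre Z (V, M))) * centredKernel h V M) (𝓝[>] 0)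
      (𝓝 (∫ V, partialTransform h Φ Z V)) := by
    refine tendsto_integral_filter_of_dominated_convergence (fun V => C * decay e h V)
      (Filter.Eventually.of_forall fun ε => ?_)
      (hpos.mono fun ε hε => Filter.Eventually.of_forall (hC ε hε.2))
      ((integrable_decay e hh).const_mul _) (Filter.Eventually.of_forall fun V => ?_)
    · exact ((hcont ε).stronglyMeasurable.integral_prod_right (ν := volume)).aestronglyMeasurable
    · refine tendsto_integral_filter_of_dominated_convergence
        (fun M => D * (N 0 * Real.exp (-(normSq M / h)))) (Filter.Eventually.of_forall fun ε => ?_)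
        (Filter.Eventually.of_forall fun ε => Filter.Eventually.of_forall fun M => ?_)
        (((integrable_exp_neg_normSq hh).const_mul _).const_mul _)
        (Filter.Eventually.of_forall fun M => ?_)
      · exact ((hcont ε).comp (Continuous.prodMk_right V)).aestronglyMeasurable
      · rw [mul_assoc, norm_mul]
        exact mul_le_mul (hD' _) (hΦ.norm_mul_centredKernel_le hh Z V M M) (norm_nonneg _)
          ((norm_nonneg _).trans (hD' 0))
      · have h1 : Continuous fun ε : ℝ =>
            (χ (ε • centre Z (V, M)) * Φ (centre Z (V, M))) * centredKernel h V M :=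
          ((χ.continuous.comp (by fun_prop)).mul continuous_const).mul continuous_const
        have h2 := (h1.tendsto 0).mono_left (nhdsWithin_le_nhds (s := Set.Ioi 0))
        simpa [hχ] using h2
  have h3 := (hlim.const_mul ((bealsConst n h * 4 ^ n : ℝ) : ℂ))
  refine h3.congr' (hpos.mono fun ε hε => ?_)
  beta_reduce
  rw [hΦ.integral_cutoff_mul hh Z χ hε.1, Complex.real_smul]
  push_cast
  ring

end IsBealsSymbol

end Oscillatory

end BealsWeyl
end

noncomputable section

open MeasureTheory

set_option linter.unusedSectionVars false

namespace BealsWeyl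

/-! ### The transform in the sense of distributions. -/

section Distributions

variable {H : Type*} [NormedAddCommGroup H] [InnerProductSpace ℝ H] {n : ℕ}
  [FiniteDimensional ℝ H] [MeasurableSpace H] [BorelSpace H]

lemma centre_sub (Z V P : H × H) : centre Z (V, P - Z) = centre 0 (V, P) := by
  ext1 <;> simp [centre]

lemma bealsKernel_centre_zero {h : ℝ} (hh : 0 < h) (Z V P : H × H) :
    bealsKernel h (centre 0 (V, P)).1 (centre 0 (V, P)).2 Z = centredKernel h V (P - Z) := by
  rw [← centre_sub Z, bealsKernel_centre hh]

/-- The pairing of the Beals kernel with a function of `Z`. -/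
def kernelPairing (h : ℝ) (φ : H × H → ℂ) (p : (H × H) × (H × H)) : ℂ :=
  ∫ Z, bealsKernel h p.1 p.2 Z * φ Z

lemma kernelPairing_centre {h : ℝ} (hh : 0 < h) (φ : H × H → ℂ) (V P : H × H) :
    kernelPairing h φ (centre 0 (V, P)) = ∫ Z, centredKernel h V (P - Z) * φ Z := by
  simp_rw [kernelPairing, bealsKernel_centre_zero hh]

lemma stronglyMeasurable_kernelPairing_centre {h : ℝ} (hh : 0 < h) {φ : H × H → ℂ}
    (hφ : Continuous φ) :
    StronglyMeasurable fun q : (H × H) × (H × H) => kernelPairing h φ (centre 0 q) := by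
  have h1 : (fun q : (H × H) × (H × H) => kernelPairing h φ (centre 0 q))
      = fun q : (H × H) × (H × H) => ∫ Z, centredKernel h q.1 (q.2 - Z) * φ Z := by
    ext q
    exact kernelPairing_centre hh φ q.1 q.2
  rw [h1]
  have h2 : Continuous fun r : ((H × H) × (H × H)) × (H × H) =>
      centredKernel h r.1.1 (r.1.2 - r.2) * φ r.2 := by
    refine Continuous.mul ?_ (hφ.comp continuous_snd)
    fun_prop
  exact h2.stronglyMeasurable.integral_prod_right (ν := volume)

namespace IsBealsSymbol

variable {e : OrthonormalBasis (Fin n) ℝ H} {h : ℝ} {N : (Fin n ⊕ Fin n → Fin 3) → ℝ}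
  {Φ : (H × H) × (H × H) → ℂ}

lemma integrable_partialTransform_mul (hΦ : IsBealsSymbol e h N Φ) (hh : 0 < h)
    {φ : H × H → ℂ} (hφ : Integrable φ) :
    Integrable fun q : (H × H) × (H × H) => partialTransform h Φ q.1 q.2 * φ q.1 := by
  refine (hφ.norm.mul_prod ((integrable_decay e hh).const_mul
    (h ^ n * (weightBound ^ (2 * n) * scaledSum h N)))).mono' ?_
    (Filter.Eventually.of_forall fun q => ?_)
  · exact hΦ.stronglyMeasurable_partialTransform.aestronglyMeasurable.mul
      hφ.aestronglyMeasurable.comp_fst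
  · rw [norm_mul, mul_comm]
    exact mul_le_mul_of_nonneg_left (hΦ.norm_partialTransform_le hh _ _) (norm_nonneg _)

/-- With `P = M + Z` in place of `M` the symbol no longer depends on `Z`, so after Fubini the
`Z`-integral falls on the kernel alone. -/
lemma integral_partialTransform_mul (hΦ : IsBealsSymbol e h N Φ) (hh : 0 < h)
    {φ : H × H → ℂ} (hφc : Continuous φ) (hφ : Integrable φ) (V : H × H) :
    ∫ Z, partialTransform h Φ Z V * φ Z
      = ∫ P, Φ (centre 0 (V, P)) * kernelPairing h φ (centre 0 (V, P)) := by
  have e1 : ∀ Z, partialTransform h Φ Z V * φ Z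
      = ∫ P, Φ (centre 0 (V, P)) * centredKernel h V (P - Z) * φ Z := fun Z => by
    rw [integral_mul_const, partialTransform,
      ← integral_sub_right_eq_self (fun M => Φ (centre Z (V, M)) * centredKernel h V M) Z]
    simp_rw [centre_sub]
  have hint : Integrable (Function.uncurry fun Z P =>
      Φ (centre 0 (V, P)) * centredKernel h V (P - Z) * φ Z)
      ((volume : Measure (H × H)).prod (volume : Measure (H × H))) := by
    have h1 := (measurePreserving_prod_sub (volume : Measure (H × H))
      (volume : Measure (H × H))).integrable_comp_of_integrable
      (hφ.norm.mul_prod ((integrable_exp_neg_normSq hh).const_mul (N 0)))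
    refine h1.mono' ?_ (Filter.Eventually.of_forall fun q => ?_)
    · have hc : Continuous fun q : (H × H) × (H × H) =>
          Φ (centre 0 (V, q.2)) * centredKernel h V (q.2 - q.1) * φ q.1 :=
        ((hΦ.smooth.continuous.comp (by fun_prop)).mul (by fun_prop)).mul
          (hφc.comp continuous_fst)
      exact hc.aestronglyMeasurable
    · simp only [Function.uncurry, Function.comp_apply]
      rw [norm_mul, mul_comm]
      exact mul_le_mul_of_nonneg_left (hΦ.norm_mul_centredKernel_le hh 0 V q.2 (q.2 - q.1))
        (norm_nonneg _)
  simp_rw [e1]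
  rw [integral_integral_swap hint]
  refine integral_congr_ae (Filter.Eventually.of_forall fun P => ?_)
  beta_reduce
  rw [kernelPairing_centre hh, ← integral_const_mul]
  simp_rw [mul_assoc]

/-- Integrability of the pairing is a hypothesis, and `φ` need not have compact support, so that the
formula also applies to the Gaussian of the heat operator. -/
lemma integral_bealsTransform_mul (hΦ : IsBealsSymbol e h N Φ) (hh : 0 < h)
    {φ : H × H → ℂ} (hφc : Continuous φ) (hφ : Integrable φ)
    (hΨ : Integrable fun p => Φ p * kernelPairing h φ p) :
    ∫ Z, bealsTransform n h Φ Z * φ Z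
      = (bealsConst n h : ℂ) * ∫ p, Φ p * kernelPairing h φ p := by
  have e1 : ∀ Z, bealsTransform n h Φ Z * φ Z
      = ((bealsConst n h * 4 ^ n : ℝ) : ℂ) * ∫ V, partialTransform h Φ Z V * φ Z := fun Z => by
    rw [integral_mul_const, bealsTransform, mul_assoc]
  have h2 := (integrable_comp_centre_iff 0 _).2 hΨ
  simp_rw [e1, integral_const_mul]
  rw [integral_integral_swap (f := fun Z V => partialTransform h Φ Z V * φ Z)
    (hΦ.integrable_partialTransform_mul hh hφ)]
  simp_rw [hΦ.integral_partialTransform_mul hh hφc hφ]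
  rw [integral_comp_centre 0 fun p => Φ p * kernelPairing h φ p, finrank_eq e,
    Complex.real_smul]
  have h3 : ∫ p, Φ (centre 0 p) * kernelPairing h φ (centre 0 p)
      = ∫ V, ∫ P, Φ (centre 0 (V, P)) * kernelPairing h φ (centre 0 (V, P)) :=
    integral_prod _ h2
  rw [h3]
  push_cast
  ring

end IsBealsSymbol

lemma HasCompactSupport.dirDeriv {E : Type*} [NormedAddCommGroup E] [NormedSpace ℝ E]
    {F : E → ℂ} (hF : HasCompactSupport F) (hc : ContDiff ℝ ∞ F) (v : E) :
    HasCompactSupport (dirDeriv v F) := by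
  have : BealsWeyl.dirDeriv v F = fun x => fderiv ℝ F x v := by
    ext x
    exact (hc.differentiable (by simp) x).lineDeriv_eq_fderiv
  rw [this]
  exact hF.fderiv_apply ℝ v

lemma HasCompactSupport.dirMonomial {E ι : Type*} [NormedAddCommGroup E] [NormedSpace ℝ E]
    {F : E → ℂ} (hF : HasCompactSupport F) (hc : ContDiff ℝ ∞ F) (u : ι → E) (l : List ι)
    (k : ι → Fin 3) : HasCompactSupport (dirMonomial u l k F) := by
  induction l with
  | nil => exact hF
  | cons j l ih =>
    rw [dirMonomial_cons]
    have hcl := ContDiff.dirMonomial hc u l k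
    generalize (k j : ℕ) = r
    induction r with
    | zero => exact ih
    | succ r ihr =>
      rw [Function.iterate_succ_apply']
      exact HasCompactSupport.dirDeriv ihr (ContDiff.iterate_dirDeriv hcl _ _) _

lemma norm_coordMonomial_comp_sub (e : OrthonormalBasis (Fin n) ℝ H) (k) (φ : H × H → ℂ)
    (P M : H × H) :
    ‖coordMonomial e k (fun M => φ (P - M)) M‖ = ‖coordMonomial e k φ (P - M)‖ := by
  have h1 := dirMonomial_comp_affine φ P ((-1 : ℝ) • ContinuousLinearMap.id ℝ (H × H))
    (coordDir e) (coordList n) k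
  simp only [FunLike.coe_smul, Pi.smul_apply, ContinuousLinearMap.id_apply] at h1
  rw [dirMonomial_smul] at h1
  simp only [neg_one_smul, ← sub_eq_add_neg] at h1
  rw [coordMonomial, h1]
  simp [coordMonomial]

lemma continuous_fullWeight {ι : Type*} [Fintype ι] (k : ι → Fin 3) :
    Continuous (fullWeight k) := by
  unfold fullWeight
  have := fun i => continuous_ibpWeight (k i)
  fun_prop

/-- In effect a convolution of two integrable functions. -/
lemma integrable_integral_fullWeight_mul (e : OrthonormalBasis (Fin n) ℝ H) (h : ℝ)
    (k : Fin n ⊕ Fin n → Fin 3) {g : H × H → ℂ} (hg : Continuous g) (hgi : Integrable g) :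
    Integrable fun P => ∫ x, fullWeight k x * ‖g (P - coordMap e h x)‖ := by
  have hc : Continuous fun q : (H × H) × (Fin n ⊕ Fin n → ℝ) =>
      fullWeight k q.2 * ‖g (q.1 - coordMap e h q.2)‖ :=
    ((continuous_fullWeight k).comp continuous_snd).mul
      (hg.comp (continuous_fst.sub ((coordMap e h).continuous.comp continuous_snd))).norm
  refine Integrable.integral_prod_left
    (f := fun q : (H × H) × (Fin n ⊕ Fin n → ℝ) =>
      fullWeight k q.2 * ‖g (q.1 - coordMap e h q.2)‖) ?_
  rw [integrable_prod_iff' hc.aestronglyMeasurable]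
  refine ⟨Filter.Eventually.of_forall fun x =>
    (hgi.comp_sub_right (coordMap e h x)).norm.const_mul (fullWeight k x), ?_⟩
  have : ∀ x, ∫ P, ‖fullWeight k x * ‖g (P - coordMap e h x)‖‖ = fullWeight k x * ∫ P, ‖g P‖ :=
    fun x => by
      simp only [norm_mul, norm_norm, Real.norm_of_nonneg (fullWeight_nonneg k x)]
      rw [integral_const_mul, integral_sub_right_eq_self fun P => ‖g P‖]
  simp only [this]
  exact (integrable_fullWeight k).mul_const _

namespace IsBealsSymbol

variable {e : OrthonormalBasis (Fin n) ℝ H} {h : ℝ} {N : (Fin n ⊕ Fin n → Fin 3) → ℝ}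
  {Φ : (H × H) × (H × H) → ℂ}

/-- No derivative falls on `Φ` here. The substitution `M = P - Z` puts `φ(P - M)` in the role of the
symbol: its derivatives give the decay in `V`, and their integrals are integrable in `P`. -/
lemma integrable_mul_kernelPairing (hΦ : IsBealsSymbol e h N Φ) (hh : 0 < h)
    {φ : H × H → ℂ} (hφ : ContDiff ℝ ∞ φ) (hs : HasCompactSupport φ) :
    Integrable fun p => Φ p * kernelPairing h φ p := by
  rw [← integrable_comp_centre_iff 0]
  have hgc : ∀ k, Continuous (coordMonomial e k φ) := fun k =>
    (ContDiff.dirMonomial hφ _ _ _).continuous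
  have hgs : ∀ k, HasCompactSupport (coordMonomial e k φ) := fun k =>
    HasCompactSupport.dirMonomial hs hφ _ _ _
  have hd : Integrable fun P => ∑ k, √h ^ (∑ i, (k i : ℕ))
      * ∫ x, fullWeight k x * ‖coordMonomial e k φ (P - coordMap e h x)‖ :=
    integrable_finsetSum _ fun k _ => (integrable_integral_fullWeight_mul e h k (hgc k)
      ((hgc k).integrable_of_hasCompactSupport (hgs k))).const_mul _
  refine (((integrable_decay e hh).const_mul (N 0 * h ^ n)).mul_prod hd).mono' ?_
    (Filter.Eventually.of_forall fun q => ?_)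
  · exact (hΦ.smooth.continuous.comp (by fun_prop)).aestronglyMeasurable.mul
      (stronglyMeasurable_kernelPairing_centre hh hφ.continuous).aestronglyMeasurable
  · obtain ⟨V, P⟩ := q
    have e1 : kernelPairing h φ (centre 0 (V, P)) = ∫ M, φ (P - M) * centredKernel h V M := by
      rw [kernelPairing_centre hh,
        ← integral_sub_left_eq_self (fun Z => centredKernel h V (P - Z) * φ Z) volume P]
      simp_rw [sub_sub_cancel, mul_comm]
    have key := norm_integral_mul_centredKernel_le e hh (F := fun M => φ (P - M))
      (hφ.comp (contDiff_const.sub contDiff_id)) (fun k => by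
        obtain ⟨C, hC⟩ := (hgc k).bounded_above_of_compact_support (hgs k)
        exact ⟨C, fun M => (norm_coordMonomial_comp_sub e k φ P M).trans_le (hC _)⟩) V
    simp_rw [norm_coordMonomial_comp_sub] at key
    rw [norm_mul, e1]
    refine (mul_le_mul (hΦ.norm_comp_centre_le hh 0 (V, P)) key (norm_nonneg _)
      (mul_nonneg (hΦ.nonneg 0) (Real.exp_pos _).le)).trans_eq ?_
    have h1 : Real.exp (normSq V / h) * Real.exp (-(normSq V / h)) = 1 := by
      rw [← Real.exp_add, add_neg_cancel, Real.exp_zero]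
    linear_combination (N 0 * h ^ n * decay e h V * ∑ k, √h ^ (∑ i, (k i : ℕ))
      * ∫ x, fullWeight k x * ‖coordMonomial e k φ (P - coordMap e h x)‖) * h1

lemma isBealsTransformDistrib (hΦ : IsBealsSymbol e h N Φ) (hh : 0 < h) :
    IsBealsTransformDistrib n h Φ (bealsTransform n h Φ) := by
  intro φ hφ hs
  have h1 := hΦ.integrable_mul_kernelPairing hh hφ hs
  exact ⟨h1, hΦ.integral_bealsTransform_mul hh hφ.continuous
    (hφ.continuous.integrable_of_hasCompactSupport hs) h1⟩

end IsBealsSymbol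

end Distributions

end BealsWeyl
end

noncomputable section

open MeasureTheory

set_option linter.unusedSectionVars false

namespace BealsWeyl

/-! ### The heat operator and the diagonal values of the symbol. -/

section Heat

variable {H : Type*} [NormedAddCommGroup H] [InnerProductSpace ℝ H] {n : ℕ}
  [FiniteDimensional ℝ H] [MeasurableSpace H] [BorelSpace H]

/-- The kernel of the heat operator `H_{h/2}`, at the point `Z`. -/
def heatKernel (h : ℝ) (Z W : H × H) : ℂ :=
  ((Real.exp (-(normSq (W - Z) / h)) / (Real.pi * h) ^ Module.finrank ℝ H : ℝ) : ℂ)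

lemma heatOp_eq_integral_heatKernel {h : ℝ} (hh : 0 < h) (F : H × H → ℂ) (Z : H × H) :
    heatOp (h / 2) F Z = ∫ W, F W * heatKernel h Z W := by
  rw [heatOp, gaussianMeasure, integral_withDensity_eq_integral_toReal_smul
    (Continuous.measurable (by fun_prop)).ennreal_ofReal
    (Filter.Eventually.of_forall fun _ => by simp),
    ← integral_add_left_eq_self (fun W => F W * heatKernel h Z W) Z]
  refine integral_congr_ae (Filter.Eventually.of_forall fun Y => ?_)
  have e1 : 2 * (h / 2) = h := by ring
  have e2 : 2 * Real.pi * (h / 2) = Real.pi * h := by ring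
  beta_reduce
  rw [ENNReal.toReal_ofReal (by positivity), e1, e2, heatKernel, add_sub_cancel_left,
    Complex.real_smul, mul_comm]

lemma continuous_heatKernel (h : ℝ) (Z : H × H) : Continuous (heatKernel h Z) := by
  unfold heatKernel
  fun_prop

lemma integrable_heatKernel {h : ℝ} (hh : 0 < h) (Z : H × H) : Integrable (heatKernel h Z) :=
  (((integrable_exp_neg_normSq hh).comp_sub_right Z).div_const _).ofReal

lemma norm_bealsKernel_le {h : ℝ} (hh : 0 < h) (X Y Z : H × H) : ‖bealsKernel h X Y Z‖ ≤ 1 := by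
  have h1 : bealsKernel h X Y Z = centredKernel h ((1 / 2 : ℝ) • (X - Y))
      ((1 / 2 : ℝ) • (X + Y) - Z) := by
    rw [← bealsKernel_eq_centredKernel hh.ne' Z]
    congr 1 <;> module
  rw [h1, norm_centredKernel]
  have h2 : ∀ W : H × H, Real.exp (-(normSq W / h)) ≤ 1 := fun W => by
    rw [Real.exp_le_one_iff, neg_nonpos]
    exact div_nonneg (normSq_nonneg W) hh.le
  exact mul_le_one₀ (h2 _) (Real.exp_pos _).le (h2 _)

lemma entireOnLines_cexp_cdot (c : ℂ) (B : H × H) :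
    EntireOnLines fun W => Complex.exp (c * cdot W B) := by
  refine ⟨by fun_prop, fun A X => ?_⟩
  simp only [cdot_add_left, cdot_cmul_left]
  fun_prop

/-- With `A = Z - Y`, `B = Z - X` and `Z` moved to the origin, the two Gaussians add up to
`exp(-2|W|²/h)`. The linear term `-A·W̄/h` then makes this the reproducing kernel of width `h/2` at
the point `-A/2`, acting on the entire function `exp(-W·B̄/h)`. -/
lemma kernelPairing_heatKernel {h : ℝ} (hh : 0 < h) (Z : H × H) (p : (H × H) × (H × H)) :
    kernelPairing h (heatKernel h Z) p
      = (1 / 2 : ℂ) ^ Module.finrank ℝ H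
        * Complex.exp (-(1 / (2 * h)) * cdot (Z - p.2) (Z - p.1)
          - ((normSq (p.1 - p.2) / (2 * h) : ℝ) : ℂ)) := by
  obtain ⟨X, Y⟩ := p
  simp only
  have hhc : (h : ℂ) ≠ 0 := by exact_mod_cast hh.ne'
  have hpi : (Real.pi : ℂ) ≠ 0 := by exact_mod_cast Real.pi_ne_zero
  set A := Z - Y with hA
  set B := Z - X with hB
  set c : ℂ := Complex.exp (-(1 / h) * cdot A B - ((normSq (X - Y) / (2 * h) : ℝ) : ℂ))
    / ((Real.pi * h : ℝ) : ℂ) ^ Module.finrank ℝ H with hc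
  have hc0 : c ≠ 0 := div_ne_zero (Complex.exp_ne_zero _)
    (pow_ne_zero _ (by push_cast; exact mul_ne_zero hpi hhc))
  have hI : Integrable fun W => bealsKernel h X Y W * heatKernel h Z W :=
    (integrable_heatKernel hh Z).bdd_mul (c := 1)
      (by unfold bealsKernel; fun_prop : Continuous fun W => bealsKernel h X Y W).aestronglyMeasurable
      (Filter.Eventually.of_forall fun W => norm_bealsKernel_le hh X Y W)
  have hI' := hI.comp_add_left Z
  have hrw : ∀ W, bealsKernel h X Y (Z + W) * heatKernel h Z (Z + W)
      = c * (Complex.exp (-(1 / h) * cdot W B)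
        * Complex.exp ((cdot (-(1 / 2 : ℝ) • A) W - normSq W) / ((h / 2 : ℝ) : ℂ))) := fun W => by
    have e1 : Z + W - Y = A + W := by rw [hA]; abel
    have e2 : Z + W - X = B + W := by rw [hB]; abel
    have e0 : heatKernel h Z (Z + W) = Complex.exp ((-(normSq W / h) : ℝ) : ℂ)
        / ((Real.pi * h : ℝ) : ℂ) ^ Module.finrank ℝ H := by
      rw [heatKernel, add_sub_cancel_left, Complex.ofReal_div, Complex.ofReal_exp,
        Complex.ofReal_pow]
    rw [bealsKernel, e0, hc, e1, e2, ← mul_div_assoc, div_mul_eq_mul_div,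
      ← Complex.exp_add, ← Complex.exp_add, ← Complex.exp_add]
    congr 2
    rw [cdot_add_left, cdot_add_right, cdot_add_right, cdot_self, cdot_smul_left]
    push_cast
    field_simp
    ring
  rw [kernelPairing, ← integral_add_left_eq_self _ Z]
  simp_rw [hrw] at hI' ⊢
  rw [integral_const_mul, (entireOnLines_cexp_cdot _ B).integral_mul_cexp (half_pos hh) _
    ((integrable_const_mul_iff hc0.isUnit _).1 hI'), hc, cdot_smul_left]
  have e3 : (((Real.pi * (h / 2)) ^ Module.finrank ℝ H : ℝ) : ℂ)
      = (1 / 2 : ℂ) ^ Module.finrank ℝ H * ((Real.pi * h : ℝ) : ℂ) ^ Module.finrank ℝ H := by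
    rw [← mul_pow]
    push_cast
    congr 1
    ring
  have e4 : -(1 / (2 * h)) * cdot A B - ((normSq (X - Y) / (2 * h) : ℝ) : ℂ)
      = (-(1 / h) * cdot A B - ((normSq (X - Y) / (2 * h) : ℝ) : ℂ))
        + -(1 / h) * ((-(1 / 2) : ℝ) * cdot A B) := by
    push_cast
    field_simp
    ring
  rw [e3, e4, Complex.exp_add]
  have : ((Real.pi * h : ℝ) : ℂ) ^ Module.finrank ℝ H ≠ 0 :=
    pow_ne_zero _ (by push_cast; exact mul_ne_zero hpi hhc)
  field_simp

/-- The growth of `Φ` and that of `exp(X·Ȳ/(2h))` together use exactly half of the product Gaussian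
`exp(-(|X|² + |Y|²)/(2h))`, which gives absolute convergence. -/
lemma normSq_sub_add_re_cdot {h : ℝ} (hh : 0 < h) (X Y : H × H) :
    normSq (X - Y) / (4 * h) + (cdot X Y).re / (2 * h) = (normSq X + normSq Y) / (4 * h) := by
  rw [normSq_sub]
  field_simp
  ring

namespace IsBealsSymbol

variable {e : OrthonormalBasis (Fin n) ℝ H} {h : ℝ} {N : (Fin n ⊕ Fin n → Fin 3) → ℝ}
  {Φ : (H × H) × (H × H) → ℂ}

lemma norm_mul_cexp_cdot_le (hΦ : IsBealsSymbol e h N Φ) (hh : 0 < h) (Z X Y : H × H) :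
    ‖Φ (Z + X, Z + Y) * Complex.exp (cdot X Y / ((2 * h : ℝ) : ℂ))‖
      ≤ N 0 * Real.exp ((normSq X + normSq Y) / (4 * h)) := by
  have h1 := hΦ.norm_apply_le (Z + X, Z + Y)
  simp only [add_sub_add_left_eq_sub] at h1
  rw [norm_mul, Complex.norm_exp, Complex.div_ofReal_re, ← normSq_sub_add_re_cdot hh,
    Real.exp_add, ← mul_assoc]
  gcongr

lemma norm_mul_cexp_cdot_mul_exp_le (hΦ : IsBealsSymbol e h N Φ) (hh : 0 < h) (Z X Y : H × H) :
    ‖Φ (Z + X, Z + Y) * Complex.exp (cdot X Y / ((2 * h : ℝ) : ℂ))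
        * (Real.exp (-(normSq X / (2 * h))) : ℂ)‖
      ≤ N 0 * Real.exp (normSq Y / (4 * h)) * Real.exp (-(normSq X / (4 * h))) := by
  rw [norm_mul, Complex.norm_real, Real.norm_of_nonneg (Real.exp_pos _).le]
  refine (mul_le_mul_of_nonneg_right (hΦ.norm_mul_cexp_cdot_le hh Z X Y)
    (Real.exp_pos _).le).trans_eq ?_
  rw [mul_assoc, mul_assoc, ← Real.exp_add, ← Real.exp_add]
  congr 2
  field_simp
  ring

/-- The coupling factor is entire in `X` and equals `1` at `X = 0`, so the first mean value already
removes it. -/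
lemma integral_mul_cexp_cdot (hΦ : IsBealsSymbol e h N Φ) (hh : 0 < h)
    (hX : ∀ Y, EntireOnLines fun X => Φ (X, Y)) (Z Y : H × H) :
    ∫ X, Φ (Z + X, Z + Y) * Complex.exp (cdot X Y / ((2 * h : ℝ) : ℂ))
        * (Real.exp (-(normSq X / (2 * h))) : ℂ)
      = ((Real.pi * (2 * h)) ^ Module.finrank ℝ H : ℝ) * Φ (Z, Z + Y) := by
  have hc := hΦ.smooth.continuous
  rw [integral_mul_gaussian_of_entire (s := 2 * h) (by positivity)
    (g := fun X => Φ (Z + X, Z + Y) * Complex.exp (cdot X Y / ((2 * h : ℝ) : ℂ)))]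
  · simp [cdot]
  · fun_prop
  · intro X
    simp only [cdot_cmul_left]
    exact ((hX (Z + Y)).2 Z X).mul (by fun_prop)
  · exact ((integrable_exp_neg_normSq (s := 4 * h) (by positivity)).const_mul _).mono'
      (by fun_prop : Continuous _).aestronglyMeasurable
      (Filter.Eventually.of_forall fun X => hΦ.norm_mul_cexp_cdot_mul_exp_le hh Z X Y)

lemma integral_mul_exp_snd (hΦ : IsBealsSymbol e h N Φ) (hh : 0 < h)
    (hY : ∀ X, EntireOnLines fun Y => (starRingEnd ℂ) (Φ (X, Y))) (Z : H × H) :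
    ∫ Y, Φ (Z, Z + Y) * (Real.exp (-(normSq Y / (2 * h))) : ℂ)
      = ((Real.pi * (2 * h)) ^ Module.finrank ℝ H : ℝ) * Φ (Z, Z) := by
  have hc := hΦ.smooth.continuous
  rw [integral_mul_gaussian_of_conj_entire (s := 2 * h) (by positivity)
    (g := fun Y => Φ (Z, Z + Y)) (by fun_prop) (hY Z |>.2 Z)]
  · simp
  · refine ((integrable_exp_neg_normSq (s := 4 * h) (by positivity)).const_mul (N 0)).mono'
      (by fun_prop : Continuous _).aestronglyMeasurable
      (Filter.Eventually.of_forall fun Y => ?_)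
    have h1 := hΦ.norm_apply_le (Z, Z + Y)
    simp only [sub_add_cancel_left, normSq_neg] at h1
    rw [norm_mul, Complex.norm_real, Real.norm_of_nonneg (Real.exp_pos _).le]
    refine (mul_le_mul_of_nonneg_right h1 (Real.exp_pos _).le).trans_eq ?_
    rw [mul_assoc, ← Real.exp_add]
    congr 2
    field_simp
    ring

/-- Expanding `|X - Y|²` cancels the term in `Y·X̄`. Only `X·Ȳ` survives, holomorphic in `X` and
antiholomorphic in `Y` just as `Φ` is. -/
lemma mul_kernelPairing_heatKernel (hh : 0 < h) (Z : H × H) (q : (H × H) × (H × H)) :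
    Φ ((Z, Z) + q) * kernelPairing h (heatKernel h Z) ((Z, Z) + q)
      = (1 / 2 : ℂ) ^ Module.finrank ℝ H
        * (Φ (Z + q.1, Z + q.2) * Complex.exp (cdot q.1 q.2 / ((2 * h : ℝ) : ℂ))
          * (Real.exp (-(normSq q.1 / (2 * h))) : ℂ)
          * (Real.exp (-(normSq q.2 / (2 * h))) : ℂ)) := by
  obtain ⟨X, Y⟩ := q
  have hhc : (h : ℂ) ≠ 0 := by exact_mod_cast hh.ne'
  rw [kernelPairing_heatKernel hh, Complex.ofReal_exp, Complex.ofReal_exp, mul_assoc (_ * _),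
    mul_assoc (Φ _), ← Complex.exp_add, ← Complex.exp_add, mul_left_comm]
  simp only [Prod.mk_add_mk, sub_add_cancel_left, add_sub_add_left_eq_sub]
  congr 3
  push_cast
  rw [← cdot_self (X - Y), cdot_neg_left, cdot_neg_right, cdot_sub_left, cdot_sub_right,
    cdot_sub_right, cdot_self, cdot_self]
  field_simp
  ring

lemma integrable_mul_gaussians (hΦ : IsBealsSymbol e h N Φ) (hh : 0 < h) (Z : H × H) :
    Integrable fun q : (H × H) × (H × H) =>
      Φ (Z + q.1, Z + q.2) * Complex.exp (cdot q.1 q.2 / ((2 * h : ℝ) : ℂ))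
        * (Real.exp (-(normSq q.1 / (2 * h))) : ℂ)
        * (Real.exp (-(normSq q.2 / (2 * h))) : ℂ) := by
  have hc := hΦ.smooth.continuous
  refine ((integrable_exp_neg_normSq_prod (s := 4 * h) (by positivity)).const_mul (N 0)).mono'
    (by fun_prop : Continuous _).aestronglyMeasurable (Filter.Eventually.of_forall fun q => ?_)
  rw [norm_mul _ (Complex.ofReal _), Complex.norm_real,
    Real.norm_of_nonneg (Real.exp_pos _).le]
  refine (mul_le_mul_of_nonneg_right (hΦ.norm_mul_cexp_cdot_mul_exp_le hh Z q.1 q.2)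
    (Real.exp_pos _).le).trans_eq ?_
  rw [mul_assoc, mul_assoc, ← Real.exp_add, ← Real.exp_add]
  congr 2
  field_simp
  ring

lemma integrable_mul_kernelPairing_heatKernel (hΦ : IsBealsSymbol e h N Φ) (hh : 0 < h)
    (Z : H × H) : Integrable fun p => Φ p * kernelPairing h (heatKernel h Z) p := by
  have h1 := (hΦ.integrable_mul_gaussians hh Z).const_mul ((1 / 2 : ℂ) ^ Module.finrank ℝ H)
  simp_rw [← mul_kernelPairing_heatKernel hh Z] at h1
  simpa only [add_neg_cancel_left] using h1.comp_add_left (-(Z, Z))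

lemma integral_mul_kernelPairing_heatKernel (hΦ : IsBealsSymbol e h N Φ) (hh : 0 < h)
    (hX : ∀ Y, EntireOnLines fun X => Φ (X, Y))
    (hY : ∀ X, EntireOnLines fun Y => (starRingEnd ℂ) (Φ (X, Y))) (Z : H × H) :
    ∫ p, Φ p * kernelPairing h (heatKernel h Z) p
      = (1 / 2 : ℂ) ^ Module.finrank ℝ H
        * (((Real.pi * (2 * h)) ^ Module.finrank ℝ H : ℝ)
          * (((Real.pi * (2 * h)) ^ Module.finrank ℝ H : ℝ) * Φ (Z, Z))) := by
  rw [← integral_add_left_eq_self _ (Z, Z)]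
  simp_rw [mul_kernelPairing_heatKernel hh Z]
  rw [integral_const_mul]
  congr 1
  refine (integral_prod_symm _ (hΦ.integrable_mul_gaussians hh Z)).trans ?_
  simp_rw [integral_mul_const, hΦ.integral_mul_cexp_cdot hh hX, mul_assoc, integral_const_mul,
    hΦ.integral_mul_exp_snd hh hY]

/-- The two mean values give `(2πh)^{2n}` and the kernel pairing `2^{-n}`; the normalization `2ⁿ
(2πh)^{-2n}` is their inverse. -/
lemma heatOp_bealsTransform (hΦ : IsBealsSymbol e h N Φ) (hh : 0 < h)
    (hX : ∀ Y, EntireOnLines fun X => Φ (X, Y))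
    (hY : ∀ X, EntireOnLines fun Y => (starRingEnd ℂ) (Φ (X, Y))) (Z : H × H) :
    heatOp (h / 2) (bealsTransform n h Φ) Z = Φ (Z, Z) := by
  rw [heatOp_eq_integral_heatKernel hh, hΦ.integral_bealsTransform_mul hh
    (continuous_heatKernel h Z) (integrable_heatKernel hh Z)
    (hΦ.integrable_mul_kernelPairing_heatKernel hh Z),
    hΦ.integral_mul_kernelPairing_heatKernel hh hX hY, finrank_eq e, bealsConst]
  have hhc : (h : ℂ) ≠ 0 := by exact_mod_cast hh.ne'
  have hpi : (Real.pi : ℂ) ≠ 0 := by exact_mod_cast Real.pi_ne_zero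
  push_cast
  rw [two_mul n, pow_add, one_div, inv_pow, mul_left_comm (Real.pi : ℂ) 2, ← mul_assoc (2 : ℂ)]
  field_simp

end IsBealsSymbol

end Heat

end BealsWeyl
end

noncomputable section

open MeasureTheory

set_option linter.unusedSectionVars false

namespace BealsWeyl

/-! ### From the extended-valued norms to symbol bounds. -/

section Norms

variable {H : Type*} [NormedAddCommGroup H] [InnerProductSpace ℝ H] {n : ℕ}

/-- The weighted sup norm of the diagonal derivative of multi-index `k`, as a real number. -/
def derivBound (h : ℝ) (e : OrthonormalBasis (Fin n) ℝ H) (Φ : (H × H) × (H × H) → ℂ)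
    (k : Fin n ⊕ Fin n → Fin 3) : ℝ :=
  (weightedSup h e (fun j => k (Sum.inl j)) (fun j => k (Sum.inr j)) Φ).toReal

lemma sum_sumElim {M : Type*} [AddCommMonoid M] (f : (Fin n → Fin 3) → (Fin n → Fin 3) → M) :
    ∑ k : Fin n ⊕ Fin n → Fin 3, f (fun j => k (Sum.inl j)) (fun j => k (Sum.inr j))
      = ∑ α, ∑ β, f α β := by
  rw [← Fintype.sum_prod_type']
  exact Fintype.sum_equiv (Equiv.sumArrowEquivProdArrow _ _ _) _ _ fun k => rfl

variable {h : ℝ} {e : OrthonormalBasis (Fin n) ℝ H} {Φ : (H × H) × (H × H) → ℂ}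

lemma weightedSup_lt_top (hfin : derivNorm h e Φ < ⊤) (α β : Fin n → Fin 3) :
    weightedSup h e α β Φ < ⊤ :=
  ENNReal.sum_lt_top.1 (ENNReal.sum_lt_top.1 hfin α (Finset.mem_univ α)) β (Finset.mem_univ β)

lemma norm_dirMonomial_le_derivBound (hfin : derivNorm h e Φ < ⊤) (k : Fin n ⊕ Fin n → Fin 3)
    (p : (H × H) × (H × H)) :
    ‖dirMonomial (fun i => (coordDir e i, coordDir e i)) (coordList n) k Φ p‖
      ≤ derivBound h e Φ k * Real.exp (normSq (p.1 - p.2) / (4 * h)) := by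
  rw [← diagMultiDeriv_eq_dirMonomial]
  have h1 := (ENNReal.ofReal_le_iff_le_toReal (weightedSup_lt_top hfin _ _).ne).1
    (le_iSup (fun p : (H × H) × (H × H) =>
      ENNReal.ofReal (Real.exp (-(normSq (p.1 - p.2) / (4 * h)))
        * ‖diagMultiDeriv e (fun j => k (Sum.inl j)) (fun j => k (Sum.inr j)) Φ p‖)) p)
  rwa [Real.exp_neg, inv_mul_le_iff₀ (Real.exp_pos _), mul_comm] at h1

lemma scaledSum_derivBound (hfin : derivNorm h e Φ < ⊤) :
    scaledSum h (derivBound h e Φ) = (scaledDerivNorm h e Φ).toReal := by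
  have h1 : ∀ α β : Fin n → Fin 3,
      ENNReal.ofReal (√h ^ (∑ j, ((α j : ℕ) + (β j : ℕ)))) * weightedSup h e α β Φ ≠ ⊤ :=
    fun α β => ENNReal.mul_ne_top ENNReal.ofReal_ne_top (weightedSup_lt_top hfin α β).ne
  rw [scaledDerivNorm, ← sum_sumElim fun α β =>
    ENNReal.ofReal (√h ^ (∑ j, ((α j : ℕ) + (β j : ℕ)))) * weightedSup h e α β Φ,
    ENNReal.toReal_sum fun k _ => h1 _ _, scaledSum]
  refine Finset.sum_congr rfl fun k _ => ?_
  rw [ENNReal.toReal_mul, ENNReal.toReal_ofReal (by positivity), Fintype.sum_sum_type,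
    Finset.sum_add_distrib, derivBound]

lemma scaledDerivNorm_le_derivNorm (hh1 : h ≤ 1) :
    scaledDerivNorm h e Φ ≤ derivNorm h e Φ := by
  refine Finset.sum_le_sum fun α _ => Finset.sum_le_sum fun β _ => mul_le_of_le_one_left' ?_
  rw [ENNReal.ofReal_le_one]
  exact pow_le_one₀ (Real.sqrt_nonneg h) (Real.sqrt_le_one.2 hh1)

variable [FiniteDimensional ℝ H] [MeasurableSpace H] [BorelSpace H]

/-- Smoothness uses only the bound for the zero multi-index, that is, on `Φ` itself. -/
lemma isBealsSymbol_derivBound (hh : 0 < h) (hX : ∀ Y, EntireOnLines fun X => Φ (X, Y))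
    (hY : ∀ X, EntireOnLines fun Y => (starRingEnd ℂ) (Φ (X, Y)))
    (hfin : derivNorm h e Φ < ⊤) : IsBealsSymbol e h (derivBound h e Φ) Φ where
  smooth := contDiff_of_entireOnLines hh hX hY fun p => by
    simpa only [dirMonomial_zero] using norm_dirMonomial_le_derivBound hfin 0 p
  bound := norm_dirMonomial_le_derivBound hfin

end Norms

end BealsWeyl
end

theorem theorem5p1 :
    ∃ K : ℝ, 0 < K ∧
      ∀ (n : ℕ) (H : Type*) [NormedAddCommGroup H] [InnerProductSpace ℝ H]
        [FiniteDimensional ℝ H] [MeasurableSpace H] [BorelSpace H]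
        (e : OrthonormalBasis (Fin n) ℝ H) (h : ℝ) (_ : 0 < h)
        (Φ : (H × H) × (H × H) → ℂ)
        (_ : ∀ Y : H × H, BealsWeyl.IsHolomorphic fun X => Φ (X, Y))
        (_ : ∀ X : H × H, BealsWeyl.IsAntiholomorphic fun Y => Φ (X, Y))
        (_ : BealsWeyl.derivNorm h e Φ < ⊤),
        ∃ B : (H × H) →ᵇ ℂ,
          BealsWeyl.IsBealsTransform n h Φ B ∧
          BealsWeyl.IsBealsTransformDistrib n h Φ B ∧
          ‖B‖ ≤ K ^ n * (BealsWeyl.scaledDerivNorm h e Φ).toReal ∧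
          (h ≤ 1 → ‖B‖ ≤ K ^ n * (BealsWeyl.derivNorm h e Φ).toReal) ∧
          ∀ Z : H × H, BealsWeyl.heatOp (h / 2) B Z = Φ (Z, Z) := by
  -- The bound for the transform holds with `weightBound ^ 2 / 2`; adding `1` makes positivity
  -- immediate.
  refine ⟨BealsWeyl.weightBound ^ 2 / 2 + 1, by positivity, ?_⟩
  intro n H _ _ _ _ _ e h hh Φ hhol hanti hfin
  have hX := fun Y => (hhol Y).entireOnLines
  have hY := fun X => (hanti X).conj.entireOnLines
  have hΦ := BealsWeyl.isBealsSymbol_derivBound hh hX hY hfin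
  have hb : ∀ Z, ‖BealsWeyl.bealsTransform n h Φ Z‖
      ≤ (BealsWeyl.weightBound ^ 2 / 2 + 1) ^ n * (BealsWeyl.scaledDerivNorm h e Φ).toReal :=
    fun Z => by
      refine (hΦ.norm_bealsTransform_le hh Z).trans ?_
      rw [BealsWeyl.scaledSum_derivBound hfin]
      gcongr
      exact le_add_of_nonneg_right zero_le_one
  let B : (H × H) →ᵇ ℂ := BoundedContinuousFunction.ofNormedAddCommGroup
    (BealsWeyl.bealsTransform n h Φ) (hΦ.continuous_bealsTransform hh) _ hb
  have hB : ‖B‖ ≤ (BealsWeyl.weightBound ^ 2 / 2 + 1) ^ n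
      * (BealsWeyl.scaledDerivNorm h e Φ).toReal :=
    (B.norm_le (by positivity)).2 hb
  refine ⟨B, hΦ.isBealsTransform hh, hΦ.isBealsTransformDistrib hh, hB, fun hh1 => ?_,
    hΦ.heatOp_bealsTransform hh hX hY⟩
  refine hB.trans ?_
  gcongr
  · exact hfin.ne
  · exact BealsWeyl.scaledDerivNorm_le_derivNorm hh1
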